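/- Let $(\Omega,\mathcal F,\mathbb P)$ be a probability space carrying a real Lévy process $X$ with càdlàg paths, $X_0=0$ a.s. and $\mathbb E[e^{i\lambda X_t}]=e^{-t\Psi(\lambda)}$, where $$\Psi(\lambda)=-i\gamma\lambda+\tfrac12\sigma^2\lambda^2+\int_{\mathbb R\setminus\{0\}}\bigl(1-e^{i\lambda z}+i\lambda z1_{\{|z|<1\}}\bigr)\Pi(dz),$$ $\gamma\in\mathbb R$, $\sigma\ge0$, $\int(1\wedge z^2)\Pi(dz)<\infty$; $\mathbb P_x$ denotes the law under which $X$ is replaced by $x+X$. Let $0=T(0)<T(1)<T(2)<\cdots$, where $T(1),T(2),\dots$ are the arrival times of a Poisson process of rate $\eta>0$ independent of $X$. Let $q>0$, $C\in\mathbb R$ and $f:\mathbb R\to\mathbb R$. Assume: * $f$ is convex, $|f(x)|\le k_1+k_2|x|^N$ for some constants $k_1,k_2$ and $N\in\mathbb N$, and $\lim_{x\to-\infty}f'_+(x)<-Cq<\lim_{x\to\infty}f'_+(x)$, where $f'_+$ is the right derivative and the limits may be infinite; * $X$ is not a driftless compound Poisson process (in particular $X\not\equiv0$), and $\int_{\mathbb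 R\setminus(-1,1)}e^{\bar\theta|z|}\Pi(dz)<\infty$ for some $\bar\theta>0$. For $b\in\mathbb R$ the periodic barrier strategy at $b$ is defined as follows. Put $T_b^{(0)}=0$, $\tilde X^{(0),b}_t=X_t$, and for $n\ge1$ $$T_b^{(n)}=\inf\{t\in\{T(k):k\ge1\}:\ t>T_b^{(n-1)},\ \tilde X^{(n-1),b}_t<b\},\qquad \tilde X^{(n),b}_t=b+X_t-X_{T_b^{(n)}},$$ with $\inf\emptyset=\infty$. Let $$R^b_t=\sum_{n\ge1}\bigl(b-\tilde X^{(n-1),b}_{T_b^{(n)}}\bigr)1_{\{T_b^{(n)}\le t\}},\qquad U^b_t=X_t+R^b_t,$$ $$v_b(x)=\mathbb E_x\Bigl[\int_0^\infty e^{-qt}f(U^b_t)\,dt+C\int_{[0,\infty)}e^{-qt}\,dR^b_t\Bigr],\qquad \rho(b)=\mathbb E_b\Bigl[\int_0^\infty e^{-qt}f'_+(U^b_t)\,dt\Bigr],$$ $$b^*=\inf\{b\in\mathbb R:\rho(b)+C\ge0\},\qquad \mathcal Mg(x)=\inf_{l\ge0}\{Cl+g(x+l)\}\in[-\infty,\infty).$$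 Then these quantities are well defined: $\mathbb E_b[\int_0^\infty e^{-qt}|f'_+(U^b_t)|\,dt]<\infty$ for all $b\in\mathbb R$, the set defining $b^*$ is nonempty and bounded below (so $b^*\in\mathbb R$), and $\mathbb E_x[\int_0^\infty e^{-qt}|f(U^{b^*}_t)|\,dt]<\infty$ and $\mathbb E_x[\int_{[0,\infty)}e^{-qt}\,dR^{b^*}_t]<\infty$ for all $x\in\mathbb R$. Moreover $$\mathcal Mv_{b^*}(x)=C(b^*-x)^++v_{b^*}(x\vee b^*)\qquad\text{for all }x\in\mathbb R.$$ -/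

import Mathlib

open MeasureTheory ProbabilityTheory Set Filter Topology
open scoped NNReal ENNReal

namespace PeriodicBarrier

noncomputable section

/-! ### Lévy processes -/

/-- A path that is right-continuous with left limits. -/
def IsCadlag (p : ℝ≥0 → ℝ) : Prop :=
  ∀ t, ContinuousWithinAt p (Ici t) t ∧ ∃ l, Tendsto p (𝓝[<] t) (𝓝 l)

/-- `Λ` is a Lévy measure: a measure on `ℝ \ {0}` that integrates `1 ∧ z²`. -/
def IsLevyMeasure (Λ : Measure ℝ) : Prop :=
  Λ {0} = 0 ∧ ∫⁻ z, ENNReal.ofReal (min 1 (z ^ 2)) ∂Λ < ∞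

/-- The exponent
`Ψ(ξ) = -iγξ + σ²ξ²/2 + ∫ (1 - e^{iξz} + iξz 1_{|z|<1}) Λ(dz)`. -/
def levyExponent (γ σ : ℝ) (Λ : Measure ℝ) (ξ : ℝ) : ℂ :=
  -(Complex.I * γ * ξ) + (σ ^ 2 * ξ ^ 2 / 2 : ℝ) +
    ∫ z : ℝ, (1 - Complex.exp (Complex.I * ξ * z)
      + (if |z| < 1 then Complex.I * ξ * z else 0)) ∂Λ

/-- `X` is a real Lévy process started at `0` whose characteristic exponent
(`E[e^{iξX_t}] = e^{-tΨ(ξ)}`) has the triplet `(γ, σ, Λ)`. -/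
structure IsLevyProcess {Ω : Type*} [MeasurableSpace Ω] (P : Measure Ω)
    (X : ℝ≥0 → Ω → ℝ) (γ σ : ℝ) (Λ : Measure ℝ) : Prop where
  measurable : ∀ t, Measurable (X t)
  start_zero : ∀ᵐ ω ∂P, X 0 ω = 0
  indep_increments : HasIndepIncrements X P
  stationary_increments : ∀ s t, IdentDistrib (fun ω => X (s + t) ω - X s ω) (X t) P P
  cadlag : ∀ᵐ ω ∂P, IsCadlag (fun t => X t ω)
  sigma_nonneg : 0 ≤ σ
  levy_measure : IsLevyMeasure Λ
  charFun_eq : ∀ (t : ℝ≥0) (ξ : ℝ),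
    charFun (P.map (X t)) ξ = Complex.exp (-((t : ℝ) * levyExponent γ σ Λ ξ))

/-- The triplet of a compound Poisson process without drift: no Gaussian part, finite Lévy measure
and `γ = ∫_{|z|<1} z Λ(dz)`, so that the exponent is `∫ (1 - e^{iξz}) Λ(dz)`.
The zero process is the case `Λ = 0`. -/
def IsDriftlessCompoundPoisson (γ σ : ℝ) (Λ : Measure ℝ) : Prop :=
  σ = 0 ∧ Λ univ < ∞ ∧ γ = ∫ z in Ioo (-1 : ℝ) 1, z ∂Λ

/-- `T 0 = 0` and `T 1, T 2, …` are the arrival times of a Poisson process of rate `η`: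
the interarrival times are independent and exponentially distributed with parameter `η`. -/
structure IsPoissonArrivals {Ω : Type*} [MeasurableSpace Ω] (P : Measure Ω)
    (T : ℕ → Ω → ℝ≥0) (η : ℝ) : Prop where
  measurable : ∀ k, Measurable (T k)
  start_zero : ∀ ω, T 0 ω = 0
  indep : iIndepFun (fun (k : ℕ) ω => (T (k + 1) ω : ℝ) - T k ω) P
  law : ∀ k : ℕ, P.map (fun ω => (T (k + 1) ω : ℝ) - T k ω) = expMeasure η

/-! ### The running cost -/

/-- The right-hand derivative `f'₊`. -/
def rightDeriv (f : ℝ → ℝ) (x : ℝ) : ℝ := derivWithin f (Ioi x) x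

/-- The assumptions on the running cost `f` and the unit cost `C`: convexity, polynomial growth,
and `f'₊(-∞) < -Cq < f'₊(∞)` for the (possibly infinite) limits of `f'₊`. -/
structure CostAssumption (f : ℝ → ℝ) (C q : ℝ) : Prop where
  convex : ConvexOn ℝ univ f
  growth : ∃ (k₁ k₂ : ℝ) (N : ℕ), ∀ x, |f x| ≤ k₁ + k₂ * |x| ^ N
  slope_atBot : ∃ l : EReal, Tendsto (fun x => (rightDeriv f x : EReal)) atBot (𝓝 l) ∧
    l < ((-(C * q) : ℝ) : EReal)
  slope_atTop : ∃ l : EReal, Tendsto (fun x => (rightDeriv f x : EReal)) atTop (𝓝 l) ∧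
    ((-(C * q) : ℝ) : EReal) < l

/-! ### The periodic barrier strategy along one path

Here `p` is a path of the uncontrolled process, `τ 1, τ 2, …` are the control opportunities and `b`
is the barrier. -/

/-- The path `X̃^{(m),b}`, where `s` stands for the `m`-th control time: the path `p` itself if
`m = 0`, and `p` shifted so as to start from `b` at time `s` if `m ≥ 1`. -/
def shiftedPath (p : ℝ≥0 → ℝ) (b : ℝ) (m : ℕ) (s : ℝ≥0∞) (t : ℝ≥0) : ℝ :=
  if m = 0 then p t else b + (p t - p s.toNNReal)

/-- The control times `T_b^{(n)}` (`∞` if there is no `n`-th control): `T_b^{(0)} = 0`, and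
`T_b^{(n+1)}` is the first control opportunity after `T_b^{(n)}` at which the controlled path is
observed below `b`. -/
def controlTime (p : ℝ≥0 → ℝ) (τ : ℕ → ℝ≥0) (b : ℝ) : ℕ → ℝ≥0∞
  | 0 => 0
  | n + 1 => sInf {t : ℝ≥0∞ | ∃ k : ℕ, 1 ≤ k ∧ t = τ k ∧ controlTime p τ b n < t ∧
      shiftedPath p b n (controlTime p τ b n) (τ k) < b}

/-- The size `b - X̃^{(n),b}` of the control at the time `T_b^{(n+1)}`
(used only if that time is finite). -/
def controlSize (p : ℝ≥0 → ℝ) (τ : ℕ → ℝ≥0) (b : ℝ) (n : ℕ) : ℝ :=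
  b - shiftedPath p b n (controlTime p τ b n) (controlTime p τ b (n + 1)).toNNReal

open Classical in
/-- The control process `R^b_t`: the sum of the controls made up to time `t`. -/
def control (p : ℝ≥0 → ℝ) (τ : ℕ → ℝ≥0) (b : ℝ) (t : ℝ≥0) : ℝ :=
  ∑' n : ℕ, if controlTime p τ b (n + 1) ≤ t then controlSize p τ b n else 0

open Classical in
/-- The measure `dR^b` on `[0, ∞)`: a mass of the size of the control at each finite control
time. -/
def controlMeasure (p : ℝ≥0 → ℝ) (τ : ℕ → ℝ≥0) (b : ℝ) : Measure ℝ≥0 :=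
  Measure.sum fun n : ℕ =>
    if controlTime p τ b (n + 1) < ∞ then
      ENNReal.ofReal (controlSize p τ b n) •
        Measure.dirac (controlTime p τ b (n + 1)).toNNReal
    else 0

/-- The controlled path `U^b_t = X_t + R^b_t`. -/
def controlled (p : ℝ≥0 → ℝ) (τ : ℕ → ℝ≥0) (b : ℝ) (t : ℝ≥0) : ℝ :=
  p t + control p τ b t

/-! ### Expected costs

The process started at `x` is `x + X`, where `X` starts at `0`. -/

variable {Ω : Type*} [MeasurableSpace Ω]

/-- The controlled process `U^b_t` under the periodic barrier strategy at `b`, started at `x`. -/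
def U (X : ℝ≥0 → Ω → ℝ) (T : ℕ → Ω → ℝ≥0) (b x : ℝ) (t : ℝ≥0) (ω : Ω) : ℝ :=
  controlled (fun s => x + X s ω) (fun k => T k ω) b t

/-- The random measure `dR^b` for the process started at `x`. -/
def dR (X : ℝ≥0 → Ω → ℝ) (T : ℕ → Ω → ℝ≥0) (b x : ℝ) (ω : Ω) : Measure ℝ≥0 :=
  controlMeasure (fun s => x + X s ω) (fun k => T k ω) b

/-- `E_x[∫₀^∞ e^{-qt} |g(U^b_t)| dt] < ∞`. -/
def HasFiniteRunningCost (P : Measure Ω) (X : ℝ≥0 → Ω → ℝ) (T : ℕ → Ω → ℝ≥0) (q : ℝ)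
    (g : ℝ → ℝ) (b x : ℝ) : Prop :=
  Integrable (fun y : Ω × ℝ => Real.exp (-(q * y.2)) * g (U X T b x y.2.toNNReal y.1))
    (P.prod (volume.restrict (Ioi 0)))

/-- `E_x[∫_{[0,∞)} e^{-qt} dR^b_t] < ∞`. -/
def HasFiniteControlCost (P : Measure Ω) (X : ℝ≥0 → Ω → ℝ) (T : ℕ → Ω → ℝ≥0) (q : ℝ)
    (b x : ℝ) : Prop :=
  (∀ᵐ ω ∂P, Integrable (fun t : ℝ≥0 => Real.exp (-(q * t))) (dR X T b x ω)) ∧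
  Integrable (fun ω => ∫ t : ℝ≥0, Real.exp (-(q * t)) ∂(dR X T b x ω)) P

/-- The expected total cost
`v_b(x) = E_x[∫₀^∞ e^{-qt} f(U^b_t) dt + C ∫_{[0,∞)} e^{-qt} dR^b_t]`. -/
def cost (P : Measure Ω) (X : ℝ≥0 → Ω → ℝ) (T : ℕ → Ω → ℝ≥0) (q C : ℝ) (f : ℝ → ℝ)
    (b x : ℝ) : ℝ :=
  ∫ ω, ((∫ t in Ioi (0 : ℝ), Real.exp (-(q * t)) * f (U X T b x t.toNNReal ω))
    + C * ∫ t : ℝ≥0, Real.exp (-(q * t)) ∂(dR X T b x ω)) ∂P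

/-- `ρ(b) = E_b[∫₀^∞ e^{-qt} f'₊(U^b_t) dt]`. -/
def rho (P : Measure Ω) (X : ℝ≥0 → Ω → ℝ) (T : ℕ → Ω → ℝ≥0) (q : ℝ) (f : ℝ → ℝ) (b : ℝ) : ℝ :=
  ∫ ω, (∫ t in Ioi (0 : ℝ), Real.exp (-(q * t)) * rightDeriv f (U X T b b t.toNNReal ω)) ∂P

/-- The set `{b : ρ(b) + C ≥ 0}`. -/
def barrierSet (P : Measure Ω) (X : ℝ≥0 → Ω → ℝ) (T : ℕ → Ω → ℝ≥0) (q C : ℝ) (f : ℝ → ℝ) :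
    Set ℝ :=
  {b | 0 ≤ rho P X T q f b + C}

/-- The barrier `b* = inf {b : ρ(b) + C ≥ 0}`. -/
def bStar (P : Measure Ω) (X : ℝ≥0 → Ω → ℝ) (T : ℕ → Ω → ℝ≥0) (q C : ℝ) (f : ℝ → ℝ) : ℝ :=
  sInf (barrierSet P X T q C f)

/-- The intervention operator `Mg(x) = inf_{l ≥ 0} (C l + g(x + l))`, with values in the extended
reals. -/
def interventionOp (C : ℝ) (g : ℝ → ℝ) (x : ℝ) : EReal :=
  ⨅ (l : ℝ) (_ : 0 ≤ l), ((C * l + g (x + l) : ℝ) : EReal)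

end

end PeriodicBarrier

namespace PeriodicBarrier

section

open scoped ContDiff

/-! ### Moments from the smoothness of the characteristic function -/

lemma exists_norm_symmetric_difference_le {φ : ℝ → ℂ} (hφ : ContDiff ℝ ∞ φ) :
    ∃ K : ℝ, ∀ h ∈ Icc (0 : ℝ) 1, ‖φ h + φ (-h) - 2 * φ 0‖ ≤ K * h ^ 2 := by
  have hg : ContDiff ℝ ∞ (fun h => φ h + φ (-h)) := by fun_prop
  obtain ⟨K, hK⟩ := exists_taylor_mean_remainder_bound (f := fun h => φ h + φ (-h)) (n := 1)
    (zero_le_one (α := ℝ)) (hg.contDiffOn.of_le (by norm_num; exact ENat.LEInfty.out))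
  refine ⟨K, fun h hh => ?_⟩
  have h1 := hK h hh
  have hd : derivWithin (fun h => φ h + φ (-h)) (Icc 0 1) 0 = 0 := by
    have hφd : HasDerivAt φ (deriv φ 0) 0 := (hφ.differentiable (by simp) 0).hasDerivAt
    have h2 : HasDerivAt (fun h => φ (-h)) (-deriv φ 0) 0 := by
      have h3 : HasDerivAt φ (deriv φ 0) (-(0 : ℝ)) := by simpa using hφd
      have h5 := HasDerivAt.scomp (0 : ℝ) h3 (hasDerivAt_neg (0 : ℝ))
      rw [neg_one_smul] at h5
      exact h5
    have h4 := hφd.add h2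
    rw [add_neg_cancel] at h4
    exact h4.hasDerivWithinAt.derivWithin (uniqueDiffOn_Icc zero_lt_one 0 (by simp))
  have h5 : taylorWithinEval (fun h => φ h + φ (-h)) 1 (Icc 0 1) 0 h = 2 * φ 0 := by
    rw [taylorWithinEval_succ, taylor_within_zero_eval, iteratedDerivWithin_one, hd]
    simp [two_mul]
  rw [h5] at h1
  simpa using h1

lemma integral_two_sub_two_cos (μ : Measure ℝ) [IsFiniteMeasure μ] (h : ℝ) :
    ∫ x, (2 - 2 * Real.cos (h * x)) ∂μ = -(charFun μ h + charFun μ (-h) - 2 * charFun μ 0).re := by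
  have hi : ∀ t : ℝ, Integrable (fun x : ℝ => Complex.exp (t * x * Complex.I)) μ := fun t =>
    Integrable.of_bound (by fun_prop) 1 (Eventually.of_forall fun x => by
      rw [← Complex.ofReal_mul, Complex.norm_exp_ofReal_mul_I])
  have hadd : Integrable (fun x : ℝ => Complex.exp (h * x * Complex.I) +
      Complex.exp ((-h : ℝ) * x * Complex.I)) μ := (hi h).add (hi (-h))
  have hsub : Integrable (fun x : ℝ => Complex.exp (h * x * Complex.I) +
      Complex.exp ((-h : ℝ) * x * Complex.I) - 2 * Complex.exp ((0 : ℝ) * x * Complex.I)) μ :=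
    hadd.sub ((hi 0).const_mul 2)
  have hs : charFun μ h + charFun μ (-h) - 2 * charFun μ 0 =
      ∫ x : ℝ, (Complex.exp (h * x * Complex.I) + Complex.exp ((-h : ℝ) * x * Complex.I) -
        2 * Complex.exp ((0 : ℝ) * x * Complex.I)) ∂μ := by
    rw [integral_sub hadd ((hi 0).const_mul 2), integral_const_mul,
      integral_add (hi h) (hi (-h))]
    simp only [charFun_apply_real]
  rw [hs, ← RCLike.re_eq_complex_re, ← integral_re hsub, ← integral_neg]
  refine integral_congr_ae (Eventually.of_forall fun x => ?_)
  dsimp only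
  have e1 : (h : ℂ) * x * Complex.I = ((h * x : ℝ) : ℂ) * Complex.I := by push_cast; ring
  have e2 : ((-h : ℝ) : ℂ) * x * Complex.I = ((-(h * x) : ℝ) : ℂ) * Complex.I := by
    push_cast; ring
  simp only [RCLike.re_eq_complex_re, e1, e2, Complex.sub_re, Complex.add_re,
    Complex.exp_ofReal_mul_I_re, Real.cos_neg]
  simp
  ring

lemma tendsto_two_sub_two_cos_div (x : ℝ) :
    Tendsto (fun n : ℕ => (2 - 2 * Real.cos ((1 / ((n : ℝ) + 1)) * x)) / (1 / ((n : ℝ) + 1)) ^ 2)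
      atTop (𝓝 (x ^ 2)) := by
  have h0 : Tendsto (fun n : ℕ => (1 / ((n : ℝ) + 1)) * x / 2) atTop (𝓝 0) := by
    have := (tendsto_one_div_add_atTop_nhds_zero_nat (𝕜 := ℝ)).mul_const (x / 2)
    simpa [mul_div_assoc] using this
  have h1 : Tendsto (fun n : ℕ => (x * Real.sinc ((1 / ((n : ℝ) + 1)) * x / 2)) ^ 2) atTop
      (𝓝 ((x * Real.sinc 0) ^ 2)) :=
    (((Real.continuous_sinc.tendsto 0).comp h0).const_mul x).pow 2
  rw [Real.sinc_zero, mul_one] at h1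
  refine h1.congr fun n => ?_
  have hn : (0 : ℝ) < 1 / ((n : ℝ) + 1) := by positivity
  set h := 1 / ((n : ℝ) + 1)
  have hc : 2 - 2 * Real.cos (h * x) = 4 * Real.sin (h * x / 2) ^ 2 := by
    have : h * x = 2 * (h * x / 2) := by ring
    rw [this, Real.cos_two_mul, Real.cos_sq']
    ring_nf
  rw [hc]
  rcases eq_or_ne x 0 with rfl | hx
  · simp
  · rw [Real.sinc_of_ne_zero (by positivity)]
    field_simp
    ring

lemma lintegral_sq_lt_top (μ : Measure ℝ) [IsFiniteMeasure μ] (hφ : ContDiff ℝ ∞ (charFun μ)) :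
    ∫⁻ x, ENNReal.ofReal (x ^ 2) ∂μ < ⊤ := by
  obtain ⟨K, hK⟩ := exists_norm_symmetric_difference_le hφ
  set F : ℕ → ℝ → ℝ := fun n x =>
    (2 - 2 * Real.cos ((1 / ((n : ℝ) + 1)) * x)) / (1 / ((n : ℝ) + 1)) ^ 2
  have hF0 : ∀ n x, 0 ≤ F n x := fun n x => div_nonneg (by
    linarith [Real.cos_le_one ((1 / ((n : ℝ) + 1)) * x)]) (by positivity)
  have hlim : ∀ x, liminf (fun n => ENNReal.ofReal (F n x)) atTop = ENNReal.ofReal (x ^ 2) :=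
    fun x => (ENNReal.tendsto_ofReal (tendsto_two_sub_two_cos_div x)).liminf_eq
  simp_rw [← hlim]
  refine (lintegral_liminf_le fun n => by fun_prop).trans_lt ?_
  have hb : ∀ n, ∫⁻ x, ENNReal.ofReal (F n x) ∂μ ≤ ENNReal.ofReal K := by
    intro n
    have hn : (0 : ℝ) < 1 / ((n : ℝ) + 1) := by positivity
    have hn1 : 1 / ((n : ℝ) + 1) ≤ 1 := by
      rw [div_le_one (by positivity)]; linarith [n.cast_nonneg (α := ℝ)]
    have hint : Integrable (F n) μ := by
      refine Integrable.of_bound (by fun_prop) (4 / (1 / ((n : ℝ) + 1)) ^ 2)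
        (Eventually.of_forall fun x => ?_)
      rw [Real.norm_of_nonneg (hF0 n x)]
      simp only [F]
      gcongr
      linarith [Real.neg_one_le_cos ((1 / ((n : ℝ) + 1)) * x)]
    rw [← ofReal_integral_eq_lintegral_ofReal hint (Eventually.of_forall (hF0 n))]
    refine ENNReal.ofReal_le_ofReal ?_
    simp only [F]
    rw [integral_div, integral_two_sub_two_cos, div_le_iff₀ (by positivity)]
    refine le_trans ?_ (hK _ ⟨hn.le, hn1⟩)
    exact (neg_le_abs _).trans (Complex.abs_re_le_norm _)
  refine lt_of_le_of_lt (liminf_le_of_le (by isBoundedDefault) fun b hb' => ?_)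
    (ENNReal.ofReal_lt_top (r := K))
  obtain ⟨n, hn⟩ := hb'.exists
  exact hn.trans (hb n)

lemma lintegral_pow_lt_top (n : ℕ) : ∀ (μ : Measure ℝ) [IsFiniteMeasure μ],
    ContDiff ℝ ∞ (charFun μ) → ∫⁻ x, ENNReal.ofReal (x ^ (2 * n)) ∂μ < ⊤ := by
  induction n with
  | zero => intro μ _ _; simp
  | succ n ih =>
    intro μ _ hφ
    have h2 := lintegral_sq_lt_top μ hφ
    set ν := μ.withDensity fun x => ENNReal.ofReal (x ^ 2)
    have hfin : IsFiniteMeasure ν := isFiniteMeasure_withDensity h2.ne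
    have hmem : MemLp (id : ℝ → ℝ) 2 μ := by
      rw [memLp_two_iff_integrable_sq (by fun_prop)]
      refine ⟨by fun_prop, ?_⟩
      rw [hasFiniteIntegral_iff_ofReal (Eventually.of_forall fun x => sq_nonneg _)]
      exact h2
    have hν : charFun ν = fun t => -iteratedDeriv 2 (charFun μ) t := by
      ext t
      rw [iteratedDeriv_charFun (n := 2) (by exact_mod_cast hmem), charFun_apply_real,
        integral_withDensity_eq_integral_toReal_smul (by fun_prop)
          (Eventually.of_forall fun x => ENNReal.ofReal_lt_top)]
      simp [Complex.I_sq, sq_nonneg]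
    have hs : ContDiff ℝ ∞ (charFun ν) := by
      rw [hν]
      simp only [iteratedDeriv_eq_iterate]
      exact (hφ.iterate_deriv 2).neg
    have := ih ν hs
    rw [lintegral_withDensity_eq_lintegral_mul _ (by fun_prop) (by fun_prop)] at this
    refine lt_of_eq_of_lt (lintegral_congr fun x => ?_) this
    rw [Pi.mul_apply, ← ENNReal.ofReal_mul (sq_nonneg x)]
    ring_nf

end

end PeriodicBarrier

namespace PeriodicBarrier

/-! ### The Lévy exponent -/

lemma IsLevyMeasure.integrable_min {Λ : Measure ℝ} (hΛ : IsLevyMeasure Λ) :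
    Integrable (fun z : ℝ => min 1 (z ^ 2)) Λ := by
  refine ⟨by fun_prop, ?_⟩
  rw [hasFiniteIntegral_iff_ofReal (Eventually.of_forall fun x => by positivity)]
  exact hΛ.2

lemma IsLevyMeasure.integrable_abs_pow {Λ : Measure ℝ} (hΛ : IsLevyMeasure Λ) {θ : ℝ} (hθ : 0 < θ)
    (hexp : IntegrableOn (fun z : ℝ => Real.exp (θ * |z|)) (Ioo (-1 : ℝ) 1)ᶜ Λ) {k : ℕ}
    (hk : 2 ≤ k) : Integrable (fun z : ℝ => |z| ^ k) Λ := by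
  have h2 := (hexp.integrable_indicator measurableSet_Ioo.compl).const_mul (k.factorial / θ ^ k)
  refine (hΛ.integrable_min.add h2).mono' (by fun_prop) (Eventually.of_forall fun z => ?_)
  rw [Real.norm_of_nonneg (by positivity)]
  by_cases hz : z ∈ Ioo (-1 : ℝ) 1
  · have h1 : |z| ≤ 1 := (abs_lt.2 hz).le
    have h3 : z ^ 2 ≤ 1 := by rw [← sq_abs]; exact pow_le_one₀ (abs_nonneg z) h1
    simp only [Pi.add_apply, indicator_of_notMem (notMem_compl_iff.2 hz), min_eq_right h3]
    rw [mul_zero, add_zero, ← sq_abs]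
    exact pow_le_pow_of_le_one (abs_nonneg z) h1 hk
  · simp only [Pi.add_apply, indicator_of_mem (mem_compl hz)]
    have h4 := Real.pow_div_factorial_le_exp (θ * |z|) (by positivity) k
    have h5 : |z| ^ k ≤ k.factorial / θ ^ k * Real.exp (θ * |z|) := by
      rw [div_le_iff₀ (by positivity), mul_pow] at h4
      rw [div_mul_eq_mul_div, le_div_iff₀ (by positivity)]
      linarith
    have : (0 : ℝ) ≤ min 1 (z ^ 2) := by positivity
    linarith

/-- The jump part `1 - e^{iξz} + iξz 1_{|z|<1}` of the integrand of the exponent. -/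
noncomputable def jumpIntegrand (ξ z : ℝ) : ℂ :=
  1 - Complex.exp (Complex.I * ξ * z) + (if |z| < 1 then Complex.I * ξ * z else 0)

@[fun_prop]
lemma measurable_jumpIntegrand (ξ : ℝ) : Measurable (jumpIntegrand ξ) := by
  unfold jumpIntegrand
  refine Measurable.add (by fun_prop) (Measurable.ite ?_ (by fun_prop) (by fun_prop))
  exact measurableSet_lt (by fun_prop) (by fun_prop)

lemma norm_jumpIntegrand_le (ξ z : ℝ) :
    ‖jumpIntegrand ξ z‖ ≤ (2 + 3 * ξ ^ 2) * min 1 (z ^ 2) := by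
  have hexp : ∀ x : ℝ, ‖1 - Complex.exp (Complex.I * x)‖ ≤ 2 := fun x => by
    refine (norm_sub_le _ _).trans ?_
    rw [mul_comm, Complex.norm_exp_ofReal_mul_I]
    norm_num
  have hc : Complex.I * ξ * z = Complex.I * ((ξ * z : ℝ) : ℂ) := by push_cast; ring
  unfold jumpIntegrand
  split_ifs with hz
  · have h3 : z ^ 2 ≤ 1 := by rw [← sq_abs]; exact pow_le_one₀ (abs_nonneg z) hz.le
    rw [min_eq_right h3, hc]
    have key : ‖1 - Complex.exp (Complex.I * ((ξ * z : ℝ) : ℂ)) + Complex.I * ((ξ * z : ℝ) : ℂ)‖ ≤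
        3 * (ξ * z) ^ 2 := by
      set x := ξ * z
      have hn : ‖Complex.I * (x : ℂ)‖ = |x| := by simp
      rcases le_or_gt |x| 1 with h | h
      · have := Complex.norm_exp_sub_one_sub_id_le (x := Complex.I * (x : ℂ)) (by rw [hn]; exact h)
        rw [hn, sq_abs] at this
        rw [← norm_neg]
        refine (le_of_eq ?_).trans (this.trans ?_)
        · congr 1; ring
        · nlinarith [sq_nonneg x]
      · refine (norm_add_le _ _).trans ?_
        rw [hn]
        have := hexp x
        rw [← sq_abs]
        nlinarith
    refine key.trans ?_
    nlinarith [sq_nonneg z]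
  · have h3 : 1 ≤ z ^ 2 := by
      rw [← sq_abs]; exact one_le_pow₀ (not_lt.1 hz)
    rw [min_eq_left h3, hc, add_zero]
    nlinarith [hexp (ξ * z), sq_nonneg ξ]

lemma IsLevyMeasure.integrable_jumpIntegrand {Λ : Measure ℝ} (hΛ : IsLevyMeasure Λ) (ξ : ℝ) :
    Integrable (jumpIntegrand ξ) Λ :=
  (hΛ.integrable_min.const_mul (2 + 3 * ξ ^ 2)).mono' (by fun_prop)
    (Eventually.of_forall fun z => norm_jumpIntegrand_le ξ z)

/-- The `ξ`-derivative of `jumpIntegrand`. -/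
noncomputable def jumpDeriv (ξ z : ℝ) : ℂ :=
  -(Complex.I * z * Complex.exp (Complex.I * ξ * z)) + (if |z| < 1 then Complex.I * z else 0)

@[fun_prop]
lemma measurable_jumpDeriv (ξ : ℝ) : Measurable (jumpDeriv ξ) := by
  unfold jumpDeriv
  refine Measurable.add (by fun_prop) (Measurable.ite ?_ (by fun_prop) (by fun_prop))
  exact measurableSet_lt (by fun_prop) (by fun_prop)

lemma hasDerivAt_exp_I_mul (ξ z : ℝ) :
    HasDerivAt (fun x : ℝ => Complex.exp (Complex.I * x * z))
      (Complex.I * z * Complex.exp (Complex.I * ξ * z)) ξ := by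
  have h1 : HasDerivAt (fun x : ℝ => Complex.I * (x : ℂ) * z) (Complex.I * 1 * z) ξ :=
    ((Complex.ofRealCLM.hasDerivAt (x := ξ)).const_mul Complex.I).mul_const (z : ℂ)
  have h2 := h1.cexp
  rw [mul_one] at h2
  rwa [mul_comm] at h2

lemma hasDerivAt_jumpIntegrand (ξ z : ℝ) :
    HasDerivAt (fun x => jumpIntegrand x z) (jumpDeriv ξ z) ξ := by
  unfold jumpIntegrand jumpDeriv
  have h1 := (hasDerivAt_exp_I_mul ξ z).const_sub 1
  split_ifs
  · have h2 : HasDerivAt (fun x : ℝ => Complex.I * (x : ℂ) * z) (Complex.I * 1 * z) ξ :=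
      ((Complex.ofRealCLM.hasDerivAt (x := ξ)).const_mul Complex.I).mul_const (z : ℂ)
    rw [mul_one] at h2
    exact h1.add h2
  · exact h1.add (hasDerivAt_const ξ 0)

lemma norm_jumpDeriv_le (ξ z : ℝ) : ‖jumpDeriv ξ z‖ ≤ (1 + |ξ|) * |z| ^ 2 := by
  have hc : Complex.I * ξ * z = Complex.I * ((ξ * z : ℝ) : ℂ) := by push_cast; ring
  unfold jumpDeriv
  split_ifs with hz
  · have h1 : -(Complex.I * (z : ℂ) * Complex.exp (Complex.I * ξ * z)) + Complex.I * z =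
        -(Complex.I * z) * (Complex.exp (Complex.I * ((ξ * z : ℝ) : ℂ)) - 1) := by rw [hc]; ring
    rw [h1, norm_mul]
    have h2 := Real.norm_exp_I_mul_ofReal_sub_one_le (x := ξ * z)
    rw [Real.norm_eq_abs, abs_mul] at h2
    have h3 : ‖-(Complex.I * (z : ℂ))‖ = |z| := by simp
    rw [h3]
    nlinarith [mul_le_mul_of_nonneg_left h2 (abs_nonneg z), sq_nonneg (|z|)]
  · rw [add_zero, norm_neg, norm_mul, hc, mul_comm Complex.I ((ξ * z : ℝ) : ℂ),
      Complex.norm_exp_ofReal_mul_I, mul_one]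
    have h3 : ‖(Complex.I * (z : ℂ))‖ = |z| := by simp
    rw [h3]
    nlinarith [not_lt.1 hz, mul_nonneg (abs_nonneg ξ) (sq_nonneg (|z|))]

section

open scoped ContDiff

lemma contDiff_integral_jumpIntegrand {Λ : Measure ℝ} (hΛ : IsLevyMeasure Λ) {θ : ℝ} (hθ : 0 < θ)
    (hexp : IntegrableOn (fun z : ℝ => Real.exp (θ * |z|)) (Ioo (-1 : ℝ) 1)ᶜ Λ) :
    ContDiff ℝ ∞ (fun ξ => ∫ z, jumpIntegrand ξ z ∂Λ) := by
  have hpow := fun k (hk : 2 ≤ k) => hΛ.integrable_abs_pow hθ hexp hk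
  have hd1 : ∀ ξ, HasDerivAt (fun ξ => ∫ z, jumpIntegrand ξ z ∂Λ) (∫ z, jumpDeriv ξ z ∂Λ) ξ := by
    intro ξ
    refine (hasDerivAt_integral_of_dominated_loc_of_deriv_le (Metric.ball_mem_nhds ξ one_pos)
      (Eventually.of_forall fun x => (measurable_jumpIntegrand x).aestronglyMeasurable)
      (hΛ.integrable_jumpIntegrand ξ) (measurable_jumpDeriv ξ).aestronglyMeasurable
      (bound := fun z => (2 + |ξ|) * |z| ^ 2) (Eventually.of_forall fun z x hx => ?_)
      ((hpow 2 le_rfl).const_mul _)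
      (Eventually.of_forall fun z x _ => hasDerivAt_jumpIntegrand x z)).2
    refine (norm_jumpDeriv_le x z).trans ?_
    have : |x| ≤ 1 + |ξ| := by
      have h1 : |x - ξ| < 1 := by simpa [Real.dist_eq] using hx
      have h2 := abs_sub_abs_le_abs_sub x ξ
      linarith
    exact mul_le_mul_of_nonneg_right (by linarith) (by positivity)
  have hd2 : ∀ ξ : ℝ, HasDerivAt (fun ξ => ∫ z, jumpDeriv ξ z ∂Λ)
      (∫ z : ℝ, (z : ℂ) ^ 2 * Complex.exp (Complex.I * ξ * z) ∂Λ) ξ := by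
    intro ξ
    refine (hasDerivAt_integral_of_dominated_loc_of_deriv_le (Metric.ball_mem_nhds ξ one_pos)
      (Eventually.of_forall fun x => (measurable_jumpDeriv x).aestronglyMeasurable)
      (((hpow 2 le_rfl).const_mul (1 + |ξ|)).mono' (by fun_prop)
        (Eventually.of_forall fun z => norm_jumpDeriv_le ξ z)) (by fun_prop)
      (F' := fun ξ (z : ℝ) => (z : ℂ) ^ 2 * Complex.exp (Complex.I * ξ * z))
      (bound := fun z => |z| ^ 2) (Eventually.of_forall fun z x hx => ?_) (hpow 2 le_rfl)
      (Eventually.of_forall fun z x _ => ?_)).2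
    · have hc : Complex.I * x * z = ((x * z : ℝ) : ℂ) * Complex.I := by push_cast; ring
      simp only [norm_mul, hc, Complex.norm_exp_ofReal_mul_I, mul_one]
      simp
    · have h := ((hasDerivAt_exp_I_mul x z).const_mul (Complex.I * z)).neg.add_const
        (if |z| < 1 then Complex.I * z else 0)
      unfold jumpDeriv
      convert! h using 1
      linear_combination ((z : ℂ) ^ 2 * Complex.exp (Complex.I * x * z)) * Complex.I_sq
  set M := Λ.withDensity fun z => ENNReal.ofReal (z ^ 2)
  have hMfin : IsFiniteMeasure M := by
    refine isFiniteMeasure_withDensity ?_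
    have h := (hpow 2 le_rfl).2
    rw [hasFiniteIntegral_iff_ofReal (Eventually.of_forall fun x => by positivity)] at h
    simpa using h.ne
  have hMmem : ∀ k : ℕ, MemLp (id : ℝ → ℝ) k M := by
    intro k
    rcases eq_or_ne k 0 with rfl | hk
    · simpa using (by fun_prop : AEStronglyMeasurable (id : ℝ → ℝ) M)
    rw [← integrable_norm_rpow_iff (by fun_prop) (by exact_mod_cast hk) (by simp)]
    rw [integrable_withDensity_iff_integrable_smul' (by fun_prop)
      (Eventually.of_forall fun x => ENNReal.ofReal_lt_top)]
    refine (hpow (k + 2) (by omega)).congr (Eventually.of_forall fun z => ?_)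
    simp [sq_nonneg, pow_add]
    ring
  have hM : (fun ξ : ℝ => ∫ z : ℝ, (z : ℂ) ^ 2 * Complex.exp (Complex.I * ξ * z) ∂Λ) =
      charFun M := by
    ext ξ
    rw [charFun_apply_real, integral_withDensity_eq_integral_toReal_smul (by fun_prop)
      (Eventually.of_forall fun x => ENNReal.ofReal_lt_top)]
    refine integral_congr_ae (Eventually.of_forall fun z => ?_)
    have hc : Complex.I * ξ * z = ξ * z * Complex.I := by ring
    simp [sq_nonneg, hc]
  rw [contDiff_infty_iff_deriv]
  refine ⟨fun ξ => (hd1 ξ).differentiableAt, ?_⟩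
  rw [funext fun ξ => (hd1 ξ).deriv, contDiff_infty_iff_deriv]
  refine ⟨fun ξ => (hd2 ξ).differentiableAt, ?_⟩
  rw [funext fun ξ => (hd2 ξ).deriv, hM]
  exact contDiff_charFun' hMmem

lemma contDiff_levyExponent (γ σ : ℝ) {Λ : Measure ℝ} (hΛ : IsLevyMeasure Λ) {θ : ℝ} (hθ : 0 < θ)
    (hexp : IntegrableOn (fun z : ℝ => Real.exp (θ * |z|)) (Ioo (-1 : ℝ) 1)ᶜ Λ) :
    ContDiff ℝ ∞ (levyExponent γ σ Λ) := by
  unfold levyExponent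
  refine ContDiff.add (ContDiff.add ?_ ?_) (contDiff_integral_jumpIntegrand hΛ hθ hexp)
  · exact (contDiff_const.mul Complex.ofRealCLM.contDiff).neg
  · exact Complex.ofRealCLM.contDiff.comp (g := Complex.ofRealCLM) (f := fun ξ : ℝ => σ ^ 2 * ξ ^ 2 / 2)
      ((contDiff_const.mul (contDiff_id.pow 2)).div_const 2)

end

lemma re_jumpIntegrand (ξ z : ℝ) : (jumpIntegrand ξ z).re = 1 - Real.cos (ξ * z) := by
  have hc : Complex.I * ξ * z = ((ξ * z : ℝ) : ℂ) * Complex.I := by push_cast; ring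
  unfold jumpIntegrand
  rw [hc, Complex.add_re, Complex.sub_re, Complex.exp_ofReal_mul_I_re]
  split_ifs <;> simp

lemma re_levyExponent (γ σ : ℝ) {Λ : Measure ℝ} (hΛ : IsLevyMeasure Λ) (ξ : ℝ) :
    (levyExponent γ σ Λ ξ).re = σ ^ 2 * ξ ^ 2 / 2 + ∫ z, (1 - Real.cos (ξ * z)) ∂Λ := by
  have h1 : (∫ z, jumpIntegrand ξ z ∂Λ).re = ∫ z, (1 - Real.cos (ξ * z)) ∂Λ := by
    rw [← RCLike.re_eq_complex_re, ← integral_re (hΛ.integrable_jumpIntegrand ξ)]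
    simp only [RCLike.re_eq_complex_re, re_jumpIntegrand]
  have h2 : levyExponent γ σ Λ ξ = -(Complex.I * γ * ξ) + (σ ^ 2 * ξ ^ 2 / 2 : ℝ) +
    ∫ z, jumpIntegrand ξ z ∂Λ := rfl
  rw [h2, Complex.add_re, Complex.add_re, h1, Complex.ofReal_re]
  simp

lemma integrable_one_sub_cos {Λ : Measure ℝ} (hΛ : IsLevyMeasure Λ) (ξ : ℝ) :
    Integrable (fun z => 1 - Real.cos (ξ * z)) Λ := by
  simp_rw [← re_jumpIntegrand]
  exact (hΛ.integrable_jumpIntegrand ξ).re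

lemma isFiniteMeasure_restrict_levyMeasure {Λ : Measure ℝ} (hΛ : IsLevyMeasure Λ) {ε : ℝ}
    (hε : 0 < ε) : IsFiniteMeasure (Λ.restrict {z | ε ≤ |z|}) := by
  refine ⟨?_⟩
  rw [Measure.restrict_apply_univ]
  have h := hΛ.integrable_min.measure_norm_ge_lt_top (ε := min 1 (ε ^ 2)) (by positivity)
  refine (measure_mono fun z hz => ?_).trans_lt h
  rw [mem_ofPred_eq, Real.norm_of_nonneg (by positivity)]
  refine min_le_min le_rfl ?_
  rw [← sq_abs z]
  exact pow_le_pow_left₀ hε.le hz 2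

lemma levyMeasure_univ_le {Λ : Measure ℝ} (hΛ : IsLevyMeasure Λ) {B : ℝ}
    (hB : ∀ ξ, ∫ z, (1 - Real.cos (ξ * z)) ∂Λ ≤ B) : Λ univ ≤ ENNReal.ofReal B := by
  have hε : ∀ ε > 0, Λ {z | ε ≤ |z|} ≤ ENNReal.ofReal B := by
    intro ε hε
    have hfin := isFiniteMeasure_restrict_levyMeasure hΛ hε
    set m := Λ.restrict {z | ε ≤ |z|}
    have hset : MeasurableSet {z : ℝ | ε ≤ |z|} := measurableSet_le (by fun_prop) (by fun_prop)
    have hm : ∀ ξ, ∫ z, (1 - Real.cos (ξ * z)) ∂m ≤ B := fun ξ =>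
      (setIntegral_le_integral (integrable_one_sub_cos hΛ ξ) (Eventually.of_forall fun z =>
        sub_nonneg.2 (Real.cos_le_one _))).trans (hB ξ)
    have havg : ∀ n : ℕ, ∫ z, (1 - Real.sinc ((n + 1 : ℝ) * z)) ∂m ≤ B := by
      intro n
      have hcos : ∀ z : ℝ, ∫ u in (0 : ℝ)..1, (1 - Real.cos ((n + 1 : ℝ) * u * z)) =
          1 - Real.sinc ((n + 1 : ℝ) * z) := by
        intro z
        rw [intervalIntegral.integral_sub (by simp)
          (Continuous.intervalIntegrable (by fun_prop) _ _)]
        have e : ∀ u : ℝ, (n + 1 : ℝ) * u * z = (n + 1 : ℝ) * z * u := fun u => by ring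
        simp only [e]
        rcases eq_or_ne z 0 with rfl | hz
        · simp
        · have h0 : (n + 1 : ℝ) * z ≠ 0 := mul_ne_zero (by positivity) hz
          rw [intervalIntegral.integral_comp_mul_left _ h0, integral_cos, Real.sinc_of_ne_zero h0]
          simp
          field_simp
      simp_rw [← hcos]
      rw [← intervalIntegral_integral_swap]
      · have h1 : ∫ u in (0 : ℝ)..1, ∫ z, (1 - Real.cos ((n + 1 : ℝ) * u * z)) ∂m ≤
            ∫ u in (0 : ℝ)..1, B := by
          refine intervalIntegral.integral_mono_on zero_le_one ?_ (by simp) fun u _ => hm _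
          refine (continuous_of_dominated (bound := fun _ => 2) (by fun_prop) (fun u =>
            Eventually.of_forall fun z => ?_) (integrable_const _)
            (Eventually.of_forall fun z => by fun_prop)).intervalIntegrable _ _
          rw [Real.norm_of_nonneg (sub_nonneg.2 (Real.cos_le_one _))]
          linarith [Real.neg_one_le_cos ((n + 1 : ℝ) * u * z)]
        simpa using h1
      · have : IsFiniteMeasure (volume.restrict (uIoc (0 : ℝ) 1)) := by
          rw [uIoc_of_le zero_le_one]; infer_instance
        refine Integrable.of_bound (by fun_prop) 2 (Eventually.of_forall fun y => ?_)
        simp only [Function.uncurry]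
        rw [Real.norm_of_nonneg (sub_nonneg.2 (Real.cos_le_one _))]
        linarith [Real.neg_one_le_cos ((n + 1 : ℝ) * y.1 * y.2)]
    have hlim : Tendsto (fun n : ℕ => ∫ z, (1 - Real.sinc ((n + 1 : ℝ) * z)) ∂m) atTop
        (𝓝 (∫ _, (1 : ℝ) ∂m)) := by
      refine tendsto_integral_of_dominated_convergence (fun _ => 2) (fun n => by fun_prop)
        (integrable_const _) (fun n => Eventually.of_forall fun z => ?_) ?_
      · rw [Real.norm_of_nonneg (sub_nonneg.2 (Real.sinc_le_one _))]
        linarith [Real.neg_one_le_sinc ((n + 1 : ℝ) * z)]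
      · refine (ae_restrict_iff' hset).2 (Eventually.of_forall fun z hz => ?_)
        have hz0 : 0 < |z| := hε.trans_le hz
        have : Tendsto (fun n : ℕ => Real.sinc ((n + 1 : ℝ) * z)) atTop (𝓝 0) := by
          have hb : Tendsto (fun n : ℕ => (1 / ((n : ℝ) + 1)) * (1 / |z|)) atTop (𝓝 0) := by
            simpa using (tendsto_one_div_add_atTop_nhds_zero_nat (𝕜 := ℝ)).mul_const (1 / |z|)
          refine squeeze_zero_norm (fun n => ?_) hb
          have h0 : (n + 1 : ℝ) * z ≠ 0 := mul_ne_zero (by positivity) (abs_pos.1 hz0)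
          rw [Real.sinc_of_ne_zero h0, norm_div, Real.norm_eq_abs, Real.norm_eq_abs, abs_mul,
            abs_of_pos (by positivity : (0 : ℝ) < n + 1), div_mul_div_comm, one_mul]
          gcongr
          exact Real.abs_sin_le_one _
        simpa using this.const_sub 1
    have h1 := le_of_tendsto' hlim havg
    rw [integral_const, smul_eq_mul, mul_one] at h1
    have h2 : m univ ≤ ENNReal.ofReal B := by
      rw [← ENNReal.ofReal_toReal (measure_ne_top m univ)]
      exact ENNReal.ofReal_le_ofReal h1
    simpa [m] using h2
  have hU : (univ : Set ℝ) = {0} ∪ ⋃ n : ℕ, {z | 1 / ((n : ℝ) + 1) ≤ |z|} := by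
    ext z
    simp only [mem_univ, mem_union, mem_singleton_iff, mem_iUnion, mem_ofPred_eq, true_iff]
    rcases eq_or_ne z 0 with h | h
    · exact Or.inl h
    · obtain ⟨n, hn⟩ := exists_nat_one_div_lt (abs_pos.2 h)
      exact Or.inr ⟨n, hn.le⟩
  have hmono : Monotone fun n : ℕ => {z : ℝ | 1 / ((n : ℝ) + 1) ≤ |z|} := by
    intro a b hab z hz
    refine le_trans ?_ (show 1 / ((a : ℝ) + 1) ≤ |z| from hz)
    have : (a : ℝ) ≤ b := by exact_mod_cast hab
    gcongr
  rw [hU]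
  refine (measure_union_le _ _).trans ?_
  rw [hΛ.1, zero_add, hmono.measure_iUnion]
  exact iSup_le fun n => hε _ (by positivity)

lemma isDriftlessCompoundPoisson_of_bounded (γ σ : ℝ) {Λ : Measure ℝ} (hΛ : IsLevyMeasure Λ)
    {B : ℝ} (hB : ∀ ξ, ‖levyExponent γ σ Λ ξ‖ ≤ B) : IsDriftlessCompoundPoisson γ σ Λ := by
  have hre : ∀ ξ, σ ^ 2 * ξ ^ 2 / 2 + ∫ z, (1 - Real.cos (ξ * z)) ∂Λ ≤ B := fun ξ => by
    rw [← re_levyExponent γ σ hΛ]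
    exact (Complex.re_le_norm _).trans (hB ξ)
  have hcos0 : ∀ ξ, 0 ≤ ∫ z, (1 - Real.cos (ξ * z)) ∂Λ := fun ξ =>
    integral_nonneg fun z => sub_nonneg.2 (Real.cos_le_one _)
  have hB0 : 0 ≤ B := (norm_nonneg _).trans (hB 0)
  have hlin : ∀ (c A : ℝ), (∀ ξ : ℝ, c * |ξ| ≤ A) → c ≤ 0 := by
    intro c A h
    by_contra! hc
    have h1 := h ((|A| + 1) / c)
    rw [abs_of_pos (by positivity), mul_div_cancel₀ _ hc.ne'] at h1
    linarith [le_abs_self A]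
  have hσ : σ = 0 := by
    have h1 : σ ^ 2 / 2 ≤ 0 := hlin _ (B + σ ^ 2 / 2) fun ξ => by
      have h2 := hre ξ
      have h3 := hcos0 ξ
      have h4 : |ξ| ≤ ξ ^ 2 + 1 := by rw [← sq_abs]; nlinarith [sq_nonneg (|ξ| - 1), abs_nonneg ξ]
      nlinarith [mul_le_mul_of_nonneg_left h4 (by positivity : (0 : ℝ) ≤ σ ^ 2 / 2)]
    nlinarith
  have hfin : Λ univ < ⊤ := by
    refine (levyMeasure_univ_le hΛ (B := B) fun ξ => ?_).trans_lt ENNReal.ofReal_lt_top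
    have := hre ξ
    nlinarith [sq_nonneg σ, sq_nonneg ξ, mul_nonneg (sq_nonneg σ) (sq_nonneg ξ)]
  refine ⟨hσ, hfin, ?_⟩
  have : IsFiniteMeasure Λ := ⟨hfin⟩
  set d := ∫ z in Ioo (-1 : ℝ) 1, z ∂Λ
  have hsplit : ∀ ξ, levyExponent γ σ Λ ξ =
      Complex.I * ξ * ((d - γ : ℝ) : ℂ) + ∫ z : ℝ, (1 - Complex.exp (Complex.I * ξ * z)) ∂Λ := by
    intro ξ
    have hi1 : Integrable (fun z : ℝ => 1 - Complex.exp (Complex.I * ξ * z)) Λ := by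
      refine Integrable.of_bound (by fun_prop) 2 (Eventually.of_forall fun z => ?_)
      have hc : Complex.I * ξ * z = ((ξ * z : ℝ) : ℂ) * Complex.I := by push_cast; ring
      refine (norm_sub_le _ _).trans ?_
      rw [hc, Complex.norm_exp_ofReal_mul_I]
      norm_num
    have hd : ∫ z : ℝ, (if |z| < 1 then Complex.I * ξ * z else 0) ∂Λ = Complex.I * ξ * d := by
      have e : ∀ z : ℝ, (if |z| < 1 then Complex.I * ξ * z else 0) =
          (Ioo (-1 : ℝ) 1).indicator (fun z : ℝ => Complex.I * ξ * z) z := fun z => by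
        simp only [indicator, mem_Ioo, abs_lt]
      simp_rw [e]
      rw [integral_indicator measurableSet_Ioo, integral_const_mul, integral_complex_ofReal]
    have hi2 : Integrable (fun z : ℝ => if |z| < 1 then Complex.I * ξ * z else 0) Λ := by
      have := (hΛ.integrable_jumpIntegrand ξ).sub hi1
      refine this.congr (Eventually.of_forall fun z => ?_)
      simp [jumpIntegrand]
    unfold levyExponent
    rw [integral_add hi1 hi2, hd, hσ]
    push_cast
    ring
  have hbd : ∀ ξ : ℝ, |d - γ| * |ξ| ≤ B + 2 * Λ.real univ := by
    intro ξ
    have h1 : ‖∫ z : ℝ, (1 - Complex.exp (Complex.I * ξ * z)) ∂Λ‖ ≤ 2 * Λ.real univ := by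
      refine norm_integral_le_of_norm_le_const (Eventually.of_forall fun z => ?_)
      have hc : Complex.I * ξ * z = ((ξ * z : ℝ) : ℂ) * Complex.I := by push_cast; ring
      refine (norm_sub_le _ _).trans ?_
      rw [hc, Complex.norm_exp_ofReal_mul_I]
      norm_num
    have h2 : ‖Complex.I * ξ * ((d - γ : ℝ) : ℂ)‖ = |d - γ| * |ξ| := by
      rw [norm_mul, norm_mul, Complex.norm_I, Complex.norm_real, Complex.norm_real, one_mul,
        Real.norm_eq_abs, Real.norm_eq_abs, mul_comm]
    rw [← h2, eq_sub_of_add_eq (hsplit ξ).symm]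
    exact (norm_sub_le _ _).trans (add_le_add (hB ξ) h1)
  have := abs_nonpos_iff.1 (hlin _ _ hbd)
  linarith

end PeriodicBarrier

namespace PeriodicBarrier

/-! ### Evaluation of right-continuous paths, jointly measurable in path and time -/

/-- The point `⌈t (n + 1)⌉ / (n + 1)`, which approximates `t` from the right. -/
noncomputable def upperGrid (n : ℕ) (t : ℝ≥0) : ℝ≥0 := (⌈t * (n + 1 : ℝ≥0)⌉₊ : ℝ≥0) / (n + 1 : ℝ≥0)

/-- Evaluation of a right-continuous path through its values at rational times. -/
noncomputable def evalRight (p : ℝ≥0 → ℝ) (t : ℝ≥0) : ℝ :=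
  limsup (fun n : ℕ => p (upperGrid n t)) atTop

lemma le_upperGrid (n : ℕ) (t : ℝ≥0) : t ≤ upperGrid n t := by
  rw [upperGrid, le_div_iff₀ (by positivity)]
  exact Nat.le_ceil _

lemma tendsto_upperGrid (t : ℝ≥0) : Tendsto (fun n => upperGrid n t) atTop (𝓝 t) := by
  have h := (tendsto_nat_ceil_mul_div_atTop (R := ℝ) t.coe_nonneg).comp
    (tendsto_natCast_atTop_atTop.comp (tendsto_add_atTop_nat 1))
  rw [← NNReal.tendsto_coe]
  refine h.congr fun n => ?_
  simp only [Function.comp_apply, upperGrid, NNReal.coe_div, NNReal.coe_natCast, NNReal.coe_add,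
    NNReal.coe_one, Nat.cast_add, Nat.cast_one]
  congr 1

lemma evalRight_eq {p : ℝ≥0 → ℝ} {t : ℝ≥0} (hp : ContinuousWithinAt p (Ici t) t) :
    evalRight p t = p t :=
  (hp.tendsto.comp (tendsto_nhdsWithin_iff.2 ⟨tendsto_upperGrid t,
    Eventually.of_forall fun n => le_upperGrid n t⟩)).limsup_eq

lemma IsCadlag.evalRight_eq {p : ℝ≥0 → ℝ} (hp : IsCadlag p) : evalRight p = p :=
  funext fun t => PeriodicBarrier.evalRight_eq (hp t).1

lemma measurable_evalRight :
    Measurable (fun z : (ℝ≥0 → ℝ) × ℝ≥0 => evalRight z.1 z.2) := by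
  refine Measurable.limsup fun n => ?_
  have h1 : Measurable (fun z : (ℝ≥0 → ℝ) × ℕ => z.1 ((z.2 : ℝ≥0) / (n + 1 : ℝ≥0))) :=
    measurable_from_prod_countable_left fun m =>
      (measurable_pi_apply ((m : ℝ≥0) / (n + 1 : ℝ≥0)) : Measurable fun p : ℝ≥0 → ℝ => _)
  have h2 : Measurable (fun z : (ℝ≥0 → ℝ) × ℝ≥0 => (z.1, ⌈z.2 * (n + 1 : ℝ≥0)⌉₊)) :=
    measurable_fst.prodMk (Nat.measurable_ceil.comp (by fun_prop))
  exact h1.comp h2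

attribute [irreducible] evalRight

lemma measurable_evalRight_comp {α : Type*} [MeasurableSpace α] {p : α → ℝ≥0 → ℝ} {t : α → ℝ≥0}
    (hp : Measurable p) (ht : Measurable t) :
    Measurable (fun a => evalRight (p a) (t a)) :=
  measurable_evalRight.comp (hp.prodMk ht)

/-! ### Discounted time -/

/-- The measure `e^{-qt} dt` on `(0, ∞)`. -/
noncomputable def expTime (q : ℝ) : Measure ℝ :=
  (volume.restrict (Ioi (0 : ℝ))).withDensity fun t => ENNReal.ofReal (Real.exp (-(q * t)))

lemma expTime_apply (q : ℝ) {A : Set ℝ} (hA : MeasurableSet A) :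
    expTime q A = ∫⁻ t, (A ∩ Ioi 0).indicator
      (fun t => ENNReal.ofReal (Real.exp (-(q * t)))) t := by
  rw [expTime, withDensity_apply _ hA, Measure.restrict_restrict hA,
    lintegral_indicator (hA.inter measurableSet_Ioi)]

lemma integrableOn_exp_neg_mul {q : ℝ} (hq : 0 < q) :
    IntegrableOn (fun t : ℝ => Real.exp (-(q * t))) (Ioi 0) := by
  simpa only [neg_mul_eq_neg_mul] using exp_neg_integrableOn_Ioi 0 hq

lemma integral_exp_neg_mul_Ioi {q : ℝ} (hq : 0 < q) (s : ℝ) :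
    ∫ t in Ioi s, Real.exp (-(q * t)) = Real.exp (-(q * s)) / q := by
  have := integral_exp_mul_Ioi (neg_neg_of_pos hq) s
  simp only [neg_mul] at this
  rw [this]
  field_simp

lemma isFiniteMeasure_expTime {q : ℝ} (hq : 0 < q) : IsFiniteMeasure (expTime q) :=
  isFiniteMeasure_withDensity_ofReal (integrableOn_exp_neg_mul hq).2

lemma ae_expTime_pos (q : ℝ) : ∀ᵐ t ∂(expTime q), 0 < t :=
  (withDensity_absolutelyContinuous _ _).ae_le (ae_restrict_mem measurableSet_Ioi)

lemma integral_expTime (q : ℝ) {E : Type*} [NormedAddCommGroup E] [NormedSpace ℝ E] (g : ℝ → E) :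
    ∫ t, g t ∂(expTime q) = ∫ t in Ioi (0 : ℝ), Real.exp (-(q * t)) • g t := by
  rw [expTime, integral_withDensity_eq_integral_toReal_smul (by fun_prop)
    (Eventually.of_forall fun x => ENNReal.ofReal_lt_top)]
  simp [Real.exp_nonneg]

lemma expTime_restrict_Ioi (q : ℝ) {s : ℝ} (hs : 0 ≤ s) :
    (expTime q).restrict (Ioi s) =
      ENNReal.ofReal (Real.exp (-(q * s))) • (expTime q).map (fun u => s + u) := by
  ext A hA
  rw [Measure.restrict_apply hA, Measure.smul_apply, Measure.map_apply (by fun_prop) hA,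
    expTime_apply q (hA.inter measurableSet_Ioi), expTime_apply q (by measurability),
    ← lintegral_add_left_eq_self _ s, smul_eq_mul, ← lintegral_const_mul _ (by
      refine Measurable.indicator (by fun_prop) ?_
      exact ((by fun_prop : Measurable fun u : ℝ => s + u) hA).inter measurableSet_Ioi)]
  refine lintegral_congr fun u => ?_
  by_cases h : s + u ∈ A ∩ Ioi s ∩ Ioi 0
  · have h' : u ∈ (fun u => s + u) ⁻¹' A ∩ Ioi 0 := ⟨h.1.1, by simpa using h.1.2⟩
    rw [indicator_of_mem h, indicator_of_mem h', ← ENNReal.ofReal_mul (Real.exp_nonneg _),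
      ← Real.exp_add]
    ring_nf
  · have h' : u ∉ (fun u => s + u) ⁻¹' A ∩ Ioi 0 := fun h2 =>
      h ⟨⟨h2.1, by simpa using h2.2⟩, by have : 0 < u := h2.2; exact mem_Ioi.2 (by linarith)⟩
    rw [indicator_of_notMem h, indicator_of_notMem h', mul_zero]

lemma expTime_restrict_Ici (q : ℝ) {s : ℝ} (hs : 0 ≤ s) :
    (expTime q).restrict (Ici s) =
      ENNReal.ofReal (Real.exp (-(q * s))) • (expTime q).map (fun u => s + u) := by
  rw [← expTime_restrict_Ioi q hs]
  refine Measure.restrict_congr_set ?_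
  exact (withDensity_absolutelyContinuous _ _).ae_le (ae_restrict_of_ae Ioi_ae_eq_Ici.symm)

lemma expTime_Ioc_le {q s : ℝ} (hq : 0 < q) : expTime q (Ioc 0 s) ≤ ENNReal.ofReal s := by
  rw [expTime, withDensity_apply _ measurableSet_Ioc]
  refine (lintegral_mono_ae (g := fun _ => 1) ?_).trans ?_
  · rw [Measure.restrict_restrict measurableSet_Ioc]
    refine (ae_restrict_iff' (measurableSet_Ioc.inter measurableSet_Ioi)).2
      (Eventually.of_forall fun t ht => ?_)
    rw [← ENNReal.ofReal_one]
    refine ENNReal.ofReal_le_ofReal (Real.exp_le_one_iff.2 ?_)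
    have : 0 < t := ht.2
    nlinarith
  · rw [Measure.restrict_restrict measurableSet_Ioc, lintegral_one, Measure.restrict_apply_univ]
    refine (measure_mono inter_subset_left).trans ?_
    simp

/-! ### The potential measure of a Lévy process -/

variable {Ω : Type*} [MeasurableSpace Ω] {P : Measure Ω} {X : ℝ≥0 → Ω → ℝ} {γ σ : ℝ}
  {Λ : Measure ℝ}

lemma IsLevyProcess.measurable_path (hX : IsLevyProcess P X γ σ Λ) :
    Measurable (fun ω t => X t ω) :=
  measurable_pi_lambda _ hX.measurable

lemma IsLevyProcess.ae_evalRight (hX : IsLevyProcess P X γ σ Λ) :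
    ∀ᵐ ω ∂P, evalRight (fun t => X t ω) = fun t => X t ω :=
  hX.cadlag.mono fun _ h => h.evalRight_eq

lemma IsLevyProcess.measurable_evalRight (hX : IsLevyProcess P X γ σ Λ) :
    Measurable (fun y : Ω × ℝ => evalRight (fun t => X t y.1) y.2.toNNReal) :=
  measurable_evalRight_comp (hX.measurable_path.comp measurable_fst) (by fun_prop)

lemma ae_prod_of_ae_fst {α β : Type*} [MeasurableSpace α] [MeasurableSpace β] {μ : Measure α}
    {ν : Measure β} [SFinite ν] {p : α → Prop} (h : ∀ᵐ a ∂μ, p a) : ∀ᵐ y ∂(μ.prod ν), p y.1 :=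
  Measure.quasiMeasurePreserving_fst.ae h

lemma ae_prod_of_ae_snd {α β : Type*} [MeasurableSpace α] [MeasurableSpace β] {μ : Measure α}
    {ν : Measure β} [SFinite ν] {p : β → Prop} (h : ∀ᵐ b ∂ν, p b) : ∀ᵐ y ∂(μ.prod ν), p y.2 :=
  Measure.quasiMeasurePreserving_snd.ae h

lemma IsLevyProcess.aemeasurable_uncurry (hX : IsLevyProcess P X γ σ Λ) (ν : Measure ℝ)
    [SFinite ν] : AEMeasurable (fun y : Ω × ℝ => X y.2.toNNReal y.1) (P.prod ν) :=
  ⟨_, hX.measurable_evalRight, (ae_prod_of_ae_fst hX.ae_evalRight).mono fun _ hy =>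
    (congrFun hy _).symm⟩

/-- The `q`-potential measure `∫₀^∞ e^{-qt} P(X_t ∈ ·) dt`. -/
noncomputable def potential (P : Measure Ω) (X : ℝ≥0 → Ω → ℝ) (q : ℝ) : Measure ℝ :=
  (P.prod (expTime q)).map fun y => X y.2.toNNReal y.1

lemma sFinite_expTime (q : ℝ) : SFinite (expTime q) := by unfold expTime; infer_instance

attribute [instance] sFinite_expTime

lemma IsLevyProcess.isFiniteMeasure_potential [IsProbabilityMeasure P]
    {q : ℝ} (hq : 0 < q) : IsFiniteMeasure (potential P X q) := by
  have := isFiniteMeasure_expTime hq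
  exact Measure.isFiniteMeasure_map _ _

lemma IsLevyProcess.norm_exp_le_one [IsProbabilityMeasure P] (hX : IsLevyProcess P X γ σ Λ)
    (t : ℝ≥0) (ξ : ℝ) : ‖Complex.exp (-((t : ℝ) * levyExponent γ σ Λ ξ))‖ ≤ 1 := by
  have := Measure.isProbabilityMeasure_map (μ := P) (hX.measurable t).aemeasurable
  rw [← hX.charFun_eq]
  exact norm_charFun_le_one ξ

lemma IsLevyProcess.re_exponent_nonneg [IsProbabilityMeasure P] (hX : IsLevyProcess P X γ σ Λ)
    (ξ : ℝ) : 0 ≤ (levyExponent γ σ Λ ξ).re := by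
  have h := hX.norm_exp_le_one 1 ξ
  rw [Complex.norm_exp, Real.exp_le_one_iff] at h
  simpa using h

lemma IsLevyProcess.charFun_potential [IsProbabilityMeasure P] (hX : IsLevyProcess P X γ σ Λ)
    {q : ℝ} (hq : 0 < q) (ξ : ℝ) :
    charFun (potential P X q) ξ = (q + levyExponent γ σ Λ ξ)⁻¹ := by
  have := isFiniteMeasure_expTime hq
  have haem := hX.aemeasurable_uncurry (expTime q)
  rw [charFun_apply_real, potential, integral_map haem (by fun_prop),
    integral_prod_symm]
  swap
  · refine Integrable.of_bound (C := 1) ?_ (Eventually.of_forall fun y => ?_)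
    · have : AEMeasurable (fun y : Ω × ℝ => Complex.exp (ξ * (X y.2.toNNReal y.1 : ℝ) * Complex.I))
          (P.prod (expTime q)) :=
        (by fun_prop : Measurable fun x : ℝ => Complex.exp (ξ * x * Complex.I)).comp_aemeasurable
          haem
      exact this.aestronglyMeasurable
    · rw [← Complex.ofReal_mul, Complex.norm_exp_ofReal_mul_I]
  have h1 : ∀ t : ℝ, ∫ ω, Complex.exp (ξ * (X t.toNNReal ω : ℝ) * Complex.I) ∂P =
      Complex.exp (-((t.toNNReal : ℝ) * levyExponent γ σ Λ ξ)) := fun t => by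
    rw [← hX.charFun_eq, charFun_apply_real,
      integral_map (hX.measurable _).aemeasurable (by fun_prop)]
  simp_rw [h1]
  rw [integral_expTime]
  have h2 : ∀ t ∈ Ioi (0 : ℝ), Real.exp (-(q * t)) •
      Complex.exp (-((t.toNNReal : ℝ) * levyExponent γ σ Λ ξ)) =
      Complex.exp (-(q + levyExponent γ σ Λ ξ) * t) := fun t ht => by
    rw [Real.coe_toNNReal t (le_of_lt ht), Complex.real_smul, Complex.ofReal_exp, ← Complex.exp_add]
    congr 1
    push_cast
    ring
  rw [setIntegral_congr_fun measurableSet_Ioi h2, integral_exp_mul_complex_Ioi]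
  · simp only [Complex.ofReal_zero, mul_zero, Complex.exp_zero]
    rw [neg_div_neg_eq, one_div]
  · have := hX.re_exponent_nonneg ξ
    simp only [Complex.neg_re, Complex.add_re, Complex.ofReal_re]
    linarith

lemma IsLevyProcess.lintegral_potential_pow_lt_top [IsProbabilityMeasure P]
    (hX : IsLevyProcess P X γ σ Λ) {θ : ℝ} (hθ : 0 < θ)
    (hexp : IntegrableOn (fun z : ℝ => Real.exp (θ * |z|)) (Ioo (-1 : ℝ) 1)ᶜ Λ)
    {q : ℝ} (hq : 0 < q) (n : ℕ) :
    ∫⁻ x, ENNReal.ofReal (x ^ (2 * n)) ∂(potential P X q) < ⊤ := by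
  have := IsLevyProcess.isFiniteMeasure_potential (P := P) (X := X) hq
  refine lintegral_pow_lt_top n _ ?_
  rw [funext (hX.charFun_potential hq)]
  refine ContDiff.inv (contDiff_const.add (contDiff_levyExponent γ σ hX.levy_measure hθ hexp))
    fun ξ h => ?_
  have h1 := hX.re_exponent_nonneg ξ
  have h2 := congrArg Complex.re h
  simp only [Complex.add_re, Complex.ofReal_re, Complex.zero_re] at h2
  linarith

lemma IsLevyProcess.potential_apply [IsProbabilityMeasure P] (hX : IsLevyProcess P X γ σ Λ)
    (q : ℝ) {A : Set ℝ} (hA : MeasurableSet A) :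
    potential P X q A = ∫⁻ t, P.map (X t.toNNReal) A ∂(expTime q) := by
  have haem := hX.aemeasurable_uncurry (expTime q)
  rw [potential, Measure.map_apply_of_aemeasurable haem hA, ← lintegral_indicator_one₀
    (haem.nullMeasurableSet_preimage hA), lintegral_prod_symm]
  · refine lintegral_congr fun t => ?_
    rw [Measure.map_apply (hX.measurable _) hA, ← lintegral_indicator_one (hX.measurable _ hA)]
    rfl
  · exact (aemeasurable_const.indicator₀ (haem.nullMeasurableSet_preimage hA))

lemma IsLevyProcess.map_add [IsProbabilityMeasure P] (hX : IsLevyProcess P X γ σ Λ)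
    (s t : ℝ≥0) : P.map (X (s + t)) = (P.map (X s)).conv (P.map (X t)) := by
  have h : ∀ t, IsProbabilityMeasure (P.map (X t)) := fun t =>
    Measure.isProbabilityMeasure_map (hX.measurable t).aemeasurable
  have := h s
  have := h t
  have := h (s + t)
  refine Measure.ext_of_charFun (funext fun ξ => ?_)
  rw [charFun_conv, hX.charFun_eq, hX.charFun_eq, hX.charFun_eq, ← Complex.exp_add]
  congr 1
  push_cast
  ring

lemma IsLevyProcess.potential_singleton_le [IsProbabilityMeasure P]
    (hX : IsLevyProcess P X γ σ Λ) {q : ℝ} (hq : 0 < q) (x : ℝ) (s : ℝ≥0) :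
    potential P X q {x} ≤ s + ∫⁻ y, potential P X q {x - y} ∂(P.map (X s)) := by
  have h : ∀ t, IsProbabilityMeasure (P.map (X t)) := fun t =>
    Measure.isProbabilityMeasure_map (hX.measurable t).aemeasurable
  have hmeas : Measurable fun y : Ω × ℝ => evalRight (fun t => X t y.1) y.2.toNNReal :=
    hX.measurable_evalRight
  have hk : ∀ t, P.map (X t) = P.map (fun ω => evalRight (fun t => X t ω) t) := fun t =>
    Measure.map_congr (hX.ae_evalRight.mono fun ω h => (congrFun h t).symm)
  have hjoint : Measurable fun z : ℝ × ℝ => P.map (X z.1.toNNReal) {z.2} := by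
    have h1 : MeasurableSet {w : (ℝ × ℝ) × Ω | evalRight (fun t => X t w.2) w.1.1.toNNReal = w.1.2} :=
      measurableSet_eq_fun (measurable_evalRight_comp (hX.measurable_path.comp measurable_snd)
        (by fun_prop)) (by fun_prop)
    have h2 : (fun z : ℝ × ℝ => P.map (X z.1.toNNReal) {z.2}) = fun z => P (Prod.mk z ⁻¹'
        {w : (ℝ × ℝ) × Ω | evalRight (fun t => X t w.2) w.1.1.toNNReal = w.1.2}) := by
      ext z
      rw [hk, Measure.map_apply (measurable_evalRight_comp hX.measurable_path measurable_const)
        (measurableSet_singleton _)]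
      rfl
    rw [h2]
    exact measurable_measure_prodMk_left h1
  rw [hX.potential_apply q (measurableSet_singleton x)]
  have hsplit : ∫⁻ t, P.map (X t.toNNReal) {x} ∂(expTime q) =
      ∫⁻ t in Ioc (0 : ℝ) s, P.map (X t.toNNReal) {x} ∂(expTime q) +
      ∫⁻ t in Ioi (s : ℝ), P.map (X t.toNNReal) {x} ∂(expTime q) := by
    rw [← lintegral_union measurableSet_Ioi (by
      rw [Set.disjoint_left]; intro t h1 h2; exact absurd h1.2 (not_le.2 h2)),
      Ioc_union_Ioi_eq_Ioi s.coe_nonneg]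
    refine (setLIntegral_univ _).symm.trans ?_
    refine setLIntegral_congr ?_
    refine eventuallyEq_set.2 ((ae_expTime_pos q).mono fun t ht => by simp [ht])
  rw [hsplit]
  refine add_le_add ?_ ?_
  · refine (lintegral_mono (g := fun _ => 1) fun t => ?_).trans ?_
    · have := h t.toNNReal
      exact prob_le_one
    · rw [setLIntegral_one]
      refine (expTime_Ioc_le hq).trans ?_
      simp
  · rw [expTime_restrict_Ioi q s.coe_nonneg, lintegral_smul_measure,
      lintegral_map (f := fun t : ℝ => P.map (X t.toNNReal) {x})
        (hjoint.comp (measurable_id.prodMk measurable_const)) (by fun_prop)]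
    calc _ ≤ ∫⁻ u, P.map (X ((s : ℝ) + u).toNNReal) {x} ∂(expTime q) := by
          refine mul_le_of_le_one_left' ?_
          rw [← ENNReal.ofReal_one]
          refine ENNReal.ofReal_le_ofReal (Real.exp_le_one_iff.2 ?_)
          have := s.coe_nonneg
          nlinarith
      _ = ∫⁻ u, ∫⁻ y, P.map (X u.toNNReal) {x - y} ∂(P.map (X s)) ∂(expTime q) := by
          refine lintegral_congr_ae ((ae_expTime_pos q).mono fun u hu => ?_)
          dsimp only
          have := h s
          have := h u.toNNReal
          rw [Real.toNNReal_add s.coe_nonneg hu.le, Real.toNNReal_coe, hX.map_add,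
            ← lintegral_indicator_one (measurableSet_singleton x),
            Measure.lintegral_conv (measurable_one.indicator (measurableSet_singleton x))]
          refine lintegral_congr fun y => ?_
          rw [← lintegral_indicator_one (measurableSet_singleton (x - y))]
          refine lintegral_congr fun z => ?_
          simp only [indicator, mem_singleton_iff, eq_sub_iff_add_eq',
            Pi.one_apply]
      _ = ∫⁻ y, ∫⁻ u, P.map (X u.toNNReal) {x - y} ∂(expTime q) ∂(P.map (X s)) := by
          have := h s
          refine lintegral_lintegral_swap (Measurable.aemeasurable ?_)
          exact hjoint.comp (measurable_fst.prodMk (measurable_const.sub measurable_snd))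
      _ = _ := by
          refine lintegral_congr fun y => ?_
          rw [hX.potential_apply q (measurableSet_singleton _)]

end PeriodicBarrier

namespace PeriodicBarrier

/-! ### The potential measure has no atoms -/

/-- The heaviest atoms of a finite measure with an atom: they form a finite set, and all other
points have mass bounded away from the maximal one. -/
lemma exists_maximal_atoms (μ : Measure ℝ) [IsFiniteMeasure μ] {a : ℝ} (ha : μ {a} ≠ 0) :
    ∃ (F : Set ℝ) (M c : ℝ), F.Finite ∧ F.Nonempty ∧ c < M ∧ (∀ x ∈ F, μ.real {x} = M) ∧
      (∀ x, μ.real {x} ≤ M) ∧ ∀ x ∉ F, μ.real {x} ≤ c := by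
  have hfin : ∀ ε : ℝ, 0 < ε → {x | ε ≤ μ.real {x}}.Finite := by
    intro ε hε
    refine (Measure.finite_const_le_meas_of_disjoint_iUnion μ (ENNReal.ofReal_pos.2 hε)
      (As := fun x : ℝ => {x}) (fun x => measurableSet_singleton x)
      (fun x y hxy => by simpa using hxy) (measure_ne_top _ _)).subset fun x hx => ?_
    exact (ENNReal.ofReal_le_iff_le_toReal (measure_ne_top _ _)).2 hx
  have ha' : 0 < μ.real {a} := ENNReal.toReal_pos ha (measure_ne_top _ _)
  have hA := hfin _ ha'
  obtain ⟨m, hmA, hm⟩ := hA.exists_maximalFor (fun x => μ.real {x}) _ ⟨a, le_refl (μ.real {a})⟩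
  have hmax : ∀ x, μ.real {x} ≤ μ.real {m} := by
    intro x
    rcases le_total (μ.real {a}) (μ.real {x}) with h | h
    · by_contra! h2
      exact absurd (hm h h2.le) (not_le.2 h2)
    · exact h.trans hmA
  have hM : 0 < μ.real {m} := ha'.trans_le hmA
  have hB := hfin (μ.real {m} / 2) (by positivity)
  set F := {x | μ.real {x} = μ.real {m}}
  have hF : F.Finite := hB.subset fun x (hx : _ = _) => by
    rw [mem_ofPred_eq, hx]; linarith
  by_cases hne : ({x | μ.real {m} / 2 ≤ μ.real {x}} \ F).Nonempty
  · obtain ⟨k, hkB, hk⟩ := (hB.subset (sdiff_subset (t := F))).exists_maximalFor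
      (fun x => μ.real {x}) _ hne
    refine ⟨F, μ.real {m}, μ.real {k}, hF, ⟨m, rfl⟩, lt_of_le_of_ne (hmax k) hkB.2, fun _ h => h,
      hmax, fun x hx => ?_⟩
    by_cases h2 : μ.real {m} / 2 ≤ μ.real {x}
    · by_contra! h3
      exact absurd (hk ⟨h2, hx⟩ h3.le) (not_le.2 h3)
    · exact (not_le.1 h2).le.trans hkB.1
  · refine ⟨F, μ.real {m}, μ.real {m} / 2, hF, ⟨m, rfl⟩, by linarith, fun _ h => h, hmax,
      fun x hx => ?_⟩
    by_contra! h2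
    exact hne ⟨x, h2.le, hx⟩

variable {Ω : Type*} [MeasurableSpace Ω] {P : Measure Ω} {X : ℝ≥0 → Ω → ℝ} {γ σ : ℝ}
  {Λ : Measure ℝ}

lemma IsLevyProcess.measurable_potential_singleton [IsProbabilityMeasure P] {q : ℝ} (hq : 0 < q)
    (x : ℝ) : Measurable fun y => potential P X q {x - y} := by
  have := IsLevyProcess.isFiniteMeasure_potential (P := P) (X := X) hq
  have h1 : MeasurableSet {w : ℝ × ℝ | w.2 = x - w.1} :=
    measurableSet_eq_fun (by fun_prop) (by fun_prop)
  exact measurable_measure_prodMk_left (ν := potential P X q) h1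

/-- If the potential measure has an atom, then `X` stays at `0` up to time `t` with probability
at least `1 - Kt`. -/
lemma IsLevyProcess.exists_measureReal_ne_zero_le [IsProbabilityMeasure P]
    (hX : IsLevyProcess P X γ σ Λ) {q : ℝ} (hq : 0 < q) {a : ℝ} (ha : potential P X q {a} ≠ 0) :
    ∃ K : ℝ, ∀ s : ℝ≥0, (P.map (X s)).real {0}ᶜ ≤ K * s := by
  have := IsLevyProcess.isFiniteMeasure_potential (P := P) (X := X) hq
  have hprob : ∀ t, IsProbabilityMeasure (P.map (X t)) := fun t =>
    Measure.isProbabilityMeasure_map (hX.measurable t).aemeasurable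
  set V := potential P X q
  obtain ⟨F, M, c, hF, hFne, hcM, hFM, hM, hc⟩ := exists_maximal_atoms V ha
  have key : ∀ x ∈ F, ∀ A : Set ℝ, MeasurableSet A → (∀ y ∈ A, x - y ∉ F) → ∀ s : ℝ≥0,
      (P.map (X s)).real A ≤ (1 / (M - c)) * s := by
    intro x hx A hA hAF s
    have hmeas : Measurable fun y => V {x - y} :=
      IsLevyProcess.measurable_potential_singleton hq x
    have hint : Integrable (fun y => V.real {x - y}) (P.map (X s)) :=
      Integrable.of_bound hmeas.ennreal_toReal.aestronglyMeasurable M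
        (Eventually.of_forall fun y => by
          rw [Real.norm_of_nonneg measureReal_nonneg]; exact hM _)
    have h1 : V.real {x} ≤ s + ∫ y, V.real {x - y} ∂(P.map (X s)) := by
      have h := hX.potential_singleton_le hq x s
      have e : ∫⁻ y, V {x - y} ∂(P.map (X s)) =
          ENNReal.ofReal (∫ y, V.real {x - y} ∂(P.map (X s))) := by
        rw [ofReal_integral_eq_lintegral_ofReal hint
          (Eventually.of_forall fun y => measureReal_nonneg)]
        exact lintegral_congr fun y => (ofReal_measureReal).symm
      rw [e, ← ENNReal.ofReal_coe_nnreal, ← ENNReal.ofReal_add s.coe_nonneg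
        (integral_nonneg fun y => measureReal_nonneg)] at h
      exact ENNReal.toReal_le_of_le_ofReal (add_nonneg s.coe_nonneg
        (integral_nonneg fun y => measureReal_nonneg)) h
    have h2 : ∫ y, V.real {x - y} ∂(P.map (X s)) ≤
        ∫ y, (M - A.indicator (fun _ => M - c) y) ∂(P.map (X s)) := by
      refine integral_mono hint ((integrable_const M).sub
        ((integrable_const (M - c)).indicator hA)) fun y => ?_
      by_cases hy : y ∈ A
      · simpa [hy] using hc _ (hAF y hy)
      · simpa [hy] using hM _
    rw [integral_sub (integrable_const M) ((integrable_const (M - c)).indicator hA),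
      integral_indicator hA, integral_const, setIntegral_const] at h2
    simp only [probReal_univ, smul_eq_mul, one_mul] at h2
    rw [hFM x hx] at h1
    rw [one_div, inv_mul_eq_div, le_div_iff₀ (by linarith)]
    linarith
  obtain ⟨x₁, hx₁, hx₁max⟩ := hF.exists_maximalFor id F hFne
  obtain ⟨x₂, hx₂, hx₂min⟩ := hF.exists_minimalFor id F hFne
  refine ⟨1 / (M - c) + 1 / (M - c), fun s => ?_⟩
  have e : ({0}ᶜ : Set ℝ) = Iio 0 ∪ Ioi 0 := by
    ext y; simp
  rw [e, add_mul]
  refine (measureReal_union_le _ _).trans (add_le_add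
    (key x₁ hx₁ _ measurableSet_Iio (fun y hy h => ?_) s)
    (key x₂ hx₂ _ measurableSet_Ioi (fun y hy h => ?_) s))
  · have hy' : y < 0 := hy
    have := hx₁max h (by simp only [id]; linarith)
    simp only [id] at this
    linarith
  · have hy' : 0 < y := hy
    have := hx₂min h (by simp only [id]; linarith)
    simp only [id] at this
    linarith

theorem IsLevyProcess.potential_singleton [IsProbabilityMeasure P]
    (hX : IsLevyProcess P X γ σ Λ) (hCP : ¬ IsDriftlessCompoundPoisson γ σ Λ) {q : ℝ} (hq : 0 < q)
    (a : ℝ) : potential P X q {a} = 0 := by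
  by_contra ha
  obtain ⟨K, hK⟩ := hX.exists_measureReal_ne_zero_le hq ha
  refine hCP (isDriftlessCompoundPoisson_of_bounded γ σ hX.levy_measure (B := 2 * K) fun ξ => ?_)
  set ψ := levyExponent γ σ Λ ξ
  have h1 : ∀ s : ℝ≥0, ‖Complex.exp (-((s : ℝ) * ψ)) - 1‖ ≤ 2 * K * s := by
    intro s
    have hprob : IsProbabilityMeasure (P.map (X s)) :=
      Measure.isProbabilityMeasure_map (hX.measurable s).aemeasurable
    have hn : ∀ x : ℝ, ‖Complex.exp (ξ * x * Complex.I)‖ = 1 := fun x => by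
      rw [← Complex.ofReal_mul, Complex.norm_exp_ofReal_mul_I]
    have hint : Integrable (fun x : ℝ => Complex.exp (ξ * x * Complex.I)) (P.map (X s)) :=
      Integrable.of_bound (by fun_prop) 1 (Eventually.of_forall fun x => (hn x).le)
    have e : Complex.exp (-((s : ℝ) * ψ)) - 1 =
        ∫ x in ({0}ᶜ : Set ℝ), (Complex.exp (ξ * x * Complex.I) - 1) ∂(P.map (X s)) := by
      rw [← hX.charFun_eq, charFun_apply_real, setIntegral_eq_integral_of_forall_compl_eq_zero,
        integral_sub hint (integrable_const _)]
      · simp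
      · intro x hx
        have : x = 0 := by simpa using hx
        simp [this]
    rw [e]
    refine (norm_setIntegral_le_of_norm_le_const (C := 2) (measure_lt_top _ _)
      (fun x _ => ?_)).trans ?_
    · refine (norm_sub_le _ _).trans ?_
      rw [hn]
      norm_num
    · linarith [hK s]
  have hd : HasDerivAt (fun s : ℝ => Complex.exp (-((s : ℂ) * ψ))) (-ψ) 0 := by
    have h2 : HasDerivAt (fun s : ℝ => -((s : ℂ) * ψ)) (-(1 * ψ)) 0 :=
      ((Complex.ofRealCLM.hasDerivAt (x := 0)).mul_const ψ).neg
    simpa using h2.cexp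
  have hlim := (hasDerivAt_iff_tendsto_slope_zero.1 hd).norm.mono_left
    (nhdsWithin_mono (0 : ℝ) (fun t (ht : t ∈ Ioi (0 : ℝ)) => (ne_of_gt ht : t ≠ 0)))
  rw [norm_neg] at hlim
  refine le_of_tendsto hlim (eventually_nhdsWithin_of_forall fun t ht => ?_)
  have ht' : 0 < t := ht
  have h3 := h1 t.toNNReal
  rw [Real.coe_toNNReal t ht'.le] at h3
  simp only [zero_add, Complex.ofReal_zero, zero_mul, neg_zero, Complex.exp_zero]
  rw [norm_smul, norm_inv, Real.norm_of_nonneg ht'.le, inv_mul_le_iff₀ ht']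
  linarith

end PeriodicBarrier

namespace PeriodicBarrier

/-! ### Regeneration at deterministic times -/

section

variable {Ω : Type*} [MeasurableSpace Ω] {P : Measure Ω}

lemma indepFun_partial_sums [IsProbabilityMeasure P] {d : ℕ → Ω → ℝ} (hd : ∀ i, Measurable (d i))
    (hi : iIndepFun d P) (k : ℕ) :
    IndepFun (fun ω (j : ℕ) => ∑ i ∈ Finset.range (min j k), d i ω)
      (fun ω (j : ℕ) => ∑ i ∈ Finset.range j, d (k + i) ω) P := by
  refine IndepFun.indepFun_process (by fun_prop) (by fun_prop) fun J => ?_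
  set N := J.sup id
  have h := hi.indepFun_finset (Finset.range k) (Finset.Ico k (k + N)) (by
    rw [Finset.disjoint_left]; intro i h1 h2
    rw [Finset.mem_range] at h1; rw [Finset.mem_Ico] at h2; omega) hd
  set φ : (Finset.range k → ℝ) → ℕ → ℝ := fun v j =>
    ∑ i ∈ Finset.range (min j k), if h : i ∈ Finset.range k then v ⟨i, h⟩ else 0
  set ψ : (Finset.Ico k (k + N) → ℝ) → J → ℝ := fun v j =>
    ∑ i ∈ Finset.range j, if h : k + i ∈ Finset.Ico k (k + N) then v ⟨k + i, h⟩ else 0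
  have hφ : Measurable φ := by
    refine measurable_pi_lambda _ fun j => Finset.measurable_fun_sum _ fun i _ => ?_
    split_ifs <;> fun_prop
  have hψ : Measurable ψ := by
    refine measurable_pi_lambda _ fun j => Finset.measurable_fun_sum _ fun i _ => ?_
    split_ifs <;> fun_prop
  convert! h.comp hφ hψ using 1
  · ext ω j
    refine Finset.sum_congr rfl fun i hi => ?_
    have : i ∈ Finset.range k := by
      rw [Finset.mem_range] at hi ⊢; omega
    rw [dif_pos this]
  · ext ω j
    refine Finset.sum_congr rfl fun i hi => ?_
    have hj : (j : ℕ) ≤ N := Finset.le_sup (f := id) j.2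
    have : k + i ∈ Finset.Ico k (k + N) := by
      rw [Finset.mem_range] at hi; rw [Finset.mem_Ico]; omega
    rw [dif_pos this]

lemma map_sequence_eq [IsProbabilityMeasure P] {d d' : ℕ → Ω → ℝ} (hd : ∀ i, Measurable (d i))
    (hd' : ∀ i, Measurable (d' i)) (hi : iIndepFun d P) (hi' : iIndepFun d' P)
    (h : ∀ i, P.map (d i) = P.map (d' i)) :
    P.map (fun ω i => d i ω) = P.map (fun ω i => d' i ω) := by
  rw [hi.map_fun_eq_infinitePi_map hd, hi'.map_fun_eq_infinitePi_map hd']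
  simp_rw [h]

lemma exists_monotone_enumeration (J : Finset ℝ≥0) : ∃ e : ℕ → ℝ≥0, Monotone e ∧ e 0 = 0 ∧
    ∃ n : ℕ, (∀ i, n ≤ i → e i = e n) ∧ (∀ i, e i ∈ insert 0 J) ∧ ∀ u ∈ J, ∃ m, e m = u := by
  induction J using Finset.induction_on_max with
  | empty => exact ⟨fun _ => 0, monotone_const, rfl, 0, by simp⟩
  | insert a s has ih =>
    obtain ⟨e, he, he0, n, hn, hes, hs⟩ := ih
    have hea : ∀ i, e i ≤ a := fun i => by
      rcases Finset.mem_insert.1 (hes i) with h | h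
      · rw [h]; exact zero_le
      · exact (has _ h).le
    refine ⟨fun i => if i ≤ n then e i else a, fun i j hij => ?_, by simp [he0], n + 1,
      fun i hi => ?_, fun i => ?_, fun u hu => ?_⟩
    · dsimp only
      split_ifs with h1 h2 h2
      · exact he hij
      · exact hea i
      · omega
      · exact le_rfl
    · dsimp only
      rw [if_neg (by omega), if_neg (by omega)]
    · dsimp only
      split_ifs
      · rcases Finset.mem_insert.1 (hes i) with h | h
        · simp [h]
        · simp [h]
      · simp
    · rcases Finset.mem_insert.1 hu with rfl | h
      · exact ⟨n + 1, by simp⟩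
      · obtain ⟨m, hm⟩ := hs u h
        rcases le_total m n with h2 | h2
        · exact ⟨m, by simp [h2, hm]⟩
        · exact ⟨n, by simp [← hn m h2, hm]⟩

variable {X : ℝ≥0 → Ω → ℝ} {γ σ : ℝ} {Λ : Measure ℝ}

/-- The increments of a Lévy process after time `s` form a copy of the process. -/
lemma IsLevyProcess.map_shift [IsProbabilityMeasure P] (hX : IsLevyProcess P X γ σ Λ) (s : ℝ≥0) :
    P.map (fun ω u => X (s + u) ω - X s ω) = P.map (fun ω u => X u ω) := by
  have hm := hX.measurable
  rw [map_eq_iff_forall_finset_map_restrict_eq (X := fun u ω => X (s + u) ω - X s ω)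
    (measurable_pi_lambda _ fun u => (hm _).sub (hm s)).aemeasurable
    (measurable_pi_lambda _ hm).aemeasurable]
  intro J
  obtain ⟨e, he, he0, -, -, -, hJ⟩ := exists_monotone_enumeration J
  choose! m hme using hJ
  have h := map_sequence_eq (P := P) (d := fun i ω => X (s + e (i + 1)) ω - X (s + e i) ω)
    (d' := fun i ω => X (e (i + 1)) ω - X (e i) ω) (by fun_prop) (by fun_prop)
    (hX.indep_increments.nat (t := fun i => s + e i) fun i j hij => add_le_add_right (he hij) s)
    (hX.indep_increments.nat he) fun i => by
      have h1 : e i ≤ e (i + 1) := he (Nat.le_succ i)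
      have h2 := (hX.stationary_increments (s + e i) (e (i + 1) - e i)).map_eq
      have h3 := (hX.stationary_increments (e i) (e (i + 1) - e i)).map_eq
      rw [add_assoc, add_tsub_cancel_of_le h1] at h2
      rw [add_tsub_cancel_of_le h1] at h3
      exact h2.trans h3.symm
  set φ : (ℕ → ℝ) → J → ℝ := fun v u => ∑ i ∈ Finset.range (m u), v i
  have hφ : Measurable φ := by fun_prop
  have h4 := congrArg (Measure.map φ) h
  rw [Measure.map_map hφ (by fun_prop), Measure.map_map hφ (by fun_prop)] at h4
  convert! h4 using 1
  · congr 1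
    ext ω u
    simp only [Finset.restrict, Function.comp_apply, φ]
    rw [Finset.sum_range_sub (fun i => X (s + e i) ω), hme u u.2, he0, add_zero]
  · refine Measure.map_congr ?_
    filter_upwards [hX.start_zero] with ω hω
    ext u
    simp only [Finset.restrict, Function.comp_apply, φ]
    rw [Finset.sum_range_sub (fun i => X (e i) ω), hme u u.2, he0, hω, sub_zero]

/-- Independent increments: the values at the times `τ 0 ≤ … ≤ τ k` are independent of the
increments after `τ k`. -/
lemma IsLevyProcess.indepFun_shift [IsProbabilityMeasure P] (hX : IsLevyProcess P X γ σ Λ)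
    {τ : ℕ → ℝ≥0} (hτ : Monotone τ) (hτ0 : τ 0 = 0) (k : ℕ) :
    IndepFun (fun ω (j : ℕ) => X (τ (min j k)) ω) (fun ω u => X (τ k + u) ω - X (τ k) ω) P := by
  have hm := hX.measurable
  refine IndepFun.indepFun_process (by fun_prop) (by fun_prop) fun J => ?_
  obtain ⟨e, he, he0, -, -, -, hJ⟩ := exists_monotone_enumeration J
  choose! m hme using hJ
  set t : ℕ → ℝ≥0 := fun i => if i ≤ k then τ i else τ k + e (i - k)
  have ht1 : ∀ i, i ≤ k → t i = τ i := fun i hi => if_pos hi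
  have ht2 : ∀ i, t (k + i) = τ k + e i := fun i => by
    rcases Nat.eq_zero_or_pos i with rfl | hi
    · simp [t, he0]
    · simp only [t]
      rw [if_neg (by omega), Nat.add_sub_cancel_left]
  have ht : Monotone t := by
    intro i j hij
    rcases le_total j k with h | h
    · rw [ht1 j h, ht1 i (hij.trans h)]; exact hτ hij
    · obtain ⟨j', rfl⟩ := Nat.exists_eq_add_of_le h
      rw [ht2]
      rcases le_total i k with h' | h'
      · rw [ht1 i h']; exact (hτ h').trans le_self_add
      · obtain ⟨i', rfl⟩ := Nat.exists_eq_add_of_le h'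
        rw [ht2]
        gcongr
        exact he (by omega)
  have h := indepFun_partial_sums (P := P) (d := fun i ω => X (t (i + 1)) ω - X (t i) ω)
    (by fun_prop) (hX.indep_increments.nat ht) k
  have h2 := h.comp (φ := id) (ψ := fun (v : ℕ → ℝ) (u : J) => v (m u)) measurable_id (by fun_prop)
  refine h2.congr ?_ ?_
  · filter_upwards [hX.start_zero] with ω hω
    ext j
    simp only [Function.comp_apply, id]
    rw [Finset.sum_range_sub (fun i => X (t i) ω), ht1 _ (min_le_right j k), ht1 0 (Nat.zero_le k),
      hτ0, hω, sub_zero]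
  · refine Eventually.of_forall fun ω => ?_
    ext u
    have h3 := Finset.sum_range_sub (fun i => X (t (k + i)) ω) (m u)
    simp only [← add_assoc] at h3
    simp only [Function.comp_apply]
    rw [h3, ht2, ht2, he0, add_zero, hme u u.2]

/-! ### Arrival times -/

/-- A sequence of arrival times: it starts at `0`, increases strictly and is unbounded. -/
structure IsArrivalSeq (τ : ℕ → ℝ≥0) : Prop where
  zero : τ 0 = 0
  strictMono : StrictMono τ
  tendsto : Tendsto τ atTop atTop

/-- The arrival times after the `k`-th one, measured from the `k`-th one. -/
def shiftSeq (τ : ℕ → ℝ≥0) (k : ℕ) : ℕ → ℝ≥0 := fun j => τ (k + j) - τ k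

lemma IsArrivalSeq.shift {τ : ℕ → ℝ≥0} (hτ : IsArrivalSeq τ) (k : ℕ) :
    IsArrivalSeq (shiftSeq τ k) where
  zero := by simp [shiftSeq]
  strictMono i j hij := by
    have h1 : τ k ≤ τ (k + i) := hτ.strictMono.monotone (by omega)
    exact tsub_lt_tsub_right_of_le h1 (hτ.strictMono (by omega))
  tendsto := by
    refine tendsto_atTop_mono (f := fun j => τ (j + k) - τ k) (fun j => by
      rw [shiftSeq, add_comm]) ?_
    refine tendsto_atTop.2 fun b => ?_
    filter_upwards [((tendsto_add_atTop_iff_nat k).2 hτ.tendsto).eventually_ge_atTop (b + τ k)]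
      with j hj
    exact le_tsub_of_add_le_right hj

variable {T : ℕ → Ω → ℝ≥0} {η : ℝ}

lemma sum_increments (τ : ℕ → ℝ≥0) (k j : ℕ) :
    ∑ i ∈ Finset.range j, ((τ (k + i + 1) : ℝ) - τ (k + i)) = (τ (k + j) : ℝ) - τ k :=
  Finset.sum_range_sub (fun i => (τ (k + i) : ℝ)) j

lemma shiftSeq_eq (τ : ℕ → ℝ≥0) (k j : ℕ) :
    shiftSeq τ k j =
      (∑ i ∈ Finset.range j, ((τ (k + i + 1) : ℝ) - τ (k + i))).toNNReal := by
  rw [sum_increments, shiftSeq, ← NNReal.sub_def]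

lemma IsPoissonArrivals.eq_toNNReal_sum (hT : IsPoissonArrivals P T η) (j : ℕ) (ω : Ω) :
    T j ω = (∑ i ∈ Finset.range j, ((T (i + 1) ω : ℝ) - T i ω)).toNNReal := by
  have := sum_increments (fun i => T i ω) 0 j
  simp only [zero_add] at this
  rw [this, hT.start_zero]
  simp

lemma IsPoissonArrivals.indepFun_shiftSeq [IsProbabilityMeasure P] (hT : IsPoissonArrivals P T η)
    (k : ℕ) :
    IndepFun (fun ω (j : ℕ) => T (min j k) ω) (fun ω => shiftSeq (fun i => T i ω) k) P := by
  have hm := hT.measurable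
  have h := indepFun_partial_sums (P := P) (d := fun i ω => (T (i + 1) ω : ℝ) - T i ω)
    (by fun_prop) hT.indep k
  have hc : Measurable fun (v : ℕ → ℝ) (j : ℕ) => (v j).toNNReal := by fun_prop
  have h2 := h.comp hc hc
  refine h2.congr (Eventually.of_forall fun ω => ?_) (Eventually.of_forall fun ω => ?_)
  · ext j
    simp only [Function.comp_apply]
    rw [← hT.eq_toNNReal_sum]
  · ext j
    simp only [Function.comp_apply]
    rw [shiftSeq_eq]

lemma IsPoissonArrivals.map_shiftSeq [IsProbabilityMeasure P] (hT : IsPoissonArrivals P T η)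
    (k : ℕ) : P.map (fun ω => shiftSeq (fun i => T i ω) k) = P.map (fun ω j => T j ω) := by
  have hm := hT.measurable
  have h := map_sequence_eq (P := P) (d := fun i ω => (T (k + i + 1) ω : ℝ) - T (k + i) ω)
    (d' := fun i ω => (T (i + 1) ω : ℝ) - T i ω) (by fun_prop) (by fun_prop)
    (hT.indep.precomp (g := fun i => k + i) fun i j h => by simpa using h) hT.indep
    fun i => (hT.law (k + i)).trans (hT.law i).symm
  have hc : Measurable fun (v : ℕ → ℝ) (j : ℕ) => (∑ i ∈ Finset.range j, v i).toNNReal := by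
    fun_prop
  have h4 := congrArg (Measure.map fun (v : ℕ → ℝ) (j : ℕ) =>
    (∑ i ∈ Finset.range j, v i).toNNReal) h
  rw [Measure.map_map hc (by fun_prop), Measure.map_map hc (by fun_prop)] at h4
  convert! h4 using 2
  · ext ω j
    rw [shiftSeq_eq]
    rfl
  · ext ω j
    rw [hT.eq_toNNReal_sum]
    rfl

lemma ae_expMeasure_pos {η : ℝ} (hη : 0 < η) : ∀ᵐ x ∂(expMeasure η), 0 < x := by
  have := isProbabilityMeasure_expMeasure hη
  have h := cdf_expMeasure_eq hη 0
  rw [cdf_eq_real] at h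
  simp only [le_refl, if_true, mul_zero, neg_zero, Real.exp_zero, sub_self] at h
  rw [ae_iff]
  have h2 := (measureReal_eq_zero_iff (measure_ne_top _ _)).1 h
  convert! h2 using 2
  ext x
  simp

lemma IsPoissonArrivals.ae_strictMono (hT : IsPoissonArrivals P T η) (hη : 0 < η) :
    ∀ᵐ ω ∂P, StrictMono fun k => T k ω := by
  have hm := hT.measurable
  have h : ∀ k, ∀ᵐ ω ∂P, T k ω < T (k + 1) ω := fun k => by
    have h1 := ae_expMeasure_pos hη
    rw [← hT.law k] at h1
    filter_upwards [ae_of_ae_map (by fun_prop) h1] with ω hω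
    exact_mod_cast sub_pos.1 hω
  filter_upwards [ae_all_iff.2 h] with ω hω
  exact strictMono_nat_of_lt_succ hω

lemma IsPoissonArrivals.lintegral_exp_neg [IsProbabilityMeasure P] (hT : IsPoissonArrivals P T η)
    (q : ℝ) (k : ℕ) :
    ∫⁻ ω, ENNReal.ofReal (Real.exp (-(q * T k ω))) ∂P =
      (∫⁻ x, ENNReal.ofReal (Real.exp (-(q * x))) ∂(expMeasure η)) ^ k := by
  have hm := hT.measurable
  have h := lintegral_prod_eq_prod_lintegral_of_indepFun (μ := P) (Finset.range k)
    (fun i ω => ENNReal.ofReal (Real.exp (-(q * ((T (i + 1) ω : ℝ) - T i ω)))))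
    (hT.indep.comp (fun _ x => ENNReal.ofReal (Real.exp (-(q * x)))) (by fun_prop)) (by fun_prop)
  have h2 : ∀ i, ∫⁻ ω, ENNReal.ofReal (Real.exp (-(q * ((T (i + 1) ω : ℝ) - T i ω)))) ∂P =
      ∫⁻ x, ENNReal.ofReal (Real.exp (-(q * x))) ∂(expMeasure η) := fun i => by
    rw [← hT.law i, lintegral_map (by fun_prop) (by fun_prop)]
  simp only [h2, Finset.prod_const, Finset.card_range] at h
  rw [← h]
  refine lintegral_congr fun ω => ?_
  rw [← ENNReal.ofReal_prod_of_nonneg (fun _ _ => Real.exp_nonneg _), ← Real.exp_sum]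
  congr 2
  rw [Finset.sum_neg_distrib, ← Finset.mul_sum]
  have := sum_increments (fun i => T i ω) 0 k
  simp only [zero_add] at this
  rw [this, hT.start_zero]
  simp

lemma lintegral_exp_neg_expMeasure_lt_one {η q : ℝ} (hη : 0 < η) (hq : 0 < q) :
    ∫⁻ x, ENNReal.ofReal (Real.exp (-(q * x))) ∂(expMeasure η) < 1 := by
  have := isProbabilityMeasure_expMeasure hη
  have hlt : ∀ᵐ x ∂(expMeasure η), ENNReal.ofReal (Real.exp (-(q * x))) < 1 := by
    filter_upwards [ae_expMeasure_pos hη] with x hx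
    rw [← ENNReal.ofReal_one, ENNReal.ofReal_lt_ofReal_iff one_pos, Real.exp_lt_one_iff]
    nlinarith [mul_pos hq hx]
  have hle : ∫⁻ x, ENNReal.ofReal (Real.exp (-(q * x))) ∂(expMeasure η) ≤
      ∫⁻ _, 1 ∂(expMeasure η) := lintegral_mono_ae (hlt.mono fun _ h => h.le)
  have h1 : ∫⁻ _, (1 : ℝ≥0∞) ∂(expMeasure η) = 1 := by simp
  calc _ < ∫⁻ _, (1 : ℝ≥0∞) ∂(expMeasure η) := by
        refine lintegral_strict_mono (IsProbabilityMeasure.ne_zero _) (by fun_prop) ?_ hlt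
        exact (hle.trans_lt (by rw [h1]; exact ENNReal.one_lt_top)).ne
    _ = 1 := h1

/-- The expected total discount at the arrival times is finite. -/
lemma IsPoissonArrivals.tsum_lintegral_exp_neg_lt_top [IsProbabilityMeasure P]
    (hT : IsPoissonArrivals P T η) (hη : 0 < η) {q : ℝ} (hq : 0 < q) :
    ∑' k, ∫⁻ ω, ENNReal.ofReal (Real.exp (-(q * T k ω))) ∂P < ⊤ := by
  simp_rw [hT.lintegral_exp_neg]
  rw [ENNReal.tsum_geometric]
  exact ENNReal.inv_lt_top.2 (tsub_pos_of_lt (lintegral_exp_neg_expMeasure_lt_one hη hq))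

lemma IsPoissonArrivals.ae_isArrivalSeq [IsProbabilityMeasure P] (hT : IsPoissonArrivals P T η)
    (hη : 0 < η) : ∀ᵐ ω ∂P, IsArrivalSeq fun k => T k ω := by
  have hm := hT.measurable
  have h := hT.tsum_lintegral_exp_neg_lt_top hη one_pos
  rw [← lintegral_tsum (by fun_prop)] at h
  filter_upwards [hT.ae_strictMono hη, ae_lt_top (by fun_prop) h.ne] with ω h1 h2
  refine ⟨hT.start_zero ω, h1, ?_⟩
  have h3 := ENNReal.tendsto_atTop_zero_of_tsum_ne_top h2.ne
  have h4 : Tendsto (fun k => Real.exp (-(1 * (T k ω : ℝ)))) atTop (𝓝 0) := by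
    have := (ENNReal.tendsto_toReal ENNReal.zero_ne_top).comp h3
    refine this.congr fun k => ?_
    simp [Real.exp_nonneg]
  have h5 := Real.tendsto_exp_comp_nhds_zero.1 h4
  simp only [one_mul] at h5
  exact NNReal.tendsto_coe_atTop.1 (tendsto_neg_atBot_iff.1 h5)

end

end PeriodicBarrier

namespace PeriodicBarrier

/-! ### Regeneration at the arrival times -/

section

/-- The observations of the path `p` at the times `τ`. -/
noncomputable def observations (p : ℝ≥0 → ℝ) (τ : ℕ → ℝ≥0) (j : ℕ) : ℝ≥0 × ℝ :=
  (τ j, evalRight p (τ j))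

/-- The increments of the path `p` after the time `s`. -/
noncomputable def shiftPath (p : ℝ≥0 → ℝ) (s : ℝ≥0) (u : ℝ≥0) : ℝ :=
  evalRight p (s + u) - evalRight p s

lemma measurable_observations :
    Measurable fun z : (ℝ≥0 → ℝ) × (ℕ → ℝ≥0) => observations z.1 z.2 :=
  measurable_pi_lambda _ fun _ => Measurable.prodMk (by fun_prop)
    (measurable_evalRight_comp measurable_fst (by fun_prop))

lemma measurable_shiftPath : Measurable fun z : (ℝ≥0 → ℝ) × ℝ≥0 => shiftPath z.1 z.2 :=
  measurable_pi_lambda _ fun _ => Measurable.sub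
    (measurable_evalRight_comp measurable_fst (by fun_prop))
    (measurable_evalRight_comp measurable_fst (by fun_prop))

lemma measurable_shiftSeq (k : ℕ) : Measurable fun τ : ℕ → ℝ≥0 => shiftSeq τ k := by
  unfold shiftSeq
  fun_prop

variable {Ω : Type*} [MeasurableSpace Ω] {P : Measure Ω} {X : ℝ≥0 → Ω → ℝ} {γ σ : ℝ}
  {Λ : Measure ℝ} {T : ℕ → Ω → ℝ≥0} {η : ℝ}

lemma IsLevyProcess.lintegral_observations_shift [IsProbabilityMeasure P]
    (hX : IsLevyProcess P X γ σ Λ) {τ : ℕ → ℝ≥0} (hτ : IsArrivalSeq τ) (k : ℕ)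
    {G : (ℕ → ℝ≥0 × ℝ) × (ℝ≥0 → ℝ) → ℝ≥0∞} (hG : Measurable G) :
    ∫⁻ p, G (observations p (fun j => τ (min j k)), shiftPath p (τ k))
        ∂(P.map fun ω t => X t ω) =
      ∫⁻ p, ∫⁻ p', G (observations p (fun j => τ (min j k)), p') ∂(P.map fun ω t => X t ω)
        ∂(P.map fun ω t => X t ω) := by
  have hm := hX.measurable
  have hpath := hX.measurable_path
  have hobs : Measurable fun p : ℝ≥0 → ℝ => observations p (fun j => τ (min j k)) :=
    measurable_observations.comp (measurable_id.prodMk measurable_const)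
  have hsh : Measurable fun p : ℝ≥0 → ℝ => shiftPath p (τ k) :=
    measurable_shiftPath.comp (measurable_id.prodMk measurable_const)
  have hGo : Measurable fun p : ℝ≥0 → ℝ =>
      G (observations p (fun j => τ (min j k)), shiftPath p (τ k)) := hG.comp (hobs.prodMk hsh)
  rw [lintegral_map hGo hpath]
  have hin : Measurable fun e : ℕ → ℝ≥0 × ℝ => ∫⁻ p', G (e, p') ∂(P.map fun ω t => X t ω) := by
    have : IsProbabilityMeasure (P.map fun ω t => X t ω) :=
      Measure.isProbabilityMeasure_map hpath.aemeasurable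
    exact hG.lintegral_prod_right'
  have hino : Measurable fun p : ℝ≥0 → ℝ => ∫⁻ p', G (observations p (fun j => τ (min j k)), p')
      ∂(P.map fun ω t => X t ω) := hin.comp hobs
  rw [lintegral_map hino hpath]
  set A : Ω → ℕ → ℝ := fun ω j => X (τ (min j k)) ω
  set B : Ω → ℝ≥0 → ℝ := fun ω u => X (τ k + u) ω - X (τ k) ω
  have hA : Measurable A := measurable_pi_lambda _ fun j => hm _
  have hB : Measurable B := measurable_pi_lambda _ fun u => (hm _).sub (hm _)
  have hi := hX.indepFun_shift hτ.strictMono.monotone hτ.zero k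
  have hprod := (indepFun_iff_map_prod_eq_prod_map_map hA.aemeasurable hB.aemeasurable).1 hi
  set c : (ℕ → ℝ) → ℕ → ℝ≥0 × ℝ := fun a j => (τ (min j k), a j)
  have hc : Measurable c := by fun_prop
  have hobsA : ∀ᵐ ω ∂P, observations (fun t => X t ω) (fun j => τ (min j k)) = c (A ω) := by
    filter_upwards [hX.ae_evalRight] with ω hω
    ext j
    · rfl
    · simp [observations, hω, c, A]
  have hshB : ∀ᵐ ω ∂P, shiftPath (fun t => X t ω) (τ k) = B ω := by
    filter_upwards [hX.ae_evalRight] with ω hω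
    ext u
    simp [shiftPath, hω, B]
  have hGc : Measurable fun z : (ℕ → ℝ) × (ℝ≥0 → ℝ) => G (c z.1, z.2) :=
    hG.comp ((hc.comp measurable_fst).prodMk measurable_snd)
  have hpA : IsProbabilityMeasure (P.map A) := Measure.isProbabilityMeasure_map hA.aemeasurable
  have hpB : IsProbabilityMeasure (P.map B) := Measure.isProbabilityMeasure_map hB.aemeasurable
  calc ∫⁻ ω, G (observations (fun t => X t ω) (fun j => τ (min j k)),
          shiftPath (fun t => X t ω) (τ k)) ∂P
      = ∫⁻ ω, G (c (A ω), B ω) ∂P := by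
        refine lintegral_congr_ae ?_
        filter_upwards [hobsA, hshB] with ω h1 h2
        rw [h1, h2]
    _ = ∫⁻ z, G (c z.1, z.2) ∂(P.map fun ω => (A ω, B ω)) :=
        (lintegral_map hGc (hA.prodMk hB)).symm
    _ = ∫⁻ a, ∫⁻ b, G (c a, b) ∂(P.map B) ∂(P.map A) := by
        rw [hprod, lintegral_prod _ hGc.aemeasurable]
    _ = ∫⁻ ω, ∫⁻ b, G (c (A ω), b) ∂(P.map B) ∂P :=
        lintegral_map hGc.lintegral_prod_right' hA
    _ = _ := by
        rw [show P.map B = P.map fun ω t => X t ω from hX.map_shift (τ k)]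
        refine lintegral_congr_ae ?_
        filter_upwards [hobsA] with ω h1
        simp only [h1]

/-- At the `k`-th arrival time the pair of the Lévy process and the arrival times starts afresh,
independently of the observations made so far. -/
theorem map_observations_shift [IsProbabilityMeasure P] (hX : IsLevyProcess P X γ σ Λ)
    (hT : IsPoissonArrivals P T η) (hη : 0 < η)
    (hXT : IndepFun (fun ω t => X t ω) (fun ω k => T k ω) P) (k : ℕ) :
    P.map (fun ω => (observations (fun t => X t ω) (fun j => T (min j k) ω),
        (shiftPath (fun t => X t ω) (T k ω), shiftSeq (fun j => T j ω) k))) =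
      (P.map fun ω => observations (fun t => X t ω) (fun j => T (min j k) ω)).prod
        (P.map fun ω => ((fun t => X t ω), (fun j => T j ω))) := by
  have hTm : Measurable fun ω j => T j ω := measurable_pi_lambda _ hT.measurable
  have hpath := hX.measurable_path
  have hTk : Measurable fun ω (j : ℕ) => T (min j k) ω :=
    measurable_pi_lambda _ fun j => hT.measurable _
  have hsT : Measurable fun ω => shiftSeq (fun j => T j ω) k := (measurable_shiftSeq k).comp hTm
  set Q := P.map fun ω t => X t ω
  set N := P.map fun ω j => T j ω
  set Nk := P.map fun ω (j : ℕ) => T (min j k) ω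
  have : IsProbabilityMeasure Q := Measure.isProbabilityMeasure_map hpath.aemeasurable
  have : IsProbabilityMeasure N := Measure.isProbabilityMeasure_map hTm.aemeasurable
  have : IsProbabilityMeasure Nk := Measure.isProbabilityMeasure_map hTk.aemeasurable
  have hprod : P.map (fun ω => ((fun t => X t ω), (fun j => T j ω))) = Q.prod N :=
    (indepFun_iff_map_prod_eq_prod_map_map hpath.aemeasurable hTm.aemeasurable).1 hXT
  have hprodT : P.map (fun ω => ((fun j => T (min j k) ω), shiftSeq (fun j => T j ω) k)) =
      Nk.prod N := by
    rw [(indepFun_iff_map_prod_eq_prod_map_map hTk.aemeasurable hsT.aemeasurable).1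
      (hT.indepFun_shiftSeq k), hT.map_shiftSeq k]
  have hprodk : P.map (fun ω => ((fun t => X t ω), (fun (j : ℕ) => T (min j k) ω))) =
      Q.prod Nk := by
    have hc : Measurable fun (τ : ℕ → ℝ≥0) (j : ℕ) => τ (min j k) := by fun_prop
    exact (indepFun_iff_map_prod_eq_prod_map_map hpath.aemeasurable hTk.aemeasurable).1
      (hXT.comp measurable_id hc)
  have hobs : Measurable fun z : (ℝ≥0 → ℝ) × (ℕ → ℝ≥0) => observations z.1 z.2 :=
    measurable_observations
  have hobsk : Measurable fun ω => observations (fun t => X t ω) (fun j => T (min j k) ω) :=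
    hobs.comp (hpath.prodMk hTk)
  refine Measure.ext_of_lintegral _ fun G hG => ?_
  set K : (ℕ → ℝ≥0) → (ℕ → ℝ≥0) → ℝ≥0∞ := fun e τ =>
    ∫⁻ p, ∫⁻ p', G (observations p e, (p', τ)) ∂Q ∂Q
  have hK : Measurable fun z : (ℕ → ℝ≥0) × (ℕ → ℝ≥0) => K z.1 z.2 := by
    have h1 : Measurable fun z : (((ℕ → ℝ≥0) × (ℕ → ℝ≥0)) × (ℝ≥0 → ℝ)) × (ℝ≥0 → ℝ) =>
        G (observations z.1.2 z.1.1.1, (z.2, z.1.1.2)) :=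
      hG.comp ((hobs.comp (by fun_prop : Measurable fun
        z : (((ℕ → ℝ≥0) × (ℕ → ℝ≥0)) × (ℝ≥0 → ℝ)) × (ℝ≥0 → ℝ) => (z.1.2, z.1.1.1))).prodMk
        (by fun_prop))
    exact h1.lintegral_prod_right'.lintegral_prod_right'
  have hshz : Measurable fun z : (ℝ≥0 → ℝ) × (ℕ → ℝ≥0) => shiftPath z.1 (z.2 k) :=
    measurable_shiftPath.comp (measurable_fst.prodMk (by fun_prop))
  have hobsz : Measurable fun z : (ℝ≥0 → ℝ) × (ℕ → ℝ≥0) =>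
      observations z.1 (fun j => z.2 (min j k)) :=
    hobs.comp (measurable_fst.prodMk (by fun_prop))
  have hF : Measurable fun z : (ℝ≥0 → ℝ) × (ℕ → ℝ≥0) =>
      G (observations z.1 (fun j => z.2 (min j k)), (shiftPath z.1 (z.2 k), shiftSeq z.2 k)) :=
    hG.comp (hobsz.prodMk (hshz.prodMk ((measurable_shiftSeq k).comp measurable_snd)))
  have hL : ∫⁻ y, G y ∂(P.map (fun ω => (observations (fun t => X t ω) (fun j => T (min j k) ω),
        (shiftPath (fun t => X t ω) (T k ω), shiftSeq (fun j => T j ω) k)))) =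
      ∫⁻ e, ∫⁻ τ, K e τ ∂N ∂Nk := by
    have hshk : Measurable fun ω => shiftPath (fun t => X t ω) (T k ω) :=
      measurable_shiftPath.comp (hpath.prodMk (hT.measurable k))
    rw [lintegral_map hG (hobsk.prodMk (hshk.prodMk hsT))]
    calc _ = ∫⁻ z, G (observations z.1 (fun j => z.2 (min j k)),
              (shiftPath z.1 (z.2 k), shiftSeq z.2 k)) ∂(Q.prod N) := by
            rw [← hprod, lintegral_map hF (hpath.prodMk hTm)]
      _ = ∫⁻ τ, ∫⁻ p, G (observations p (fun j => τ (min j k)),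
              (shiftPath p (τ k), shiftSeq τ k)) ∂Q ∂N := lintegral_prod_symm' _ hF
      _ = ∫⁻ ω, ∫⁻ p, G (observations p (fun j => T (min j k) ω),
              (shiftPath p (T k ω), shiftSeq (fun j => T j ω) k)) ∂Q ∂P :=
            lintegral_map hF.lintegral_prod_left' hTm
      _ = ∫⁻ ω, K (fun j => T (min j k) ω) (shiftSeq (fun j => T j ω) k) ∂P := by
            refine lintegral_congr_ae ?_
            filter_upwards [hT.ae_isArrivalSeq hη] with ω hω
            exact hX.lintegral_observations_shift hω k
              (G := fun z => G (z.1, (z.2, shiftSeq (fun j => T j ω) k)))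
              (hG.comp (measurable_fst.prodMk (measurable_snd.prodMk measurable_const)))
      _ = ∫⁻ z, K z.1 z.2 ∂(Nk.prod N) := by
            rw [← hprodT, lintegral_map hK (hTk.prodMk hsT)]
      _ = _ := lintegral_prod _ hK.aemeasurable
  rw [hL, hprod, lintegral_prod _ hG.aemeasurable, lintegral_map hG.lintegral_prod_right' hobsk]
  have hJ : Measurable fun z : (ℝ≥0 → ℝ) × (ℕ → ℝ≥0) =>
      ∫⁻ w, G (observations z.1 z.2, w) ∂(Q.prod N) :=
    hG.lintegral_prod_right'.comp hobs
  calc ∫⁻ e, ∫⁻ τ, K e τ ∂N ∂Nk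
      = ∫⁻ e, ∫⁻ p, ∫⁻ w, G (observations p e, w) ∂(Q.prod N) ∂Q ∂Nk := by
        refine lintegral_congr fun e => ?_
        have h1 : Measurable fun z : ((ℕ → ℝ≥0) × (ℝ≥0 → ℝ)) × (ℝ≥0 → ℝ) =>
            G (observations z.1.2 e, (z.2, z.1.1)) :=
          hG.comp ((hobs.comp (by fun_prop : Measurable fun
            z : ((ℕ → ℝ≥0) × (ℝ≥0 → ℝ)) × (ℝ≥0 → ℝ) => (z.1.2, e))).prodMk (by fun_prop))
        rw [lintegral_lintegral_swap h1.lintegral_prod_right'.aemeasurable]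
        refine lintegral_congr fun p => ?_
        exact (lintegral_prod_symm' (fun w => G (observations p e, w))
          (hG.comp (measurable_const.prodMk measurable_id))).symm
    _ = ∫⁻ z, ∫⁻ w, G (observations z.1 z.2, w) ∂(Q.prod N) ∂(Q.prod Nk) :=
        (lintegral_prod_symm' _ hJ).symm
    _ = _ := by rw [← hprodk, lintegral_map hJ (hpath.prodMk hTk)]

end

end PeriodicBarrier

namespace PeriodicBarrier

/-! ### The controlled path -/

section

/-- The running maximum `y ∨ max_{1 ≤ j ≤ k} (b - a_j)`. -/
def level (b y : ℝ) (a : ℕ → ℝ) : ℕ → ℝ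
  | 0 => y
  | k + 1 => max (level b y a k) (b - a (k + 1))

/-- The difference between the controlled path started at `y` and the path `p`: the running maximum
of `b - p` over the observation times up to `t`, started at `y`. -/
noncomputable def pushed (b y : ℝ) (p : ℝ≥0 → ℝ) (τ : ℕ → ℝ≥0) (t : ℝ≥0) : ℝ :=
  ⨆ k, if τ k ≤ t then level b y (fun j => p (τ j)) k else y

/-- The controlled path started at `y`, where `p` is the uncontrolled path started at `0`. -/
noncomputable def ctrl (b y : ℝ) (p : ℝ≥0 → ℝ) (τ : ℕ → ℝ≥0) (t : ℝ≥0) : ℝ :=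
  p t + pushed b y p τ t

lemma level_mono (b y : ℝ) (a : ℕ → ℝ) : Monotone (level b y a) :=
  monotone_nat_of_le_succ fun _ => le_max_left _ _

lemma le_level (b y : ℝ) (a : ℕ → ℝ) (k : ℕ) : y ≤ level b y a k :=
  level_mono b y a (Nat.zero_le k)

lemma level_mono_left (b : ℝ) {y z : ℝ} (h : y ≤ z) (a : ℕ → ℝ) (k : ℕ) :
    level b y a k ≤ level b z a k := by
  induction k with
  | zero => exact h
  | succ k ih => exact max_le_max ih le_rfl

lemma level_le_add (b : ℝ) {y z : ℝ} (h : y ≤ z) (a : ℕ → ℝ) (k : ℕ) :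
    level b z a k ≤ level b y a k + (z - y) := by
  induction k with
  | zero => simp [level]
  | succ k ih =>
    simp only [level]
    refine max_le ?_ ?_
    · linarith [le_max_left (level b y a k) (b - a (k + 1))]
    · linarith [le_max_right (level b y a k) (b - a (k + 1))]

lemma abs_level_sub_level_le (b y z : ℝ) (a : ℕ → ℝ) (k : ℕ) :
    |level b z a k - level b y a k| ≤ |z - y| := by
  rcases le_total y z with h | h
  · rw [abs_of_nonneg (sub_nonneg.2 (level_mono_left b h a k)), abs_of_nonneg (sub_nonneg.2 h)]
    linarith [level_le_add b h a k]
  · rw [abs_of_nonpos (sub_nonpos.2 (level_mono_left b h a k)), abs_of_nonpos (sub_nonpos.2 h)]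
    linarith [level_le_add b h a k]

lemma level_eq (b y : ℝ) (a : ℕ → ℝ) (k : ℕ) :
    level b y a k = y ∨ ∃ j, 1 ≤ j ∧ j ≤ k ∧ level b y a k = b - a j := by
  induction k with
  | zero => exact Or.inl rfl
  | succ k ih =>
    simp only [level]
    rcases max_choice (level b y a k) (b - a (k + 1)) with h | h
    · rw [h]
      rcases ih with h1 | ⟨j, h1, h2, h3⟩
      · exact Or.inl h1
      · exact Or.inr ⟨j, h1, by omega, h3⟩
    · rw [h]
      exact Or.inr ⟨k + 1, by omega, le_rfl, rfl⟩

lemma level_congr (b y : ℝ) {a a' : ℕ → ℝ} {k : ℕ} (h : ∀ j ≤ k, a j = a' j) :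
    level b y a k = level b y a' k := by
  induction k with
  | zero => rfl
  | succ k ih =>
    simp only [level]
    rw [ih fun j hj => h j (by omega), h (k + 1) le_rfl]

variable {τ : ℕ → ℝ≥0}

lemma IsArrivalSeq.exists_index (hτ : IsArrivalSeq τ) (t : ℝ≥0) :
    ∃ k, τ k ≤ t ∧ t < τ (k + 1) := by
  have h : ∃ k, t < τ k := (hτ.tendsto.eventually_gt_atTop t).exists
  classical
  have h1 := Nat.find_spec h
  obtain ⟨k, hk⟩ : ∃ k, Nat.find h = k + 1 := by
    refine Nat.exists_eq_succ_of_ne_zero fun h0 => ?_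
    rw [h0, hτ.zero] at h1
    exact not_lt_zero h1
  refine ⟨k, not_lt.1 (Nat.find_min h (by omega)), hk ▸ h1⟩

lemma IsArrivalSeq.le_iff (hτ : IsArrivalSeq τ) {t : ℝ≥0} {k : ℕ} (h1 : τ k ≤ t)
    (h2 : t < τ (k + 1)) (j : ℕ) : τ j ≤ t ↔ j ≤ k := by
  constructor
  · intro h
    have := hτ.strictMono.lt_iff_lt.1 (h.trans_lt h2)
    omega
  · intro h
    exact (hτ.strictMono.monotone h).trans h1

lemma pushed_eq (hτ : IsArrivalSeq τ) (b y : ℝ) (p : ℝ≥0 → ℝ) {t : ℝ≥0} {k : ℕ} (h1 : τ k ≤ t)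
    (h2 : t < τ (k + 1)) : pushed b y p τ t = level b y (fun j => p (τ j)) k := by
  refine IsGreatest.csSup_eq ⟨⟨k, ?_⟩, ?_⟩
  · simp [h1]
  · rintro _ ⟨j, rfl⟩
    dsimp only
    split_ifs with h
    · exact level_mono _ _ _ ((hτ.le_iff h1 h2 j).1 h)
    · exact le_level _ _ _ _

lemma pushed_arrival (hτ : IsArrivalSeq τ) (b y : ℝ) (p : ℝ≥0 → ℝ) (k : ℕ) :
    pushed b y p τ (τ k) = level b y (fun j => p (τ j)) k :=
  pushed_eq hτ b y p le_rfl (hτ.strictMono (Nat.lt_succ_self k))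

lemma pushed_min_succ_sub (hτ : IsArrivalSeq τ) (b y : ℝ) (p : ℝ≥0 → ℝ) (t : ℝ≥0) (k : ℕ) :
    pushed b y p τ (min t (τ (k + 1))) - pushed b y p τ (min t (τ k)) =
      if τ (k + 1) ≤ t then
        level b y (fun j => p (τ j)) (k + 1) - level b y (fun j => p (τ j)) k else 0 := by
  split_ifs with h
  · have h' : τ k ≤ t := (hτ.strictMono.monotone (Nat.le_succ k)).trans h
    rw [min_eq_right h, min_eq_right h', pushed_arrival hτ, pushed_arrival hτ]
  · rw [min_eq_left (not_le.1 h).le, sub_eq_zero]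
    rcases le_total t (τ k) with h1 | h1
    · rw [min_eq_left h1]
    · rw [min_eq_right h1, pushed_arrival hτ, pushed_eq hτ b y p h1 (not_le.1 h)]

lemma tendsto_pushed_min (hτ : IsArrivalSeq τ) (b y : ℝ) (p : ℝ≥0 → ℝ) (t : ℝ≥0) :
    Tendsto (fun k => pushed b y p τ (min t (τ k))) atTop (𝓝 (pushed b y p τ t)) := by
  refine tendsto_const_nhds.congr' ?_
  filter_upwards [hτ.tendsto.eventually_ge_atTop t] with k hk
  rw [min_eq_left hk]

lemma pushed_mono (hτ : IsArrivalSeq τ) (b : ℝ) {y z : ℝ} (h : y ≤ z) (p : ℝ≥0 → ℝ) (t : ℝ≥0) :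
    pushed b y p τ t ≤ pushed b z p τ t := by
  obtain ⟨k, h1, h2⟩ := hτ.exists_index t
  rw [pushed_eq hτ b y p h1 h2, pushed_eq hτ b z p h1 h2]
  exact level_mono_left b h _ k

lemma abs_pushed_sub_pushed_le (hτ : IsArrivalSeq τ) (b y z : ℝ) (p : ℝ≥0 → ℝ) (t : ℝ≥0) :
    |pushed b z p τ t - pushed b y p τ t| ≤ |z - y| := by
  obtain ⟨k, h1, h2⟩ := hτ.exists_index t
  rw [pushed_eq hτ b y p h1 h2, pushed_eq hτ b z p h1 h2]
  exact abs_level_sub_level_le b y z _ k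

lemma pushed_add_const (hτ : IsArrivalSeq τ) (b c : ℝ) (p : ℝ≥0 → ℝ) (t : ℝ≥0) :
    pushed (b + c) (b + c) p τ t = pushed b b p τ t + c := by
  obtain ⟨k, h1, h2⟩ := hτ.exists_index t
  rw [pushed_eq hτ _ _ p h1 h2, pushed_eq hτ b b p h1 h2]
  clear h1 h2
  induction k with
  | zero => rfl
  | succ k ih =>
    simp only [level]
    rw [ih, ← max_add_add_right]
    ring_nf

/-- The controlled path takes the value of the uncontrolled one, or the value of a path
restarted from `b` at an earlier observation time. -/
lemma ctrl_eq (hτ : IsArrivalSeq τ) (b y : ℝ) (p : ℝ≥0 → ℝ) (t : ℝ≥0) :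
    ctrl b y p τ t = y + p t ∨ ∃ k, 1 ≤ k ∧ τ k ≤ t ∧ ctrl b y p τ t = b + (p t - p (τ k)) := by
  obtain ⟨k, h1, h2⟩ := hτ.exists_index t
  rw [ctrl, pushed_eq hτ b y p h1 h2]
  rcases level_eq b y (fun j => p (τ j)) k with h | ⟨j, hj1, hj2, h⟩
  · exact Or.inl (by rw [h]; ring)
  · exact Or.inr ⟨j, hj1, (hτ.le_iff h1 h2 j).2 hj2, by rw [h]; ring⟩

/-- Flow property: at an arrival time the controlled path starts afresh from its position. -/
lemma ctrl_add (hτ : IsArrivalSeq τ) (b y : ℝ) (p : ℝ≥0 → ℝ) (k : ℕ) (s : ℝ≥0) :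
    ctrl b y p τ (τ k + s) = ctrl b (p (τ k) + level b y (fun j => p (τ j)) k)
      (fun u => p (τ k + u) - p (τ k)) (shiftSeq τ k) s := by
  obtain ⟨j, h1, h2⟩ := (hτ.shift k).exists_index s
  have hsh : ∀ i, τ k + shiftSeq τ k i = τ (k + i) := fun i =>
    add_tsub_cancel_of_le (hτ.strictMono.monotone (Nat.le_add_right k i))
  have h1' : τ (k + j) ≤ τ k + s := by rw [← hsh]; gcongr
  have h2' : τ k + s < τ (k + j + 1) := by rw [add_assoc, ← hsh]; gcongr
  rw [ctrl, ctrl, pushed_eq hτ b y p h1' h2', pushed_eq (hτ.shift k) b _ _ h1 h2]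
  have key : ∀ i, level b (p (τ k) + level b y (fun j => p (τ j)) k)
      (fun i => p (τ k + shiftSeq τ k i) - p (τ k)) i =
      p (τ k) + level b y (fun j => p (τ j)) (k + i) := by
    intro i
    induction i with
    | zero => rfl
    | succ i ih =>
      change max _ _ = _ + max (level b y (fun j => p (τ j)) (k + i)) (b - p (τ (k + i + 1)))
      rw [ih, ← max_add_add_left]
      dsimp only
      rw [hsh, ← add_assoc]
      congr 1
      ring
  rw [key]
  ring

lemma measurable_level {α : Type*} [MeasurableSpace α] {b : ℝ} {y : α → ℝ} {a : α → ℕ → ℝ}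
    (hy : Measurable y) (ha : Measurable a) (k : ℕ) : Measurable fun x => level b (y x) (a x) k := by
  induction k with
  | zero => exact hy
  | succ k ih => exact ih.max (by fun_prop)

lemma measurable_pushed {α : Type*} [MeasurableSpace α] {b : ℝ} {y : α → ℝ} {p : α → ℝ≥0 → ℝ}
    {τ : α → ℕ → ℝ≥0} {t : α → ℝ≥0} (hy : Measurable y) (hp : Measurable p) (hτ : Measurable τ)
    (ht : Measurable t) :
    Measurable fun x => pushed b (y x) (evalRight (p x)) (τ x) (t x) := by
  refine Measurable.iSup fun k => Measurable.ite (measurableSet_le (by fun_prop) ht)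
    (measurable_level hy ?_ k) hy
  exact measurable_pi_lambda _ fun j => measurable_evalRight_comp hp (by fun_prop)

lemma measurable_ctrl {α : Type*} [MeasurableSpace α] {b : ℝ} {y : α → ℝ} {p : α → ℝ≥0 → ℝ}
    {τ : α → ℕ → ℝ≥0} {t : α → ℝ≥0} (hy : Measurable y) (hp : Measurable p) (hτ : Measurable τ)
    (ht : Measurable t) :
    Measurable fun x => ctrl b (y x) (evalRight (p x)) (τ x) (t x) :=
  (measurable_evalRight_comp hp ht).add (measurable_pushed hy hp hτ ht)

/-! ### The control times -/

/-- The value below which the path has to be observed for the `(n+1)`-st control. -/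
noncomputable def controlHeight (p : ℝ≥0 → ℝ) (τ : ℕ → ℝ≥0) (b : ℝ) (n : ℕ) : ℝ :=
  if n = 0 then b else p (controlTime p τ b n).toNNReal

lemma shiftedPath_lt_iff (p : ℝ≥0 → ℝ) (τ : ℕ → ℝ≥0) (b : ℝ) (n : ℕ) (t : ℝ≥0) :
    shiftedPath p b n (controlTime p τ b n) t < b ↔ p t < controlHeight p τ b n := by
  unfold shiftedPath controlHeight
  split_ifs
  · rfl
  · constructor <;> intro h <;> linarith

lemma controlSize_eq (p : ℝ≥0 → ℝ) (τ : ℕ → ℝ≥0) (b : ℝ) (n : ℕ) :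
    controlSize p τ b n = controlHeight p τ b n - controlHeight p τ b (n + 1) := by
  have h : controlHeight p τ b (n + 1) = p (controlTime p τ b (n + 1)).toNNReal :=
    if_neg (Nat.succ_ne_zero n)
  rw [h]
  unfold controlSize shiftedPath controlHeight
  split_ifs
  · rfl
  · ring

variable (x b : ℝ) (p : ℝ≥0 → ℝ)

lemma controlTime_succ (p : ℝ≥0 → ℝ) (n : ℕ) :
    controlTime p τ b (n + 1) = sInf {t : ℝ≥0∞ | ∃ k : ℕ, 1 ≤ k ∧ t = τ k ∧
      controlTime p τ b n < t ∧ p (τ k) < controlHeight p τ b n} := by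
  rw [controlTime]
  simp only [shiftedPath_lt_iff]

lemma controlTime_le_succ (p : ℝ≥0 → ℝ) (n : ℕ) :
    controlTime p τ b n ≤ controlTime p τ b (n + 1) := by
  rw [controlTime_succ]
  refine le_sInf ?_
  rintro t ⟨k, -, -, h, -⟩
  exact h.le

/-- One step of the control scheme: there is no further observation below the current height, or
the first one is the next control time. -/
lemma controlTime_step (hτ : IsArrivalSeq τ) (p : ℝ≥0 → ℝ) {n k : ℕ}
    (hk : controlTime p τ b n = τ k) :
    (controlTime p τ b (n + 1) = ⊤ ∧ ∀ j, k < j → controlHeight p τ b n ≤ p (τ j)) ∨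
    ∃ j, k < j ∧ controlTime p τ b (n + 1) = τ j ∧ p (τ j) < controlHeight p τ b n ∧
      ∀ i, k < i → i < j → controlHeight p τ b n ≤ p (τ i) := by
  have hlt : ∀ j, controlTime p τ b n < τ j ↔ k < j := fun j => by
    rw [hk, ENNReal.coe_lt_coe, hτ.strictMono.lt_iff_lt]
  by_cases h : ∃ j, k < j ∧ p (τ j) < controlHeight p τ b n
  · classical
    obtain ⟨h1, h2⟩ := Nat.find_spec h
    refine Or.inr ⟨Nat.find h, h1, ?_, h2, fun i hi hij => ?_⟩
    · rw [controlTime_succ]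
      refine le_antisymm (sInf_le ⟨Nat.find h, by omega, rfl, (hlt _).2 h1, h2⟩) (le_sInf ?_)
      rintro t ⟨j, -, rfl, h3, h4⟩
      rw [ENNReal.coe_le_coe]
      exact hτ.strictMono.monotone (Nat.find_min' h ⟨(hlt j).1 h3, h4⟩)
    · by_contra! h3
      exact Nat.find_min h hij ⟨hi, h3⟩
  · push Not at h
    refine Or.inl ⟨?_, h⟩
    rw [controlTime_succ]
    refine sInf_eq_top.2 ?_
    rintro t ⟨j, -, rfl, h3, h4⟩
    exact absurd h4 (not_lt.2 (h j ((hlt j).1 h3)))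

lemma level_eq_of_le {a : ℕ → ℝ} {y : ℝ} {k m : ℕ} (hkm : k ≤ m)
    (h : ∀ j, k < j → j ≤ m → b - a j ≤ level b y a k) : level b y a m = level b y a k := by
  induction m, hkm using Nat.le_induction with
  | base => rfl
  | succ m hkm ih =>
    simp only [level]
    rw [ih fun j h1 h2 => h j h1 (by omega), max_eq_left (h (m + 1) (by omega) le_rfl)]

/-- A finite `n`-th control time is an arrival time, at which the height is the running minimum of
the observations. -/
lemma controlTime_eq (hτ : IsArrivalSeq τ) (n : ℕ) :
    controlTime (fun s => x + p s) τ b n = ⊤ ∨ ∃ k, n ≤ k ∧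
      controlTime (fun s => x + p s) τ b n = τ k ∧
      controlHeight (fun s => x + p s) τ b n = x + b - level b x (fun j => p (τ j)) k := by
  induction n with
  | zero => exact Or.inr ⟨0, le_rfl, by simp [controlTime, hτ.zero], by
      simp [controlHeight, level]⟩
  | succ n ih =>
    rcases ih with h | ⟨k, hnk, hk, hh⟩
    · exact Or.inl (top_le_iff.1 (h ▸ controlTime_le_succ b _ n))
    · rcases controlTime_step b hτ _ hk with ⟨h, -⟩ | ⟨j, hkj, hj, hlt, hmin⟩
      · exact Or.inl h
      · refine Or.inr ⟨j, by omega, hj, ?_⟩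
        have h1 : controlHeight (fun s => x + p s) τ b (n + 1) = x + p (τ j) := by
          rw [controlHeight, if_neg (Nat.succ_ne_zero n), hj, ENNReal.toNNReal_coe]
        obtain ⟨m, rfl⟩ : ∃ m, j = m + 1 := ⟨j - 1, by omega⟩
        have h2 : level b x (fun j => p (τ j)) m = level b x (fun j => p (τ j)) k := by
          refine level_eq_of_le b (by omega) fun i h3 h4 => ?_
          have := hmin i h3 (by omega)
          linarith
        rw [h1]
        simp only [level]
        rw [h2, max_eq_right (by linarith)]
        ring

lemma controlSize_nonneg (hτ : IsArrivalSeq τ) {n : ℕ}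
    (hn : controlTime (fun s => x + p s) τ b (n + 1) < ⊤) :
    0 ≤ controlSize (fun s => x + p s) τ b n := by
  rcases controlTime_eq x b p hτ n with h | ⟨k, -, hk, -⟩
  · exact absurd (top_le_iff.1 (h ▸ controlTime_le_succ b _ n)) hn.ne
  · rcases controlTime_step b hτ _ hk with ⟨h, -⟩ | ⟨j, -, hj, hlt, -⟩
    · exact absurd h hn.ne
    · have h1 : controlHeight (fun s => x + p s) τ b (n + 1) = x + p (τ j) := by
        rw [controlHeight, if_neg (Nat.succ_ne_zero n), hj, ENNReal.toNNReal_coe]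
      rw [controlSize_eq, h1]
      linarith

lemma lt_controlTime (hτ : IsArrivalSeq τ) {t : ℝ≥0} {k : ℕ} (h : t < τ (k + 1)) {n : ℕ}
    (hn : k ≤ n) : (t : ℝ≥0∞) < controlTime (fun s => x + p s) τ b (n + 1) := by
  rcases controlTime_eq x b p hτ (n + 1) with h1 | ⟨j, hj, h1, -⟩
  · rw [h1]; exact ENNReal.coe_lt_top
  · rw [h1, ENNReal.coe_lt_coe]
    exact h.trans_le (hτ.strictMono.monotone (by omega))

open Classical in
/-- The control process is the running maximum of `b - p` over the observations. -/
theorem control_eq (hτ : IsArrivalSeq τ) (t : ℝ≥0) :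
    control (fun s => x + p s) τ b t = pushed b x p τ t - x := by
  obtain ⟨K, hK1, hK2⟩ := hτ.exists_index t
  set S := controlTime (fun s => x + p s) τ b
  set H := controlHeight (fun s => x + p s) τ b
  have hmono : Monotone S := monotone_nat_of_le_succ (controlTime_le_succ b _)
  have hex : ∃ n, (t : ℝ≥0∞) < S (n + 1) := ⟨K, lt_controlTime x b p hτ hK2 le_rfl⟩
  set N := Nat.find hex
  have hN : (t : ℝ≥0∞) < S (N + 1) := Nat.find_spec hex
  have hlt : ∀ n, S (n + 1) ≤ t ↔ n < N := fun n => by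
    constructor
    · intro h
      by_contra! h2
      exact absurd (hN.trans_le (hmono (by omega : N + 1 ≤ n + 1))) (not_lt.2 h)
    · intro h
      exact not_lt.1 (Nat.find_min hex h)
  have hSN : S N ≤ t := by
    rcases Nat.eq_zero_or_pos N with h | h
    · rw [h]; simp [S, controlTime]
    · obtain ⟨m, hm⟩ : ∃ m, N = m + 1 := ⟨N - 1, by omega⟩
      rw [hm]
      exact (hlt m).2 (by omega)
  have hsum : control (fun s => x + p s) τ b t = b - H N := by
    unfold control
    rw [tsum_eq_sum (s := Finset.range N) fun n hn => by
      rw [if_neg]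
      rw [Finset.mem_range] at hn
      exact fun h => hn ((hlt n).1 h)]
    have h1 : ∀ n ∈ Finset.range N, (if S (n + 1) ≤ t then controlSize (fun s => x + p s) τ b n
        else 0) = H n - H (n + 1) := fun n hn => by
      rw [if_pos ((hlt n).2 (Finset.mem_range.1 hn)), controlSize_eq]
    rw [Finset.sum_congr rfl h1, Finset.sum_range_sub']
    simp [H, controlHeight]
  rcases controlTime_eq x b p hτ N with h | ⟨k, -, hk, hh⟩
  · exact absurd (h ▸ hSN : (⊤ : ℝ≥0∞) ≤ t) (by simp)
  · have hkK : k ≤ K := (hτ.le_iff hK1 hK2 k).1 (by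
      rw [show S N = τ k from hk] at hSN
      exact_mod_cast hSN)
    have hlev : level b x (fun j => p (τ j)) K = level b x (fun j => p (τ j)) k := by
      refine level_eq_of_le b hkK fun j h1 h2 => ?_
      have h3 : H N ≤ x + p (τ j) := by
        rcases controlTime_step b hτ _ hk with ⟨-, h⟩ | ⟨i, -, hi, -, hmin⟩
        · exact h j h1
        · refine hmin j h1 ?_
          have h4 : t < τ i := by
            rw [show S (N + 1) = τ i from hi] at hN
            exact_mod_cast hN
          have := (hτ.le_iff hK1 hK2 i).not.1 (not_le.2 h4)
          omega
      have h5 : H N = x + b - level b x (fun j => p (τ j)) k := hh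
      linarith
    have h5 : H N = x + b - level b x (fun j => p (τ j)) k := hh
    rw [hsum, pushed_eq hτ b x p hK1 hK2, hlev, h5]
    ring

lemma controlled_eq (hτ : IsArrivalSeq τ) (t : ℝ≥0) :
    controlled (fun s => x + p s) τ b t = ctrl b x p τ t := by
  rw [controlled, control_eq x b p hτ, ctrl]
  ring

lemma expTime_Ici {q : ℝ} (hq : 0 < q) {s : ℝ} (hs : 0 ≤ s) :
    ENNReal.ofReal q * expTime q (Ici s) = ENNReal.ofReal (Real.exp (-(q * s))) := by
  have := isFiniteMeasure_expTime hq
  have h1 : expTime q univ = ENNReal.ofReal (1 / q) := by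
    rw [expTime, withDensity_apply _ MeasurableSet.univ, Measure.restrict_univ,
      ← ofReal_integral_eq_lintegral_ofReal (integrableOn_exp_neg_mul hq)
      (Eventually.of_forall fun _ => Real.exp_nonneg _), integral_exp_neg_mul_Ioi hq]
    simp
  rw [← Measure.restrict_apply_univ, expTime_restrict_Ici q hs, Measure.smul_apply,
    Measure.map_apply (by fun_prop) MeasurableSet.univ, preimage_univ, h1, smul_eq_mul,
    ← ENNReal.ofReal_mul (Real.exp_nonneg _), ← ENNReal.ofReal_mul hq.le]
  congr 1
  field_simp

open Classical in
/-- Integration by parts: `∫ e^{-qt} dR_t = q ∫ e^{-qt} R_t dt`. -/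
theorem lintegral_controlMeasure (hτ : IsArrivalSeq τ) {q : ℝ} (hq : 0 < q) :
    ∫⁻ t : ℝ≥0, ENNReal.ofReal (Real.exp (-(q * t))) ∂(controlMeasure (fun s => x + p s) τ b) =
      ENNReal.ofReal q * ∫⁻ t, ENNReal.ofReal (pushed b x p τ t.toNNReal - x) ∂(expTime q) := by
  set S := controlTime (fun s => x + p s) τ b
  set Z := controlSize (fun s => x + p s) τ b
  have hR : ∀ t : ℝ≥0, ENNReal.ofReal (pushed b x p τ t - x) =
      ∑' n, if S (n + 1) ≤ t then ENNReal.ofReal (Z n) else 0 := by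
    intro t
    obtain ⟨K, hK1, hK2⟩ := hτ.exists_index t
    rw [← control_eq x b p hτ, control, ENNReal.ofReal_tsum_of_nonneg]
    · refine tsum_congr fun n => ?_
      split_ifs <;> simp [Z]
    · intro n
      split_ifs with h
      · exact controlSize_nonneg x b p hτ (h.trans_lt ENNReal.coe_lt_top)
      · exact le_rfl
    · refine summable_of_ne_finset_zero (s := Finset.range K) fun n hn => ?_
      rw [if_neg]
      rw [Finset.mem_range, not_lt] at hn
      exact not_le.2 (lt_controlTime x b p hτ hK2 hn)
  simp_rw [hR]
  rw [lintegral_tsum, ← ENNReal.tsum_mul_left, controlMeasure, lintegral_sum_measure]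
  · refine tsum_congr fun n => ?_
    change ∫⁻ t : ℝ≥0, _ ∂(if S (n + 1) < ⊤ then _ else 0) = _
    by_cases h : S (n + 1) < ⊤
    · obtain ⟨s, hs⟩ : ∃ s : ℝ≥0, S (n + 1) = s := ⟨_, (ENNReal.coe_toNNReal h.ne).symm⟩
      have hs' : controlTime (fun s => x + p s) τ b (n + 1) = s := hs
      rw [if_pos h, hs, hs', lintegral_smul_measure, lintegral_dirac, ENNReal.toNNReal_coe,
        ← expTime_Ici hq s.coe_nonneg]
      have h2 : ∀ t : ℝ, 0 < t → (if (s : ℝ≥0∞) ≤ (t.toNNReal : ℝ≥0∞) then ENNReal.ofReal (Z n)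
          else 0) = (Ici (s : ℝ)).indicator (fun _ => ENNReal.ofReal (Z n)) t := fun t ht => by
        simp only [indicator, mem_Ici, ENNReal.coe_le_coe, Real.le_toNNReal_iff_coe_le ht.le]
      rw [lintegral_congr_ae ((ae_expTime_pos q).mono fun t ht => h2 t ht),
        lintegral_indicator_const measurableSet_Ici, smul_eq_mul]
      ring
    · have h2 : S (n + 1) = ⊤ := not_lt_top_iff.1 h
      simp [h2]
  · intro n
    exact (Measurable.ite (measurableSet_le measurable_const (by fun_prop)) measurable_const
      measurable_const).aemeasurable

end

end PeriodicBarrier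

namespace PeriodicBarrier

/-! ### Occupation of the controlled process -/

section

lemma continuousWithinAt_shift {p : ℝ≥0 → ℝ} (hp : IsCadlag p) (s u : ℝ≥0) :
    ContinuousWithinAt (fun u => p (s + u) - p s) (Ici u) u := by
  have h1 : ContinuousWithinAt (fun u => p (s + u)) (Ici u) u :=
    (hp (s + u)).1.comp (f := fun u => s + u) (by fun_prop) fun v hv => by
      simpa using (hv : u ≤ v)
  exact h1.sub continuousWithinAt_const

lemma IsCadlag.shiftPath_eq {p : ℝ≥0 → ℝ} (hp : IsCadlag p) (s : ℝ≥0) :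
    shiftPath p s = fun u => p (s + u) - p s := by
  ext u
  rw [shiftPath, hp.evalRight_eq]

lemma IsCadlag.evalRight_shiftPath {p : ℝ≥0 → ℝ} (hp : IsCadlag p) (s : ℝ≥0) :
    evalRight (shiftPath p s) = fun u => p (s + u) - p s := by
  rw [hp.shiftPath_eq]
  ext u
  exact PeriodicBarrier.evalRight_eq (continuousWithinAt_shift hp s u)

variable {Ω : Type*} [MeasurableSpace Ω] {P : Measure Ω} {X : ℝ≥0 → Ω → ℝ} {γ σ : ℝ}
  {Λ : Measure ℝ} {T : ℕ → Ω → ℝ≥0} {η q : ℝ}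

/-- A jointly measurable version of the controlled process. -/
noncomputable def ctrlProc (X : ℝ≥0 → Ω → ℝ) (T : ℕ → Ω → ℝ≥0) (b x : ℝ) (y : Ω × ℝ) : ℝ :=
  ctrl b x (evalRight fun t => X t y.1) (fun k => T k y.1) y.2.toNNReal

lemma IsPoissonArrivals.measurable_seq (hT : IsPoissonArrivals P T η) :
    Measurable fun ω j => T j ω :=
  measurable_pi_lambda _ hT.measurable

lemma measurable_ctrlProc (hX : IsLevyProcess P X γ σ Λ) (hT : IsPoissonArrivals P T η)
    (b x : ℝ) : Measurable (ctrlProc X T b x) :=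
  measurable_ctrl measurable_const (hX.measurable_path.comp measurable_fst)
    (hT.measurable_seq.comp measurable_fst) (by fun_prop)

/-- The observations up to the `k`-th arrival time. -/
noncomputable def pastObs (X : ℝ≥0 → Ω → ℝ) (T : ℕ → Ω → ℝ≥0) (k : ℕ) (ω : Ω) : ℕ → ℝ≥0 × ℝ :=
  observations (fun t => X t ω) (fun j => T (min j k) ω)

lemma measurable_pastObs (hX : IsLevyProcess P X γ σ Λ) (hT : IsPoissonArrivals P T η) (k : ℕ) :
    Measurable (pastObs X T k) :=
  measurable_observations.comp (hX.measurable_path.prodMk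
    (measurable_pi_lambda _ fun _ => hT.measurable _))

/-- The path and the arrival times after the `k`-th arrival time, together with the time that has
passed since. -/
noncomputable def future (X : ℝ≥0 → Ω → ℝ) (T : ℕ → Ω → ℝ≥0) (k : ℕ) (y : Ω × ℝ) :
    ((ℝ≥0 → ℝ) × (ℕ → ℝ≥0)) × ℝ :=
  ((shiftPath (fun t => X t y.1) (T k y.1), shiftSeq (fun j => T j y.1) k), y.2 - T k y.1)

/-- Discounted regeneration at the `k`-th arrival time. -/
theorem lintegral_regeneration [IsProbabilityMeasure P] (hX : IsLevyProcess P X γ σ Λ)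
    (hT : IsPoissonArrivals P T η) (hη : 0 < η)
    (hXT : IndepFun (fun ω t => X t ω) (fun ω k => T k ω) P) (q : ℝ) (k : ℕ)
    {G : (ℕ → ℝ≥0 × ℝ) × ((ℝ≥0 → ℝ) × (ℕ → ℝ≥0)) × ℝ → ℝ≥0∞} (hG : Measurable G) :
    ∫⁻ y in {y | (T k y.1 : ℝ) ≤ y.2}, G (pastObs X T k y.1, future X T k y)
        ∂(P.prod (expTime q)) =
      ∫⁻ ω, ENNReal.ofReal (Real.exp (-(q * T k ω))) *
        ∫⁻ y, G (pastObs X T k ω, (((fun t => X t y.1), (fun j => T j y.1)), y.2))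
          ∂(P.prod (expTime q)) ∂P := by
  have hTk := hT.measurable k
  have hpast := measurable_pastObs hX hT k
  have hsh : Measurable fun ω => (shiftPath (fun t => X t ω) (T k ω),
      shiftSeq (fun j => T j ω) k) :=
    (measurable_shiftPath.comp (hX.measurable_path.prodMk hTk)).prodMk
      ((measurable_shiftSeq k).comp hT.measurable_seq)
  have hfut : Measurable (future X T k) :=
    (hsh.comp measurable_fst).prodMk (by fun_prop)
  have hset : MeasurableSet {y : Ω × ℝ | (T k y.1 : ℝ) ≤ y.2} :=
    measurableSet_le (by fun_prop) (by fun_prop)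
  have hpair : Measurable fun ω => ((fun t => X t ω), (fun j => T j ω)) :=
    hX.measurable_path.prodMk hT.measurable_seq
  set J : (ℕ → ℝ≥0 × ℝ) × ((ℝ≥0 → ℝ) × (ℕ → ℝ≥0)) → ℝ≥0∞ := fun z =>
    ∫⁻ u, G (z.1, (z.2, u)) ∂(expTime q)
  have hJ0 : Measurable fun z : ((ℕ → ℝ≥0 × ℝ) × ((ℝ≥0 → ℝ) × (ℕ → ℝ≥0))) × ℝ =>
      G (z.1.1, (z.1.2, z.2)) := hG.comp (by fun_prop)
  have hJ : Measurable J := hJ0.lintegral_prod_right'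
  have hw : Measurable fun o : ℕ → ℝ≥0 × ℝ => ENNReal.ofReal (Real.exp (-(q * (o k).1))) := by
    fun_prop
  have hGy : Measurable fun y : Ω × ℝ => G (pastObs X T k y.1, future X T k y) :=
    hG.comp ((hpast.comp measurable_fst).prodMk hfut)
  have hok : ∀ ω, ENNReal.ofReal (Real.exp (-(q * T k ω))) =
      ENNReal.ofReal (Real.exp (-(q * (pastObs X T k ω k).1))) := fun ω => by
    simp [pastObs, observations]
  have hwJ : Measurable fun z : (ℕ → ℝ≥0 × ℝ) × ((ℝ≥0 → ℝ) × (ℕ → ℝ≥0)) =>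
      ENNReal.ofReal (Real.exp (-(q * (z.1 k).1))) * J z := (hw.comp measurable_fst).mul hJ
  calc ∫⁻ y in {y | (T k y.1 : ℝ) ≤ y.2}, G (pastObs X T k y.1, future X T k y)
        ∂(P.prod (expTime q))
      = ∫⁻ ω, ∫⁻ t in Ici (T k ω : ℝ), G (pastObs X T k ω, future X T k (ω, t))
          ∂(expTime q) ∂P := by
        rw [← lintegral_indicator hset, lintegral_prod _ (hGy.indicator hset).aemeasurable]
        refine lintegral_congr fun ω => ?_
        rw [← lintegral_indicator measurableSet_Ici]
        rfl
    _ = ∫⁻ ω, ENNReal.ofReal (Real.exp (-(q * T k ω))) * J (pastObs X T k ω,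
          (shiftPath (fun t => X t ω) (T k ω), shiftSeq (fun j => T j ω) k)) ∂P := by
        refine lintegral_congr fun ω => ?_
        have h1 : Measurable fun t : ℝ => G (pastObs X T k ω, future X T k (ω, t)) :=
          hGy.comp measurable_prodMk_left
        rw [expTime_restrict_Ici q (T k ω).coe_nonneg, lintegral_smul_measure,
          lintegral_map h1 (by fun_prop), smul_eq_mul]
        simp [future, J]
    _ = ∫⁻ z, ENNReal.ofReal (Real.exp (-(q * (z.1 k).1))) * J z
          ∂(P.map fun ω => (pastObs X T k ω,
            (shiftPath (fun t => X t ω) (T k ω), shiftSeq (fun j => T j ω) k))) := by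
        rw [lintegral_map hwJ (hpast.prodMk hsh)]
        simp_rw [hok]
    _ = ∫⁻ ω, ENNReal.ofReal (Real.exp (-(q * T k ω))) *
          ∫⁻ ω', J (pastObs X T k ω, ((fun t => X t ω'), (fun j => T j ω'))) ∂P ∂P := by
        have : IsProbabilityMeasure (P.map fun ω => ((fun t => X t ω), (fun j => T j ω))) :=
          Measure.isProbabilityMeasure_map hpair.aemeasurable
        rw [show (P.map fun ω => (pastObs X T k ω, (shiftPath (fun t => X t ω) (T k ω),
            shiftSeq (fun j => T j ω) k))) = (P.map (pastObs X T k)).prod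
            (P.map fun ω => ((fun t => X t ω), (fun j => T j ω))) from
            map_observations_shift hX hT hη hXT k,
          lintegral_prod _ hwJ.aemeasurable, lintegral_map hwJ.lintegral_prod_right' hpast]
        refine lintegral_congr fun ω => ?_
        have h1 : Measurable fun z => J (pastObs X T k ω, z) := hJ.comp measurable_prodMk_left
        rw [← lintegral_map (f := fun z => J (pastObs X T k ω, z)) h1 hpair, hok,
          ← lintegral_const_mul _ h1]
    _ = _ := by
        refine lintegral_congr fun ω => ?_
        congr 1
        have h1 : Measurable fun y : Ω × ℝ =>
            G (pastObs X T k ω, (((fun t => X t y.1), (fun j => T j y.1)), y.2)) :=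
          hG.comp (measurable_const.prodMk ((hpair.comp measurable_fst).prodMk measurable_snd))
        rw [lintegral_prod _ h1.aemeasurable]

lemma toNNReal_sub_coe (t : ℝ) (s : ℝ≥0) : (t - s).toNNReal = t.toNNReal - s := by
  rcases le_total 0 t with h | h
  · rw [NNReal.sub_def, Real.coe_toNNReal t h]
  · rw [Real.toNNReal_of_nonpos h, Real.toNNReal_of_nonpos (by linarith [s.coe_nonneg]), zero_tsub]

/-- The expected discounted time spent in a set after restarting from `b` at the `k`-th arrival
time. -/
lemma lintegral_restart [IsProbabilityMeasure P] (hX : IsLevyProcess P X γ σ Λ)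
    (hT : IsPoissonArrivals P T η) (hη : 0 < η)
    (hXT : IndepFun (fun ω t => X t ω) (fun ω k => T k ω) P) (b : ℝ) (k : ℕ)
    {F : ℝ → ℝ≥0∞} (hF : Measurable F) :
    ∫⁻ y in {y | (T k y.1 : ℝ) ≤ y.2}, F (b + (X y.2.toNNReal y.1 - X (T k y.1) y.1))
        ∂(P.prod (expTime q)) =
      (∫⁻ ω, ENNReal.ofReal (Real.exp (-(q * T k ω))) ∂P) *
        ∫⁻ z, F (b + z) ∂(potential P X q) := by
  have hFb : Measurable fun z => F (b + z) := by fun_prop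
  set G : (ℕ → ℝ≥0 × ℝ) × ((ℝ≥0 → ℝ) × (ℕ → ℝ≥0)) × ℝ → ℝ≥0∞ := fun z =>
    F (b + evalRight z.2.1.1 z.2.2.toNNReal)
  have hG : Measurable G := hFb.comp (measurable_evalRight_comp (by fun_prop) (by fun_prop))
  have h := lintegral_regeneration hX hT hη hXT q k hG
  have hTk := hT.measurable k
  have hset : MeasurableSet {y : Ω × ℝ | (T k y.1 : ℝ) ≤ y.2} :=
    measurableSet_le (by fun_prop) (by fun_prop)
  have hL : ∫⁻ y in {y | (T k y.1 : ℝ) ≤ y.2}, F (b + (X y.2.toNNReal y.1 - X (T k y.1) y.1))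
        ∂(P.prod (expTime q)) =
      ∫⁻ y in {y | (T k y.1 : ℝ) ≤ y.2}, G (pastObs X T k y.1, future X T k y)
        ∂(P.prod (expTime q)) := by
    refine setLIntegral_congr_fun_ae hset ?_
    filter_upwards [ae_prod_of_ae_fst (ν := expTime q) hX.cadlag] with y hy hy2
    have hle : T k y.1 ≤ y.2.toNNReal := by
      rw [← Real.toNNReal_coe (r := T k y.1)]
      exact Real.toNNReal_le_toNNReal hy2
    simp only [G, future]
    rw [hy.evalRight_shiftPath, toNNReal_sub_coe]
    dsimp only
    rw [add_tsub_cancel_of_le hle]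
  rw [hL, h]
  have hR : ∫⁻ y, F (b + evalRight (fun t => X t y.1) y.2.toNNReal) ∂(P.prod (expTime q)) =
      ∫⁻ z, F (b + z) ∂(potential P X q) := by
    rw [potential, lintegral_map' hFb.aemeasurable (hX.aemeasurable_uncurry _)]
    refine lintegral_congr_ae ?_
    filter_upwards [ae_prod_of_ae_fst (ν := expTime q) hX.ae_evalRight] with y hy
    rw [hy]
  simp only [G]
  rw [lintegral_mul_const _ (by fun_prop), hR]

/-- The controlled process spends at most as much discounted time in a set as the processes
restarted from `b` at all arrival times together. -/
theorem lintegral_ctrlProc_le [IsProbabilityMeasure P] (hX : IsLevyProcess P X γ σ Λ)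
    (hT : IsPoissonArrivals P T η) (hη : 0 < η)
    (hXT : IndepFun (fun ω t => X t ω) (fun ω k => T k ω) P) (b x : ℝ)
    {F : ℝ → ℝ≥0∞} (hF : Measurable F) :
    ∫⁻ y, F (ctrlProc X T b x y) ∂(P.prod (expTime q)) ≤
      ∫⁻ z, F (x + z) ∂(potential P X q) +
        (∑' k, ∫⁻ ω, ENNReal.ofReal (Real.exp (-(q * T k ω))) ∂P) *
          ∫⁻ z, F (b + z) ∂(potential P X q) := by
  have hTk := hT.measurable
  have hset : ∀ k, MeasurableSet {y : Ω × ℝ | (T k y.1 : ℝ) ≤ y.2} := fun k =>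
    measurableSet_le (by fun_prop) (by fun_prop)
  have hFx : AEMeasurable (fun y : Ω × ℝ => F (x + X y.2.toNNReal y.1)) (P.prod (expTime q)) :=
    (by fun_prop : Measurable fun z => F (x + z)).comp_aemeasurable (hX.aemeasurable_uncurry _)
  have hFk : ∀ k, AEMeasurable ({y : Ω × ℝ | (T k y.1 : ℝ) ≤ y.2}.indicator
      fun y => F (b + (X y.2.toNNReal y.1 - X (T k y.1) y.1))) (P.prod (expTime q)) := by
    intro k
    refine AEMeasurable.indicator ?_ (hset k)
    have h1 : Measurable fun y : Ω × ℝ => evalRight (fun t => X t y.1) (T k y.1) :=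
      measurable_evalRight_comp (hX.measurable_path.comp measurable_fst) (by fun_prop)
    refine ⟨fun y => F (b + (evalRight (fun t => X t y.1) y.2.toNNReal -
      evalRight (fun t => X t y.1) (T k y.1))), hF.comp
        (measurable_const.add (hX.measurable_evalRight.sub h1)), ?_⟩
    filter_upwards [ae_prod_of_ae_fst (ν := expTime q) hX.ae_evalRight] with y hy
    rw [hy]
  calc ∫⁻ y, F (ctrlProc X T b x y) ∂(P.prod (expTime q))
      ≤ ∫⁻ y, (F (x + X y.2.toNNReal y.1) + ∑' k, {y : Ω × ℝ | (T k y.1 : ℝ) ≤ y.2}.indicator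
          (fun y => F (b + (X y.2.toNNReal y.1 - X (T k y.1) y.1))) y) ∂(P.prod (expTime q)) := by
        refine lintegral_mono_ae ?_
        filter_upwards [ae_prod_of_ae_fst (ν := expTime q) hX.ae_evalRight,
          ae_prod_of_ae_fst (ν := expTime q) (hT.ae_isArrivalSeq hη),
          ae_prod_of_ae_snd (μ := P) (ae_expTime_pos q)] with y h1 h2 h3
        rw [ctrlProc, h1]
        rcases ctrl_eq h2 b x (fun t => X t y.1) y.2.toNNReal with h | ⟨k, -, hk, h⟩
        · rw [h]
          exact le_self_add
        · rw [h]
          refine le_trans ?_ le_add_self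
          refine le_trans ?_ (ENNReal.le_tsum k)
          rw [indicator_of_mem]
          exact (Real.le_toNNReal_iff_coe_le h3.le).1 hk
    _ = _ := by
        rw [lintegral_add_left' hFx, lintegral_tsum hFk, ← ENNReal.tsum_mul_right]
        congr 1
        · rw [potential, lintegral_map' (by fun_prop) (hX.aemeasurable_uncurry _)]
        · refine tsum_congr fun k => ?_
          rw [lintegral_indicator (hset k), lintegral_restart hX hT hη hXT b k hF]

lemma abs_add_pow_le (x z : ℝ) (N : ℕ) :
    |x + z| ^ N ≤ 1 + 2 ^ (2 * N - 1) * (x ^ (2 * N) + z ^ (2 * N)) := by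
  have h1 : |x + z| ^ N ≤ 1 + (x + z) ^ (2 * N) := by
    rw [pow_mul, ← sq_abs, ← pow_mul, mul_comm, pow_mul]
    nlinarith [sq_nonneg (|x + z| ^ N - 1)]
  have h2 := (even_two_mul N).add_pow_le (a := x) (b := z)
  linarith

/-- The data of the problem other than the cost. -/
structure IsModel (P : Measure Ω) (X : ℝ≥0 → Ω → ℝ) (T : ℕ → Ω → ℝ≥0) (γ σ : ℝ) (Λ : Measure ℝ)
    (η q : ℝ) : Prop where
  levy : IsLevyProcess P X γ σ Λ
  arrivals : IsPoissonArrivals P T η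
  eta_pos : 0 < η
  q_pos : 0 < q
  indep : IndepFun (fun ω t => X t ω) (fun ω k => T k ω) P
  not_compoundPoisson : ¬ IsDriftlessCompoundPoisson γ σ Λ
  exp_moment : ∃ θ : ℝ, 0 < θ ∧
    IntegrableOn (fun z : ℝ => Real.exp (θ * |z|)) (Ioo (-1 : ℝ) 1)ᶜ Λ

variable [IsProbabilityMeasure P]

lemma IsModel.lintegral_potential_lt_top (h : IsModel P X T γ σ Λ η q) (x : ℝ) (N : ℕ)
    {k₁ k₂ : ℝ} : ∫⁻ z, ENNReal.ofReal (k₁ + k₂ * |x + z| ^ N) ∂(potential P X q) < ⊤ := by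
  obtain ⟨θ, hθ, hexp⟩ := h.exp_moment
  have := IsLevyProcess.isFiniteMeasure_potential (P := P) (X := X) h.q_pos
  have h1 := h.levy.lintegral_potential_pow_lt_top hθ hexp h.q_pos N
  have h2 : Integrable (fun z => z ^ (2 * N)) (potential P X q) := by
    refine ⟨by fun_prop, ?_⟩
    rw [hasFiniteIntegral_iff_ofReal (Eventually.of_forall fun z => (even_two_mul N).pow_nonneg z)]
    exact h1
  have h3 : Integrable (fun z => |k₁| + |k₂| * (1 + 2 ^ (2 * N - 1) * (x ^ (2 * N) + z ^ (2 * N))))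
      (potential P X q) :=
    (integrable_const _).add (((integrable_const _).add
      (((integrable_const _).add h2).const_mul _)).const_mul _)
  refine lt_of_le_of_lt (lintegral_mono fun z => ?_) h3.lintegral_lt_top
  refine ENNReal.ofReal_le_ofReal (add_le_add (le_abs_self _) ?_)
  exact (mul_le_mul_of_nonneg_right (le_abs_self k₂) (by positivity)).trans
    (mul_le_mul_of_nonneg_left (abs_add_pow_le x z N) (abs_nonneg _))

/-- Functions of polynomial growth of the controlled process are integrable. -/
theorem IsModel.integrable_ctrlProc (h : IsModel P X T γ σ Λ η q) (b x : ℝ) {g : ℝ → ℝ}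
    (hg : Measurable g) {k₁ k₂ : ℝ} {N : ℕ} (hgN : ∀ u, |g u| ≤ k₁ + k₂ * |u| ^ N) :
    Integrable (fun y => g (ctrlProc X T b x y)) (P.prod (expTime q)) := by
  refine ⟨(hg.comp (measurable_ctrlProc h.levy h.arrivals b x)).aestronglyMeasurable, ?_⟩
  rw [hasFiniteIntegral_iff_norm]
  refine lt_of_le_of_lt (lintegral_mono fun y => ENNReal.ofReal_le_ofReal (hgN _)) ?_
  refine lt_of_le_of_lt (lintegral_ctrlProc_le h.levy h.arrivals h.eta_pos h.indep b x
    (F := fun u => ENNReal.ofReal (k₁ + k₂ * |u| ^ N)) (by fun_prop)) ?_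
  exact ENNReal.add_lt_top.2 ⟨h.lintegral_potential_lt_top x N, ENNReal.mul_lt_top
    (h.arrivals.tsum_lintegral_exp_neg_lt_top h.eta_pos h.q_pos)
    (h.lintegral_potential_lt_top b N)⟩

/-- The controlled process spends no time in a countable set. -/
theorem IsModel.ae_ctrlProc_notMem (h : IsModel P X T γ σ Λ η q) (b x : ℝ) {S : Set ℝ}
    (hS : S.Countable) : ∀ᵐ y ∂(P.prod (expTime q)), ctrlProc X T b x y ∉ S := by
  have hV : ∀ c, ∫⁻ z, S.indicator 1 (c + z) ∂(potential P X q) = 0 := by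
    intro c
    have h1 : ∀ z, S.indicator (1 : ℝ → ℝ≥0∞) (c + z) = ((c + ·) ⁻¹' S).indicator 1 z :=
      fun z => rfl
    have hc : ((c + ·) ⁻¹' S).Countable := hS.preimage (add_right_injective c)
    simp_rw [h1]
    rw [lintegral_indicator_one hc.measurableSet, ← Set.biUnion_of_singleton ((c + ·) ⁻¹' S),
      measure_biUnion_null_iff hc]
    exact fun a _ => h.levy.potential_singleton h.not_compoundPoisson h.q_pos a
  have h1 := lintegral_ctrlProc_le (q := q) h.levy h.arrivals h.eta_pos h.indep b x
    (F := S.indicator 1) (measurable_one.indicator hS.measurableSet)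
  rw [hV, hV, mul_zero, add_zero, nonpos_iff_eq_zero] at h1
  have hm : Measurable fun y => S.indicator (1 : ℝ → ℝ≥0∞) (ctrlProc X T b x y) :=
    (measurable_one.indicator hS.measurableSet).comp (measurable_ctrlProc h.levy h.arrivals b x)
  rw [lintegral_eq_zero_iff hm] at h1
  filter_upwards [h1] with y hy hmem
  simp [hmem] at hy

/-! ### Regeneration of the controlled process -/

/-- The position of the controlled process at the `k`-th arrival time in terms of the
observations. -/
noncomputable def position (b x : ℝ) (k : ℕ) (o : ℕ → ℝ≥0 × ℝ) : ℝ :=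
  (o k).2 + level b x (fun j => (o j).2) k

lemma measurable_position (b x : ℝ) (k : ℕ) : Measurable (position b x k) :=
  (by fun_prop : Measurable fun o : ℕ → ℝ≥0 × ℝ => (o k).2).add
    (measurable_level measurable_const (by fun_prop) k)

lemma integrable_of_lintegral_eq {α β : Type*} [MeasurableSpace α] [MeasurableSpace β]
    {μ : Measure α} {ν : Measure β} {φ : α → β} (hφ : Measurable φ)
    (hm : μ.map φ = ν) {G : β → ℝ} (hG : Measurable G) (hi : Integrable (fun a => G (φ a)) μ) :
    Integrable G ν ∧ ∫ a, G (φ a) ∂μ = ∫ b, G b ∂ν := by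
  subst hm
  exact ⟨(integrable_map_measure hG.aestronglyMeasurable hφ.aemeasurable).2 hi,
    (integral_map hφ.aemeasurable hG.aestronglyMeasurable).symm⟩

/-- The expected discounted value of `g` along the controlled process started at `z`. -/
noncomputable def expValue (P : Measure Ω) (X : ℝ≥0 → Ω → ℝ) (T : ℕ → Ω → ℝ≥0) (q : ℝ)
    (g : ℝ → ℝ) (b z : ℝ) : ℝ :=
  ∫ y, g (ctrlProc X T b z y) ∂(P.prod (expTime q))

/-- Regeneration of the controlled process at the `k`-th arrival time. -/
theorem IsModel.setIntegral_regeneration (h : IsModel P X T γ σ Λ η q) (b x : ℝ) (k : ℕ)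
    {g : ℝ → ℝ} (hg : Measurable g) {w : (ℕ → ℝ≥0 × ℝ) → ℝ} (hw : Measurable w)
    (hi : Integrable (fun y => w (pastObs X T k y.1) * g (ctrlProc X T b x y))
      (P.prod (expTime q))) :
    ∫ y in {y | (T k y.1 : ℝ) ≤ y.2}, w (pastObs X T k y.1) * g (ctrlProc X T b x y)
        ∂(P.prod (expTime q)) =
      ∫ ω, Real.exp (-(q * T k ω)) * (w (pastObs X T k ω) *
        expValue P X T q g b (position b x k (pastObs X T k ω))) ∂P := by
  have hX := h.levy
  have hT := h.arrivals
  have hTk := hT.measurable k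
  have hpast := measurable_pastObs hX hT k
  have hsh : Measurable fun ω => (shiftPath (fun t => X t ω) (T k ω),
      shiftSeq (fun j => T j ω) k) :=
    (measurable_shiftPath.comp (hX.measurable_path.prodMk hTk)).prodMk
      ((measurable_shiftSeq k).comp hT.measurable_seq)
  have hfut : Measurable (future X T k) :=
    (hsh.comp measurable_fst).prodMk (by fun_prop)
  have hset : MeasurableSet {y : Ω × ℝ | (T k y.1 : ℝ) ≤ y.2} :=
    measurableSet_le (by fun_prop) (by fun_prop)
  have hpair : Measurable fun y : Ω × ℝ => (((fun t => X t y.1), (fun j => T j y.1)), y.2) :=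
    ((hX.measurable_path.prodMk hT.measurable_seq).comp measurable_fst).prodMk measurable_snd
  have hdens : Measurable fun ω => ENNReal.ofReal (Real.exp (-(q * T k ω))) := by fun_prop
  set G : (ℕ → ℝ≥0 × ℝ) × ((ℝ≥0 → ℝ) × (ℕ → ℝ≥0)) × ℝ → ℝ := fun z =>
    w z.1 * g (ctrl b (position b x k z.1) (evalRight z.2.1.1) z.2.1.2 z.2.2.toNNReal)
  have hG : Measurable G := (hw.comp measurable_fst).mul (hg.comp (measurable_ctrl
    ((measurable_position b x k).comp measurable_fst) (by fun_prop) (by fun_prop) (by fun_prop)))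
  set μ := (P.prod (expTime q)).restrict {y | (T k y.1 : ℝ) ≤ y.2}
  set Pk := P.withDensity fun ω => ENNReal.ofReal (Real.exp (-(q * T k ω)))
  set Φ : Ω × ℝ → (ℕ → ℝ≥0 × ℝ) × ((ℝ≥0 → ℝ) × (ℕ → ℝ≥0)) × ℝ := fun y =>
    (pastObs X T k y.1, future X T k y)
  set Φ' : Ω × (Ω × ℝ) → (ℕ → ℝ≥0 × ℝ) × ((ℝ≥0 → ℝ) × (ℕ → ℝ≥0)) × ℝ := fun y =>
    (pastObs X T k y.1, (((fun t => X t y.2.1), (fun j => T j y.2.1)), y.2.2))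
  have hΦ : Measurable Φ := (hpast.comp measurable_fst).prodMk hfut
  have hΦ' : Measurable Φ' := (hpast.comp measurable_fst).prodMk (hpair.comp measurable_snd)
  have hmap : μ.map Φ = (Pk.prod (P.prod (expTime q))).map Φ' := by
    refine Measure.ext_of_lintegral _ fun F hF => ?_
    have h1 : Measurable fun z => F (Φ' z) := hF.comp hΦ'
    rw [lintegral_map hF hΦ, lintegral_map hF hΦ', lintegral_prod _ h1.aemeasurable,
      lintegral_withDensity_eq_lintegral_mul _ hdens h1.lintegral_prod_right']
    exact lintegral_regeneration hX hT h.eta_pos h.indep q k hF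
  have hae : ∀ᵐ y ∂μ, w (pastObs X T k y.1) * g (ctrlProc X T b x y) = G (Φ y) := by
    refine (ae_restrict_iff' hset).2 ?_
    filter_upwards [ae_prod_of_ae_fst (ν := expTime q) hX.cadlag,
      ae_prod_of_ae_fst (ν := expTime q) (hT.ae_isArrivalSeq h.eta_pos)] with y h1 h2 h3
    have hle : T k y.1 ≤ y.2.toNNReal := by
      rw [← Real.toNNReal_coe (r := T k y.1)]
      exact Real.toNNReal_le_toNNReal h3
    have h4 := ctrl_add h2 b x (fun t => X t y.1) k (y.2.toNNReal - T k y.1)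
    rw [add_tsub_cancel_of_le hle] at h4
    simp only [G, Φ, future, ctrlProc]
    rw [h1.evalRight_shiftPath, toNNReal_sub_coe, h1.evalRight_eq, h4]
    have h5 : position b x k (pastObs X T k y.1) = X (T k y.1) y.1 +
        level b x (fun j => X (T j y.1) y.1) k := by
      simp only [position, pastObs, observations, h1.evalRight_eq, min_self]
      congr 1
      exact level_congr b x fun j hj => by rw [min_eq_left hj]
    rw [h5]
  have hGi : Integrable (fun y => G (Φ y)) μ := (hi.restrict (s := {y | (T k y.1 : ℝ) ≤ y.2})).congr hae
  obtain ⟨h1, h2⟩ := integrable_of_lintegral_eq hΦ hmap hG hGi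
  have h3 : Integrable (fun z => G (Φ' z)) (Pk.prod (P.prod (expTime q))) :=
    (integrable_map_measure hG.aestronglyMeasurable hΦ'.aemeasurable).1 h1
  rw [integral_congr_ae hae, h2, integral_map hΦ'.aemeasurable hG.aestronglyMeasurable,
    integral_prod _ h3, integral_withDensity_eq_integral_toReal_smul hdens
      (Eventually.of_forall fun _ => ENNReal.ofReal_lt_top)]
  refine integral_congr_ae (Eventually.of_forall fun ω => ?_)
  simp only [ENNReal.toReal_ofReal (Real.exp_nonneg _), smul_eq_mul]
  congr 1
  simp only [G, Φ']
  rw [integral_const_mul]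
  rfl

end

end PeriodicBarrier

namespace PeriodicBarrier

/-! ### Convex functions of polynomial growth -/

section

/-- At most polynomial growth. -/
def HasPolyGrowth (g : ℝ → ℝ) : Prop :=
  ∃ (k₁ k₂ : ℝ) (N : ℕ), ∀ x, |g x| ≤ k₁ + k₂ * |x| ^ N

lemma HasPolyGrowth.exists_even {g : ℝ → ℝ} (hg : HasPolyGrowth g) :
    ∃ (K : ℝ) (N : ℕ), 0 ≤ K ∧ ∀ x, |g x| ≤ K * (1 + x ^ (2 * N)) := by
  obtain ⟨k₁, k₂, N, h⟩ := hg
  refine ⟨|k₁| + |k₂| * (1 + 2 ^ (2 * N - 1)) , N, by positivity, fun x => (h x).trans ?_⟩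
  have h1 := abs_add_pow_le 0 x N
  rw [zero_add] at h1
  have h2 : (0 : ℝ) ^ (2 * N) ≤ 1 := by
    rcases Nat.eq_zero_or_pos N with h | h
    · simp [h]
    · rw [zero_pow (by omega)]; exact zero_le_one
  have h3 : 0 ≤ x ^ (2 * N) := (even_two_mul N).pow_nonneg x
  have h4 : (0 : ℝ) < 2 ^ (2 * N - 1) := by positivity
  have h5 : |x| ^ N ≤ (1 + 2 ^ (2 * N - 1)) * (1 + x ^ (2 * N)) := by nlinarith
  have h6 : k₂ * |x| ^ N ≤ |k₂| * ((1 + 2 ^ (2 * N - 1)) * (1 + x ^ (2 * N))) :=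
    (mul_le_mul_of_nonneg_right (le_abs_self _) (by positivity)).trans
      (mul_le_mul_of_nonneg_left h5 (abs_nonneg _))
  nlinarith [le_abs_self k₁, mul_nonneg (abs_nonneg k₁) h3]

lemma hasPolyGrowth_of_even {g : ℝ → ℝ} {K : ℝ} {N : ℕ} (h : ∀ x, |g x| ≤ K * (1 + x ^ (2 * N))) :
    HasPolyGrowth g :=
  ⟨K, K, 2 * N, fun x => by
    have := h x
    rw [(even_two_mul N).pow_abs]
    linarith⟩

lemma HasPolyGrowth.add {g h : ℝ → ℝ} (hg : HasPolyGrowth g) (hh : HasPolyGrowth h) :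
    HasPolyGrowth fun x => g x + h x := by
  obtain ⟨K, N, hK, hg⟩ := hg.exists_even
  obtain ⟨L, M, hL, hh⟩ := hh.exists_even
  refine hasPolyGrowth_of_even (K := 2 * (K + L)) (N := N + M) fun x => ?_
  have h1 : ∀ A B : ℕ, x ^ (2 * A) ≤ 1 + x ^ (2 * (A + B)) := fun A B => by
    rcases le_total 1 (x ^ 2) with h | h
    · have : (x ^ 2) ^ A ≤ (x ^ 2) ^ (A + B) := pow_le_pow_right₀ h (by omega)
      rw [pow_mul, pow_mul]
      linarith
    · have h2 : (x ^ 2) ^ A ≤ 1 := pow_le_one₀ (sq_nonneg x) h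
      have h3 : 0 ≤ (x ^ 2) ^ (A + B) := by positivity
      rw [pow_mul, pow_mul]
      linarith
  have h2 := h1 N M
  have h3 := h1 M N
  rw [add_comm M N] at h3
  have h4 := mul_le_mul_of_nonneg_left h2 hK
  have h5 := mul_le_mul_of_nonneg_left h3 hL
  have h6 : 0 ≤ x ^ (2 * (N + M)) := (even_two_mul _).pow_nonneg x
  nlinarith [abs_add_le (g x) (h x), hg x, hh x, mul_nonneg hK h6, mul_nonneg hL h6]

lemma hasPolyGrowth_const (c : ℝ) : HasPolyGrowth fun _ => c :=
  ⟨|c|, 0, 0, fun _ => by simp⟩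

lemma hasPolyGrowth_const_mul (c : ℝ) : HasPolyGrowth fun x => c * x :=
  ⟨0, |c|, 1, fun _ => by simp [abs_mul]⟩

lemma HasPolyGrowth.shift {g : ℝ → ℝ} (hg : HasPolyGrowth g) (c : ℝ) :
    HasPolyGrowth fun x => g (x + c) := by
  obtain ⟨K, N, hK, hg⟩ := hg.exists_even
  refine hasPolyGrowth_of_even (K := K * (1 + 2 ^ (2 * N - 1) * (1 + c ^ (2 * N)))) (N := N)
    fun x => (hg _).trans ?_
  rw [mul_assoc]
  refine mul_le_mul_of_nonneg_left ?_ hK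
  have h2 := (even_two_mul N).add_pow_le (a := x) (b := c)
  have h3 : 0 ≤ x ^ (2 * N) := (even_two_mul N).pow_nonneg x
  have h4 : 0 ≤ c ^ (2 * N) := (even_two_mul N).pow_nonneg c
  have h5 : (0 : ℝ) < 2 ^ (2 * N - 1) := by positivity
  nlinarith [mul_nonneg h5.le h3, mul_nonneg h5.le h4, mul_nonneg h5.le (mul_nonneg h3 h4)]

lemma HasPolyGrowth.of_abs_le {g h : ℝ → ℝ} (hh : HasPolyGrowth h) (hgh : ∀ x, |g x| ≤ |h x|) :
    HasPolyGrowth g := by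
  obtain ⟨k₁, k₂, N, h⟩ := hh
  exact ⟨k₁, k₂, N, fun x => (hgh x).trans (h x)⟩

lemma HasPolyGrowth.abs {g : ℝ → ℝ} (hg : HasPolyGrowth g) : HasPolyGrowth fun x => |g x| :=
  hg.of_abs_le fun x => by rw [abs_abs]

variable {f : ℝ → ℝ}

lemma rightDeriv_mul_le (hf : ConvexOn ℝ univ f) (x y : ℝ) :
    rightDeriv f x * (y - x) ≤ f y - f x := by
  have hint : x ∈ interior (univ : Set ℝ) := by simp
  rcases lt_trichotomy x y with h | rfl | h
  · have := hf.rightDeriv_le_slope_of_mem_interior hint (mem_univ y) h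
    rw [slope_def_field, le_div_iff₀ (sub_pos.2 h)] at this
    exact this
  · simp
  · have h1 := hf.slope_le_leftDeriv_of_mem_interior (mem_univ y) hint h
    have h2 := h1.trans (hf.leftDeriv_le_rightDeriv_of_mem_interior hint)
    rw [slope_def_field, div_le_iff₀ (sub_pos.2 h)] at h2
    unfold rightDeriv
    linarith

lemma monotone_rightDeriv (hf : ConvexOn ℝ univ f) : Monotone (rightDeriv f) := by
  have := hf.monotoneOn_rightDeriv
  rw [interior_univ] at this
  exact monotoneOn_univ.1 this

lemma hasPolyGrowth_rightDeriv (hf : ConvexOn ℝ univ f) (hg : HasPolyGrowth f) :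
    HasPolyGrowth (rightDeriv f) := by
  refine HasPolyGrowth.of_abs_le (((hg.shift 1).abs.add hg.abs).add (hg.shift (-1)).abs)
    fun x => ?_
  rw [abs_of_nonneg (a := |f (x + 1)| + |f x| + |f (x + -1)|) (by positivity), abs_le]
  have h1 := rightDeriv_mul_le hf x (x + 1)
  have h2 := rightDeriv_mul_le hf x (x + -1)
  have h3 := neg_abs_le (f (x + -1))
  have h4 := neg_abs_le (f x)
  have h5 := neg_abs_le (f (x + 1))
  have h6 := le_abs_self (f (x + -1))
  have h7 := le_abs_self (f x)
  have h8 := le_abs_self (f (x + 1))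
  constructor <;> linarith

lemma measurable_of_convexOn (hf : ConvexOn ℝ univ f) : Measurable f :=
  (continuousOn_univ.1 (hf.continuousOn isOpen_univ)).measurable

/-- A monotone function that is negative at `-∞` and positive at `∞`. -/
structure IsMarginal (φ : ℝ → ℝ) : Prop where
  mono : Monotone φ
  growth : HasPolyGrowth φ
  atTop : ∃ a c, 0 < c ∧ ∀ u, a ≤ u → c ≤ φ u
  atBot : ∃ a c, 0 < c ∧ ∀ u, u ≤ a → φ u ≤ -c

lemma CostAssumption.isMarginal {C q : ℝ} (h : CostAssumption f C q) :
    IsMarginal fun u => rightDeriv f u + C * q where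
  mono := (monotone_rightDeriv h.convex).add_const _
  growth := (hasPolyGrowth_rightDeriv h.convex h.growth).add (hasPolyGrowth_const _)
  atTop := by
    obtain ⟨l, hl, hlt⟩ := h.slope_atTop
    obtain ⟨c, hc1, hc2⟩ := EReal.lt_iff_exists_real_btwn.1 hlt
    obtain ⟨a, ha⟩ := eventually_atTop.1 (hl.eventually_const_lt hc2)
    rw [EReal.coe_lt_coe_iff] at hc1
    refine ⟨a, c + C * q, by linarith, fun u hu => ?_⟩
    have := EReal.coe_lt_coe_iff.1 (ha u hu)
    linarith
  atBot := by
    obtain ⟨l, hl, hlt⟩ := h.slope_atBot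
    obtain ⟨c, hc1, hc2⟩ := EReal.lt_iff_exists_real_btwn.1 hlt
    obtain ⟨a, ha⟩ := eventually_atBot.1 (hl.eventually_lt_const hc1)
    rw [EReal.coe_lt_coe_iff] at hc2
    refine ⟨a, -(c + C * q), by linarith, fun u hu => ?_⟩
    have := EReal.coe_lt_coe_iff.1 (ha u hu)
    linarith

/-! ### Translates of a random variable -/

section

variable {α : Type*} [MeasurableSpace α] {μ : Measure α} {Z : α → ℝ}
  {φ : ℝ → ℝ}

lemma monotone_integral_add (hφ : Monotone φ) (hi : ∀ b, Integrable (fun y => φ (b + Z y)) μ) :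
    Monotone fun b => ∫ y, φ (b + Z y) ∂μ :=
  fun _ _ h => integral_mono (hi _) (hi _) fun y => hφ (by linarith)

lemma continuous_integral_add (hφ : Monotone φ) (hi : ∀ b, Integrable (fun y => φ (b + Z y)) μ)
    (hS : ∀ b (S : Set ℝ), S.Countable → ∀ᵐ y ∂μ, b + Z y ∉ S) :
    Continuous fun b => ∫ y, φ (b + Z y) ∂μ := by
  refine continuous_iff_continuousAt.2 fun b => ?_
  refine continuousAt_of_dominated (bound := fun y => |φ (b - 1 + Z y)| + |φ (b + 1 + Z y)|)
    (Eventually.of_forall fun c => (hi c).aestronglyMeasurable) ?_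
    ((hi _).abs.add (hi _).abs) ?_
  · filter_upwards [Ioo_mem_nhds (by linarith : b - 1 < b) (by linarith : b < b + 1)] with c hc
    refine Eventually.of_forall fun y => ?_
    have h1 : φ (b - 1 + Z y) ≤ φ (c + Z y) := hφ (by linarith [hc.1])
    have h2 : φ (c + Z y) ≤ φ (b + 1 + Z y) := hφ (by linarith [hc.2])
    rw [Real.norm_eq_abs, abs_le]
    constructor
    · linarith [neg_abs_le (φ (b - 1 + Z y)), abs_nonneg (φ (b + 1 + Z y))]
    · linarith [le_abs_self (φ (b + 1 + Z y)), abs_nonneg (φ (b - 1 + Z y))]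
  · filter_upwards [hS b _ hφ.countable_not_continuousAt] with y hy
    have h1 : ContinuousAt φ (b + Z y) := not_not.1 hy
    exact ContinuousAt.comp (f := fun c => c + Z y) h1 (by fun_prop)

lemma exists_integral_add_pos [IsFiniteMeasure μ] [NeZero μ] (hφ : Monotone φ)
    (hi : ∀ b, Integrable (fun y => φ (b + Z y)) μ)
    (htop : ∃ a c, 0 < c ∧ ∀ u, a ≤ u → c ≤ φ u) : ∃ b, 0 < ∫ y, φ (b + Z y) ∂μ := by
  obtain ⟨a, c, hc, ha⟩ := htop
  have h1 : Tendsto (fun n : ℕ => ∫ y, min (φ (n + Z y)) c ∂μ) atTop (𝓝 (∫ _, c ∂μ)) := by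
    refine tendsto_integral_of_dominated_convergence (fun y => |φ (0 + Z y)| + c)
      (fun n => ((hi n).inf (integrable_const c)).aestronglyMeasurable)
      ((hi 0).abs.add (integrable_const c)) (fun n => Eventually.of_forall fun y => ?_)
      (Eventually.of_forall fun y => ?_)
    · have h1 : φ (0 + Z y) ≤ φ (n + Z y) := hφ (by linarith [n.cast_nonneg (α := ℝ)])
      rw [Real.norm_eq_abs, abs_le]
      constructor
      · refine le_min ?_ ?_ <;> linarith [neg_abs_le (φ (0 + Z y)), abs_nonneg (φ (0 + Z y))]
      · linarith [min_le_right (φ (n + Z y)) c, abs_nonneg (φ (0 + Z y))]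
    · refine tendsto_const_nhds.congr' ?_
      filter_upwards [tendsto_natCast_atTop_atTop.eventually_ge_atTop (a - Z y)] with n hn
      exact (min_eq_right (ha _ (by linarith))).symm
  have h2 : 0 < ∫ _, c ∂μ := by
    rw [integral_const, smul_eq_mul]
    exact mul_pos measureReal_univ_pos hc
  obtain ⟨n, hn⟩ := (h1.eventually_const_lt h2).exists
  exact ⟨n, hn.trans_le (integral_mono ((hi n).inf (integrable_const c)) (hi n)
    fun y => min_le_left _ _)⟩

lemma exists_integral_add_neg [IsFiniteMeasure μ] [NeZero μ] (hφ : Monotone φ)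
    (hi : ∀ b, Integrable (fun y => φ (b + Z y)) μ)
    (hbot : ∃ a c, 0 < c ∧ ∀ u, u ≤ a → φ u ≤ -c) : ∃ b, ∫ y, φ (b + Z y) ∂μ < 0 := by
  obtain ⟨a, c, hc, ha⟩ := hbot
  have h1 : ∀ b y, -φ (-(b + -Z y)) = -φ (-b + Z y) := fun b y => by congr 2; ring
  obtain ⟨b, hb⟩ := exists_integral_add_pos (μ := μ) (Z := fun y => -Z y)
    (φ := fun u => -φ (-u)) (fun u v h => neg_le_neg (hφ (neg_le_neg h)))
    (fun b => by simp_rw [h1]; exact (hi _).neg)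
    ⟨-a, c, hc, fun u hu => by linarith [ha (-u) (by linarith)]⟩
  refine ⟨-b, ?_⟩
  simp_rw [h1, integral_neg] at hb
  linarith

end

lemma apply_sInf_nonneg_eq_zero {r : ℝ → ℝ} (hr : Monotone r) (hc : Continuous r)
    (hpos : ∃ b, 0 < r b) (hneg : ∃ b, r b < 0) :
    {b | 0 ≤ r b}.Nonempty ∧ BddBelow {b | 0 ≤ r b} ∧ r (sInf {b | 0 ≤ r b}) = 0 := by
  obtain ⟨b₁, h₁⟩ := hpos
  obtain ⟨b₀, h₀⟩ := hneg
  have hne : {b | 0 ≤ r b}.Nonempty := ⟨b₁, h₁.le⟩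
  have hbdd : BddBelow {b | 0 ≤ r b} := ⟨b₀, fun b hb => by
    by_contra! h
    exact absurd (hr h.le) (not_le.2 (h₀.trans_le hb))⟩
  refine ⟨hne, hbdd, le_antisymm ?_ ((isClosed_le continuous_const hc).csInf_mem hne hbdd)⟩
  by_contra! h
  set a := sInf {b | 0 ≤ r b}
  have h1 : ∀ᶠ b in 𝓝[<] a, 0 < r b :=
    nhdsWithin_le_nhds ((hc.tendsto a).eventually_const_lt h)
  obtain ⟨b, hb, hlt⟩ := (h1.and self_mem_nhdsWithin).exists
  exact absurd (csInf_le hbdd hb.le) (not_le.2 hlt)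

/-! ### The marginal cost of the barrier -/

variable {Ω : Type*} [MeasurableSpace Ω] {P : Measure Ω} {X : ℝ≥0 → Ω → ℝ} {γ σ : ℝ}
  {Λ : Measure ℝ} {T : ℕ → Ω → ℝ≥0} {η q : ℝ} [IsProbabilityMeasure P] {φ : ℝ → ℝ}

lemma IsModel.ae_ctrlProc_self (h : IsModel P X T γ σ Λ η q) (b : ℝ) :
    ∀ᵐ y ∂(P.prod (expTime q)), ctrlProc X T b b y = b + ctrlProc X T 0 0 y := by
  filter_upwards [ae_prod_of_ae_fst (ν := expTime q) (h.arrivals.ae_isArrivalSeq h.eta_pos)]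
    with y hy
  have := pushed_add_const hy 0 b (evalRight fun t => X t y.1) y.2.toNNReal
  rw [zero_add] at this
  rw [ctrlProc, ctrlProc, ctrl, ctrl, this]
  ring

lemma IsModel.integrable_of_growth (h : IsModel P X T γ σ Λ η q) (b x : ℝ) {g : ℝ → ℝ}
    (hg : Measurable g) (hgr : HasPolyGrowth g) :
    Integrable (fun y => g (ctrlProc X T b x y)) (P.prod (expTime q)) := by
  obtain ⟨k₁, k₂, N, hN⟩ := hgr
  exact h.integrable_ctrlProc b x hg hN

lemma IsModel.expValue_self (h : IsModel P X T γ σ Λ η q) (g : ℝ → ℝ) (b : ℝ) :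
    expValue P X T q g b b = ∫ y, g (b + ctrlProc X T 0 0 y) ∂(P.prod (expTime q)) := by
  refine integral_congr_ae ?_
  filter_upwards [h.ae_ctrlProc_self b] with y hy
  rw [hy]

lemma IsModel.measureReal_univ (h : IsModel P X T γ σ Λ η q) :
    (P.prod (expTime q)).real univ = 1 / q := by
  have := isFiniteMeasure_expTime h.q_pos
  have h1 := integral_expTime q fun _ => (1 : ℝ)
  simp only [integral_const, smul_eq_mul, mul_one] at h1
  rw [← univ_prod_univ, measureReal_prod_prod, probReal_univ, one_mul, h1,
    integral_exp_neg_mul_Ioi h.q_pos]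
  simp

/-- The marginal cost vanishes at its first nonnegativity point. -/
theorem IsModel.expValue_marginal (h : IsModel P X T γ σ Λ η q) (hφ : IsMarginal φ) :
    {b | 0 ≤ expValue P X T q φ b b}.Nonempty ∧ BddBelow {b | 0 ≤ expValue P X T q φ b b} ∧
      expValue P X T q φ (sInf {b | 0 ≤ expValue P X T q φ b b})
        (sInf {b | 0 ≤ expValue P X T q φ b b}) = 0 := by
  have := isFiniteMeasure_expTime h.q_pos
  have : NeZero (P.prod (expTime q)) := ⟨fun h0 => by
    have := h.measureReal_univ
    rw [h0] at this
    simp at this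
    exact h.q_pos.ne' this.symm⟩
  have hi : ∀ b, Integrable (fun y => φ (b + ctrlProc X T 0 0 y)) (P.prod (expTime q)) := by
    intro b
    refine (h.integrable_of_growth b b hφ.mono.measurable hφ.growth).congr ?_
    filter_upwards [h.ae_ctrlProc_self b] with y hy
    rw [hy]
  have hS : ∀ b (S : Set ℝ), S.Countable →
      ∀ᵐ y ∂(P.prod (expTime q)), b + ctrlProc X T 0 0 y ∉ S := by
    intro b S hS
    filter_upwards [h.ae_ctrlProc_self b, h.ae_ctrlProc_notMem b b hS] with y h1 h2
    rwa [← h1]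
  simp_rw [h.expValue_self]
  exact apply_sInf_nonneg_eq_zero (monotone_integral_add hφ.mono hi)
    (continuous_integral_add hφ.mono hi hS) (exists_integral_add_pos hφ.mono hi hφ.atTop)
    (exists_integral_add_neg hφ.mono hi hφ.atBot)

end

end PeriodicBarrier

namespace PeriodicBarrier

section

variable {Ω : Type*} {X : ℝ≥0 → Ω → ℝ} {T : ℕ → Ω → ℝ≥0}

/-! ### Comparison of starting points -/

/-- The difference of the controlled processes started at `z` and `x`, stopped at the `k`-th
arrival time. -/
noncomputable def gap (X : ℝ≥0 → Ω → ℝ) (T : ℕ → Ω → ℝ≥0) (b x z : ℝ) (k : ℕ) (y : Ω × ℝ) : ℝ :=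
  pushed b z (evalRight fun t => X t y.1) (fun j => T j y.1) (min y.2.toNNReal (T k y.1)) -
    pushed b x (evalRight fun t => X t y.1) (fun j => T j y.1) (min y.2.toNNReal (T k y.1))

/-- The change of the gap at the `k`-th arrival time. -/
noncomputable def gapStep (b x z : ℝ) (k : ℕ) (o : ℕ → ℝ≥0 × ℝ) : ℝ :=
  (level b z (fun j => (o j).2) (k + 1) - level b z (fun j => (o j).2) k) -
    (level b x (fun j => (o j).2) (k + 1) - level b x (fun j => (o j).2) k)

lemma measurable_gapStep (b x z : ℝ) (k : ℕ) : Measurable (gapStep b x z k) := by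
  have h : ∀ (c : ℝ) (k : ℕ), Measurable fun o : ℕ → ℝ≥0 × ℝ => level b c (fun j => (o j).2) k :=
    fun c k => measurable_level measurable_const (by fun_prop) k
  exact ((h z _).sub (h z _)).sub ((h x _).sub (h x _))

lemma abs_gapStep_le (b x z : ℝ) (k : ℕ) (o : ℕ → ℝ≥0 × ℝ) :
    |gapStep b x z k o| ≤ |z - x| + |z - x| := by
  rw [gapStep, sub_sub_sub_comm]
  exact (abs_sub _ _).trans (add_le_add (abs_level_sub_level_le b x z _ _)
    (abs_level_sub_level_le b x z _ _))

lemma gap_succ_sub {y : Ω × ℝ} (hτ : IsArrivalSeq fun j => T j y.1) (hy : 0 ≤ y.2)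
    (b x z : ℝ) (k : ℕ) :
    gap X T b x z (k + 1) y - gap X T b x z k y =
      {y : Ω × ℝ | (T (k + 1) y.1 : ℝ) ≤ y.2}.indicator
        (fun y => gapStep b x z k (pastObs X T (k + 1) y.1)) y := by
  have h1 := pushed_min_succ_sub hτ b z (evalRight fun t => X t y.1) y.2.toNNReal k
  have h2 := pushed_min_succ_sub hτ b x (evalRight fun t => X t y.1) y.2.toNNReal k
  have h3 : gap X T b x z (k + 1) y - gap X T b x z k y = _ - _ := sub_sub_sub_comm _ _ _ _
  rw [h3, h1, h2]
  have hle : T (k + 1) y.1 ≤ y.2.toNNReal ↔ (T (k + 1) y.1 : ℝ) ≤ y.2 :=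
    Real.le_toNNReal_iff_coe_le hy
  by_cases h : (T (k + 1) y.1 : ℝ) ≤ y.2
  · rw [if_pos (hle.2 h), if_pos (hle.2 h), indicator_of_mem (by exact h)]
    have hlev : ∀ (c : ℝ) (i : ℕ), i ≤ k + 1 →
        level b c (fun j => (pastObs X T (k + 1) y.1 j).2) i =
          level b c (fun j => evalRight (fun t => X t y.1) (T j y.1)) i := fun c i hi => by
      refine level_congr b c fun j hj => ?_
      simp only [pastObs, observations]
      rw [min_eq_left (hj.trans hi)]
    rw [gapStep, hlev z _ le_rfl, hlev z _ (Nat.le_succ k), hlev x _ le_rfl,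
      hlev x _ (Nat.le_succ k)]
  · rw [if_neg (hle.not.2 h), if_neg (hle.not.2 h), indicator_of_notMem (by exact h), sub_zero]

lemma gapStep_mul_nonneg (b x z : ℝ) (k : ℕ) (o : ℕ → ℝ≥0 × ℝ) {W : ℝ → ℝ}
    (hW : Monotone W) (hWb : W b = 0) : 0 ≤ gapStep b x z k o * W (position b x (k + 1) o) := by
  have hpos : position b x (k + 1) o = (o (k + 1)).2 +
      max (level b x (fun j => (o j).2) k) (b - (o (k + 1)).2) := rfl
  set A := level b x (fun j => (o j).2) k
  set B := level b z (fun j => (o j).2) k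
  set c := b - (o (k + 1)).2
  have hstep : gapStep b x z k o = (max B c - B) - (max A c - A) := rfl
  have hWp : 0 ≤ W (position b x (k + 1) o) := by
    rw [← hWb]
    refine hW ?_
    rw [hpos]
    linarith [le_max_right A c]
  rcases le_or_gt c A with hc | hc
  · refine mul_nonneg ?_ hWp
    rw [hstep, max_eq_left hc]
    linarith [le_max_left B c]
  · have : position b x (k + 1) o = b := by
      rw [hpos, max_eq_right hc.le]
      ring
    rw [this, hWb, mul_zero]

variable [MeasurableSpace Ω] {P : Measure Ω} {γ σ : ℝ} {Λ : Measure ℝ} {η q : ℝ} {φ : ℝ → ℝ}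

lemma IsModel.measurable_gap (h : IsModel P X T γ σ Λ η q) (b x z : ℝ) (k : ℕ) :
    Measurable (gap X T b x z k) := by
  have hp : Measurable fun y : Ω × ℝ => fun t => X t y.1 :=
    h.levy.measurable_path.comp measurable_fst
  have hτ : Measurable fun y : Ω × ℝ => fun j => T j y.1 :=
    h.arrivals.measurable_seq.comp measurable_fst
  have hk := h.arrivals.measurable k
  exact (measurable_pushed measurable_const hp hτ (by fun_prop)).sub
    (measurable_pushed measurable_const hp hτ (by fun_prop))

lemma integrable_prod_expTime_iff [SFinite P] {G : Ω × ℝ → ℝ} : Integrable G (P.prod (expTime q)) ↔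
    Integrable (fun y => Real.exp (-(q * y.2)) * G y) (P.prod (volume.restrict (Ioi 0))) := by
  rw [expTime, prod_withDensity_right (by fun_prop), integrable_withDensity_iff_integrable_smul'
    (by fun_prop) (Eventually.of_forall fun _ => ENNReal.ofReal_lt_top)]
  simp only [ENNReal.toReal_ofReal (Real.exp_nonneg _), smul_eq_mul]

variable [IsProbabilityMeasure P]

lemma IsModel.expValue_mono (h : IsModel P X T γ σ Λ η q) (hφ : IsMarginal φ) (b : ℝ) :
    Monotone (expValue P X T q φ b) := by
  intro x z hxz
  refine integral_mono_ae (h.integrable_of_growth b x hφ.mono.measurable hφ.growth)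
    (h.integrable_of_growth b z hφ.mono.measurable hφ.growth) ?_
  filter_upwards [ae_prod_of_ae_fst (ν := expTime q) (h.arrivals.ae_isArrivalSeq h.eta_pos)]
    with y hy
  exact hφ.mono (add_le_add le_rfl (pushed_mono hy b hxz _ _))

/-- The first order condition: the derivative of the expected cost at a starting point `x ≥ b` in
the direction of `z`. -/
theorem IsModel.integral_marginal_mul_nonneg (h : IsModel P X T γ σ Λ η q) (hφ : IsMarginal φ)
    {b x z : ℝ} (hb : expValue P X T q φ b b = 0) (hbx : b ≤ x) (hxz : x ≤ z ∨ x = b) :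
    Integrable (fun y => (ctrlProc X T b z y - ctrlProc X T b x y) * φ (ctrlProc X T b x y))
      (P.prod (expTime q)) ∧
    0 ≤ ∫ y, (ctrlProc X T b z y - ctrlProc X T b x y) * φ (ctrlProc X T b x y)
      ∂(P.prod (expTime q)) := by
  have := isFiniteMeasure_expTime h.q_pos
  have hi := h.integrable_of_growth b x hφ.mono.measurable hφ.growth
  have harr := ae_prod_of_ae_fst (ν := expTime q) (h.arrivals.ae_isArrivalSeq h.eta_pos)
  have hpos := ae_prod_of_ae_snd (μ := P) (ae_expTime_pos q)
  have hmul : ∀ {F : Ω × ℝ → ℝ} {c : ℝ}, Measurable F →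
      (∀ᵐ y ∂(P.prod (expTime q)), |F y| ≤ c) →
      Integrable (fun y => F y * φ (ctrlProc X T b x y)) (P.prod (expTime q)) :=
    fun hF hb => hi.bdd_mul hF.aestronglyMeasurable hb
  have hgap : ∀ k, ∀ᵐ y ∂(P.prod (expTime q)), |gap X T b x z k y| ≤ |z - x| := fun k => by
    filter_upwards [harr] with y hy
    exact abs_pushed_sub_pushed_le hy b x z _ _
  have hgi : ∀ k, Integrable (fun y => gap X T b x z k y * φ (ctrlProc X T b x y))
      (P.prod (expTime q)) := fun k => hmul (h.measurable_gap b x z k) (hgap k)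
  set a : ℕ → ℝ := fun k => ∫ y, gap X T b x z k y * φ (ctrlProc X T b x y) ∂(P.prod (expTime q))
  have ha0 : 0 ≤ a 0 := by
    have h1 : a 0 = (z - x) * expValue P X T q φ b x := by
      rw [expValue, ← integral_const_mul]
      refine integral_congr_ae ?_
      filter_upwards [harr] with y hy
      have h2 : ∀ c, pushed b c (evalRight fun t => X t y.1) (fun j => T j y.1)
          (min y.2.toNNReal (T 0 y.1)) = c := fun c => by
        rw [hy.zero, min_eq_right zero_le]
        have := pushed_arrival hy b c (evalRight fun t => X t y.1) 0
        rwa [hy.zero] at this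
      rw [gap, h2, h2]
    rw [h1]
    rcases hxz with hxz | rfl
    · exact mul_nonneg (sub_nonneg.2 hxz) (hb ▸ h.expValue_mono hφ b hbx)
    · rw [hb, mul_zero]
  have hstep : ∀ k, a k ≤ a (k + 1) := by
    intro k
    rw [← sub_nonneg]
    have hset : MeasurableSet {y : Ω × ℝ | (T (k + 1) y.1 : ℝ) ≤ y.2} := by
      have := h.arrivals.measurable (k + 1)
      exact measurableSet_le (by fun_prop) (by fun_prop)
    set S := {y : Ω × ℝ | (T (k + 1) y.1 : ℝ) ≤ y.2}
    have hw : Measurable (gapStep b x z k) := measurable_gapStep b x z k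
    have hsi : Integrable (fun y => gapStep b x z k (pastObs X T (k + 1) y.1) *
        φ (ctrlProc X T b x y)) (P.prod (expTime q)) := by
      refine hmul (hw.comp ((measurable_pastObs h.levy h.arrivals _).comp measurable_fst))
        (Eventually.of_forall fun y => abs_gapStep_le b x z k _)
    have h1 : a (k + 1) - a k = ∫ y in S, gapStep b x z k (pastObs X T (k + 1) y.1) *
        φ (ctrlProc X T b x y) ∂(P.prod (expTime q)) := by
      rw [← integral_sub (hgi _) (hgi _), ← integral_indicator hset]
      refine integral_congr_ae ?_
      filter_upwards [harr, hpos] with y h1 h2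
      rw [← sub_mul, gap_succ_sub h1 h2.le]
      by_cases hy : y ∈ S
      · rw [indicator_of_mem hy, indicator_of_mem hy]
      · rw [indicator_of_notMem hy, indicator_of_notMem hy, zero_mul]
    rw [h1, h.setIntegral_regeneration b x (k + 1) hφ.mono.measurable hw hsi]
    exact integral_nonneg fun ω => mul_nonneg (Real.exp_nonneg _)
      (gapStep_mul_nonneg b x z k _ (h.expValue_mono hφ b) hb)
  have hanonneg : ∀ k, 0 ≤ a k := fun k => ha0.trans (monotone_nat_of_le_succ hstep (Nat.zero_le k))
  have hdiff : ∀ y, ctrlProc X T b z y - ctrlProc X T b x y =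
      pushed b z (evalRight fun t => X t y.1) (fun j => T j y.1) y.2.toNNReal -
        pushed b x (evalRight fun t => X t y.1) (fun j => T j y.1) y.2.toNNReal := fun y =>
    add_sub_add_left_eq_sub _ _ _
  refine ⟨hmul (c := |z - x|) ((measurable_ctrlProc h.levy h.arrivals b z).sub
    (measurable_ctrlProc h.levy h.arrivals b x)) ?_, ?_⟩
  · filter_upwards [harr] with y hy
    rw [hdiff]
    exact abs_pushed_sub_pushed_le hy b x z _ _
  refine ge_of_tendsto' (f := a) (x := atTop) ?_ hanonneg
  refine tendsto_integral_of_dominated_convergence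
    (fun y => |z - x| * |φ (ctrlProc X T b x y)|) (fun k => (hgi k).aestronglyMeasurable)
    (hi.abs.const_mul _) (fun k => ?_) ?_
  · filter_upwards [hgap k] with y hy
    rw [norm_mul, Real.norm_eq_abs, Real.norm_eq_abs]
    gcongr
  · filter_upwards [harr] with y hy
    refine Tendsto.mul_const _ ?_
    rw [hdiff]
    exact (tendsto_pushed_min hy b z (evalRight fun t => X t y.1) y.2.toNNReal).sub
      (tendsto_pushed_min hy b x (evalRight fun t => X t y.1) y.2.toNNReal)

/-- Starting at `x ≥ b` is cheaper than starting at `z ≥ x`, and starting at `b` is cheaper than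
starting anywhere else. -/
theorem IsModel.expValue_le (h : IsModel P X T γ σ Λ η q) (hφ : IsMarginal φ)
    {g : ℝ → ℝ} (hg : Measurable g) (hgr : HasPolyGrowth g)
    (hsub : ∀ u v, φ u * (v - u) ≤ g v - g u)
    {b x z : ℝ} (hb : expValue P X T q φ b b = 0) (hbx : b ≤ x) (hxz : x ≤ z ∨ x = b) :
    expValue P X T q g b x ≤ expValue P X T q g b z := by
  have hx := h.integrable_of_growth b x hg hgr
  have hz := h.integrable_of_growth b z hg hgr
  obtain ⟨hi, h0⟩ := h.integral_marginal_mul_nonneg hφ hb hbx hxz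
  rw [← sub_nonneg, expValue, expValue, ← integral_sub hz hx]
  refine h0.trans (integral_mono hi (hz.sub hx) fun y => ?_)
  simp only [mul_comm (_ - _)]
  exact hsub _ _

/-! ### The expected cost -/

lemma IsModel.ae_U_eq (h : IsModel P X T γ σ Λ η q) (b x : ℝ) :
    ∀ᵐ ω ∂P, ∀ t : ℝ, U X T b x t.toNNReal ω = ctrlProc X T b x (ω, t) := by
  filter_upwards [h.levy.ae_evalRight, h.arrivals.ae_isArrivalSeq h.eta_pos] with ω h1 h2 t
  rw [U, controlled_eq x b (fun s => X s ω) h2, ctrlProc, h1]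

lemma IsModel.hasFiniteRunningCost (h : IsModel P X T γ σ Λ η q) (b x : ℝ) {g : ℝ → ℝ}
    (hg : Measurable g) (hgr : HasPolyGrowth g) : HasFiniteRunningCost P X T q g b x := by
  refine (integrable_prod_expTime_iff.1 (h.integrable_of_growth b x hg hgr)).congr ?_
  filter_upwards [ae_prod_of_ae_fst (ν := volume.restrict (Ioi 0)) (h.ae_U_eq b x)] with y hy
  rw [hy]

lemma IsModel.ae_integral_U_eq (h : IsModel P X T γ σ Λ η q) (b x : ℝ) (g : ℝ → ℝ) :
    ∀ᵐ ω ∂P, ∫ t in Ioi (0 : ℝ), Real.exp (-(q * t)) * g (U X T b x t.toNNReal ω) =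
      ∫ t, g (ctrlProc X T b x (ω, t)) ∂(expTime q) := by
  filter_upwards [h.ae_U_eq b x] with ω hω
  rw [integral_expTime]
  simp only [hω, smul_eq_mul]

lemma IsModel.integral_integral_eq (h : IsModel P X T γ σ Λ η q) (b x : ℝ) {g : ℝ → ℝ}
    (hg : Measurable g) (hgr : HasPolyGrowth g) :
    ∫ ω, (∫ t in Ioi (0 : ℝ), Real.exp (-(q * t)) * g (U X T b x t.toNNReal ω)) ∂P =
      expValue P X T q g b x := by
  rw [integral_congr_ae (h.ae_integral_U_eq b x g), expValue,
    integral_prod _ (h.integrable_of_growth b x hg hgr)]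

lemma IsModel.expValue_add_const (h : IsModel P X T γ σ Λ η q) (b x : ℝ) {g : ℝ → ℝ}
    (hg : Measurable g) (hgr : HasPolyGrowth g) (c : ℝ) :
    expValue P X T q (fun u => g u + c) b x = expValue P X T q g b x + c / q := by
  have := isFiniteMeasure_expTime h.q_pos
  rw [expValue, integral_add (h.integrable_of_growth b x hg hgr) (integrable_const c),
    integral_const, h.measureReal_univ, smul_eq_mul, expValue]
  ring

lemma IsModel.integrable_evalRight (h : IsModel P X T γ σ Λ η q) :
    Integrable (fun y : Ω × ℝ => evalRight (fun t => X t y.1) y.2.toNNReal)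
      (P.prod (expTime q)) := by
  have h1 : Integrable (fun z : ℝ => z) (potential P X q) := by
    refine ⟨by fun_prop, ?_⟩
    rw [hasFiniteIntegral_iff_norm]
    simpa using h.lintegral_potential_lt_top 0 1 (k₁ := 0) (k₂ := 1)
  refine ((integrable_map_measure (by fun_prop) (h.levy.aemeasurable_uncurry _)).1 h1).congr ?_
  filter_upwards [ae_prod_of_ae_fst (ν := expTime q) h.levy.ae_evalRight] with y hy
  rw [hy]
  rfl

/-- The amount of control, as a function on the product of `Ω` with the time axis. -/
noncomputable def amount (X : ℝ≥0 → Ω → ℝ) (T : ℕ → Ω → ℝ≥0) (b x : ℝ) (y : Ω × ℝ) : ℝ :=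
  ctrlProc X T b x y - x - evalRight (fun t => X t y.1) y.2.toNNReal

lemma IsModel.integrable_amount (h : IsModel P X T γ σ Λ η q) (b x : ℝ) :
    Integrable (amount X T b x) (P.prod (expTime q)) := by
  have := isFiniteMeasure_expTime h.q_pos
  exact ((h.integrable_of_growth b x measurable_id
    ((hasPolyGrowth_const_mul 1).of_abs_le fun x => by simp)).sub
      (integrable_const x)).sub h.integrable_evalRight

lemma IsModel.integral_amount (h : IsModel P X T γ σ Λ η q) (b x : ℝ) :
    ∫ y, amount X T b x y ∂(P.prod (expTime q)) = expValue P X T q (fun u => u) b x - x / q -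
      ∫ y, evalRight (fun t => X t y.1) y.2.toNNReal ∂(P.prod (expTime q)) := by
  have := isFiniteMeasure_expTime h.q_pos
  have h1 : Integrable (ctrlProc X T b x) (P.prod (expTime q)) :=
    h.integrable_of_growth b x measurable_id
      ((hasPolyGrowth_const_mul 1).of_abs_le fun x => by simp)
  have h2 : Integrable (fun y => ctrlProc X T b x y - x) (P.prod (expTime q)) :=
    h1.sub (integrable_const x)
  simp only [amount]
  rw [integral_sub h2 h.integrable_evalRight,
    integral_sub h1 (integrable_const x), integral_const, h.measureReal_univ, smul_eq_mul, expValue]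
  ring

lemma IsModel.ae_integral_dR (h : IsModel P X T γ σ Λ η q) (b x : ℝ) :
    ∀ᵐ ω ∂P, Integrable (fun t : ℝ≥0 => Real.exp (-(q * t))) (dR X T b x ω) ∧
      ∫ t : ℝ≥0, Real.exp (-(q * t)) ∂(dR X T b x ω) =
        q * ∫ t, amount X T b x (ω, t) ∂(expTime q) := by
  filter_upwards [h.levy.ae_evalRight, h.arrivals.ae_isArrivalSeq h.eta_pos,
    (h.integrable_amount b x).prod_right_ae] with ω h1 h2 h3
  have hnn : ∀ t, 0 ≤ amount X T b x (ω, t) := fun t => by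
    obtain ⟨k, hk1, hk2⟩ := h2.exists_index t.toNNReal
    rw [amount, ctrlProc, ctrl, pushed_eq h2 b x _ hk1 hk2]
    linarith [le_level b x (fun j => evalRight (fun t => X t ω) (T j ω)) k]
  have h4 := lintegral_controlMeasure x b (fun s => X s ω) h2 h.q_pos
  have h5 : ∀ t : ℝ, pushed b x (fun s => X s ω) (fun k => T k ω) t.toNNReal - x =
      amount X T b x (ω, t) := fun t => by
    rw [amount, ctrlProc, ctrl, h1]
    ring
  simp_rw [h5] at h4
  rw [← ofReal_integral_eq_lintegral_ofReal h3 (Eventually.of_forall hnn),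
    ← ENNReal.ofReal_mul h.q_pos.le] at h4
  have hint : Integrable (fun t : ℝ≥0 => Real.exp (-(q * t))) (dR X T b x ω) := by
    refine ⟨by fun_prop, ?_⟩
    rw [hasFiniteIntegral_iff_ofReal (Eventually.of_forall fun _ => Real.exp_nonneg _)]
    exact h4 ▸ ENNReal.ofReal_lt_top
  refine ⟨hint, ?_⟩
  rw [integral_eq_lintegral_of_nonneg_ae (Eventually.of_forall fun _ => Real.exp_nonneg _)
    hint.aestronglyMeasurable]
  refine (congrArg ENNReal.toReal h4).trans (ENNReal.toReal_ofReal ?_)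
  exact mul_nonneg h.q_pos.le (integral_nonneg hnn)

lemma IsModel.hasFiniteControlCost (h : IsModel P X T γ σ Λ η q) (b x : ℝ) :
    HasFiniteControlCost P X T q b x := by
  refine ⟨(h.ae_integral_dR b x).mono fun _ h => h.1, ?_⟩
  refine ((h.integrable_amount b x).integral_prod_left.const_mul q).congr ?_
  filter_upwards [h.ae_integral_dR b x] with ω hω
  exact hω.2.symm

/-- The expected total cost in terms of the modified running cost `f(u) + Cqu`. -/
theorem IsModel.cost_eq (h : IsModel P X T γ σ Λ η q) {f : ℝ → ℝ} (hf : Measurable f)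
    (hgr : HasPolyGrowth f) (C b x : ℝ) :
    cost P X T q C f b x = expValue P X T q (fun u => f u + C * q * u) b x - C * x -
      C * q * ∫ y, evalRight (fun t => X t y.1) y.2.toNNReal ∂(P.prod (expTime q)) := by
  have hfi := h.integrable_of_growth b x hf hgr
  have hid : Integrable (ctrlProc X T b x) (P.prod (expTime q)) :=
    h.integrable_of_growth b x measurable_id
      ((hasPolyGrowth_const_mul 1).of_abs_le fun x => by simp)
  have h1 : cost P X T q C f b x = ∫ ω, ((∫ t, f (ctrlProc X T b x (ω, t)) ∂(expTime q)) +
      C * (q * ∫ t, amount X T b x (ω, t) ∂(expTime q))) ∂P := by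
    refine integral_congr_ae ?_
    filter_upwards [h.ae_integral_U_eq b x f, h.ae_integral_dR b x] with ω h1 h2
    rw [h1, h2.2]
  have h2 : expValue P X T q (fun u => f u + C * q * u) b x =
      expValue P X T q f b x + C * q * expValue P X T q (fun u => u) b x := by
    rw [expValue, integral_add hfi (hid.const_mul _), integral_const_mul]
    rfl
  have hq := h.q_pos.ne'
  rw [h1, integral_add hfi.integral_prod_left
    (((h.integrable_amount b x).integral_prod_left.const_mul q).const_mul C),
    integral_const_mul, integral_const_mul, ← integral_prod _ hfi,
    ← integral_prod _ (h.integrable_amount b x), h.integral_amount, h2]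
  rw [show ∫ y, f (ctrlProc X T b x y) ∂(P.prod (expTime q)) = expValue P X T q f b x from rfl]
  field_simp
  ring

end

end PeriodicBarrier

theorem proposition4p3 {Ω : Type*} [MeasurableSpace Ω] (P : Measure Ω) [IsProbabilityMeasure P]
    (X : ℝ≥0 → Ω → ℝ) (T : ℕ → Ω → ℝ≥0) (γ σ : ℝ) (Λ : Measure ℝ) (η q C : ℝ) (f : ℝ → ℝ)
    (hη : 0 < η) (hq : 0 < q)
    (hX : PeriodicBarrier.IsLevyProcess P X γ σ Λ)
    (hT : PeriodicBarrier.IsPoissonArrivals P T η)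
    (hXT : IndepFun (fun ω t => X t ω) (fun ω k => T k ω) P)
    (hf : PeriodicBarrier.CostAssumption f C q)
    (hCP : ¬ PeriodicBarrier.IsDriftlessCompoundPoisson γ σ Λ)
    (hexp : ∃ θ : ℝ, 0 < θ ∧
      IntegrableOn (fun z : ℝ => Real.exp (θ * |z|)) (Ioo (-1 : ℝ) 1)ᶜ Λ) :
    -- `ρ` and `b*` are well defined and real
    (∀ b, PeriodicBarrier.HasFiniteRunningCost P X T q (PeriodicBarrier.rightDeriv f) b b) ∧
    (PeriodicBarrier.barrierSet P X T q C f).Nonempty ∧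
    BddBelow (PeriodicBarrier.barrierSet P X T q C f) ∧
    -- the expected costs under the strategy at `b*` are well defined and finite
    (∀ x, PeriodicBarrier.HasFiniteRunningCost P X T q f
        (PeriodicBarrier.bStar P X T q C f) x ∧
      PeriodicBarrier.HasFiniteControlCost P X T q (PeriodicBarrier.bStar P X T q C f) x) ∧
    -- the intervention operator at `v_{b*}`
    ∀ x, PeriodicBarrier.interventionOp C
        (PeriodicBarrier.cost P X T q C f (PeriodicBarrier.bStar P X T q C f)) x =
      ((C * max (PeriodicBarrier.bStar P X T q C f - x) 0 +
        PeriodicBarrier.cost P X T q C f (PeriodicBarrier.bStar P X T q C f)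
          (max x (PeriodicBarrier.bStar P X T q C f)) : ℝ) : EReal) := by
  have h : PeriodicBarrier.IsModel P X T γ σ Λ η q := ⟨hX, hT, hη, hq, hXT, hCP, hexp⟩
  have hfg : PeriodicBarrier.HasPolyGrowth f := hf.growth
  have hfm := PeriodicBarrier.measurable_of_convexOn hf.convex
  have hdm := (PeriodicBarrier.monotone_rightDeriv hf.convex).measurable
  have hdg := PeriodicBarrier.hasPolyGrowth_rightDeriv hf.convex hfg
  have hφ := hf.isMarginal
  have hset : PeriodicBarrier.barrierSet P X T q C f =
      {b | 0 ≤ PeriodicBarrier.expValue P X T q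
        (fun u => PeriodicBarrier.rightDeriv f u + C * q) b b} := by
    ext b
    rw [PeriodicBarrier.barrierSet, mem_ofPred_eq, mem_ofPred_eq, PeriodicBarrier.rho,
      h.integral_integral_eq b b hdm hdg, h.expValue_add_const b b hdm hdg, mul_div_assoc,
      div_self hq.ne', mul_one]
  obtain ⟨hne, hbdd, hzero⟩ := h.expValue_marginal hφ
  rw [← hset] at hne hbdd hzero
  refine ⟨fun b => h.hasFiniteRunningCost b b hdm hdg, hne, hbdd,
    fun x => ⟨h.hasFiniteRunningCost _ x hfm hfg, h.hasFiniteControlCost _ x⟩, fun x => ?_⟩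
  change PeriodicBarrier.expValue P X T q _ (PeriodicBarrier.bStar P X T q C f)
    (PeriodicBarrier.bStar P X T q C f) = 0 at hzero
  set b := PeriodicBarrier.bStar P X T q C f
  have hw : ∀ l, 0 ≤ l → PeriodicBarrier.expValue P X T q (fun u => f u + C * q * u) b (max x b) ≤
      PeriodicBarrier.expValue P X T q (fun u => f u + C * q * u) b (x + l) := by
    intro l hl
    refine h.expValue_le hφ (by fun_prop) (hfg.add (PeriodicBarrier.hasPolyGrowth_const_mul _))
      (fun u v => ?_) hzero (le_max_right x b) ?_
    · linarith [PeriodicBarrier.rightDeriv_mul_le hf.convex u v]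
    · rcases le_total b x with hbx | hbx
      · rw [max_eq_left hbx]
        exact Or.inl (by linarith)
      · exact Or.inr (max_eq_right hbx)
  have hmax : max (b - x) 0 = max x b - x := by
    rw [← max_sub_sub_right, sub_self, max_comm]
  have hcost := h.cost_eq hfm hfg C b
  refine le_antisymm ?_ (le_iInf₂ fun l hl => EReal.coe_le_coe_iff.2 ?_)
  · refine iInf₂_le_of_le (max (b - x) 0) (le_max_right _ _) (le_of_eq ?_)
    rw [hmax, add_sub_cancel]
  · rw [hmax, hcost, hcost]
    linarith [hw l hl]
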